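/- Let $\mathcal H$ be a separable complex Hilbert space of finite or infinite dimension, $\mathcal T(\mathcal H)$ its trace-class operators, and $\rho>0$ a density operator on $\mathcal H$ (so $\langle x,\rho x\rangle>0$ for all $x\neq0$). Operators $A$ may be unbounded; $RA\in\mathcal T(\mathcal H)$ means that $RA$ on $\operatorname{dom}A$ is the restriction of a trace-class operator, whose trace is written $\operatorname{Tr}[RA]$ when $A$ is densely defined. For self-adjoint $A$ with $\rho A,\rho A^2\in\mathcal T(\mathcal H)$ put $\sigma^2(A)=\operatorname{Tr}[\rho A^2]-\operatorname{Tr}[\rho A]^2$. *SLD Fisher information.* For a positive trace-class operator $\sigma$ and a self-adjoint trace-class operator $\tau$, let $J^{\mathrm S}_\sigma(\tau)=\operatorname{Tr}[\sigma L^2]=\|L\sqrt\sigma\|_{\mathrm{HS}}^2\in[0,\infty]$, where $L$ is a symmetric, possibly unbounded, solution of $\tfrac12(\sigma L+L\sigma)=\tau$. Precisely, $J^{\mathrm S}_\sigma(\tau)$ is the infimum of $\|Y\|_{\mathrm{HS}}^2$ over the bounded operators $Y$ (standing for $L\sqrt\sigma$) such that $\sqrt\sigma\,Y$ is self-adjoint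 and $\tfrac12(Y\sqrt\sigma+\sqrt\sigma\,Y^*)=\tau$; it is $+\infty$ if there is no such $Y$. *Directions.* Let $\Xi_A$ be the real vector space of self-adjoint $\varphi\in\mathcal T(\mathcal H)$ with $\operatorname{Tr}\varphi=0$, $J^{\mathrm S}_\rho(\varphi)<\infty$ and $\varphi A\in\mathcal T(\mathcal H)$ (if $\dim\mathcal H<\infty$, these are all traceless self-adjoint operators), and let $b_A(\varphi)=\operatorname{Tr}[\varphi A]$, the derivative at $\rho$ of the expectation value of $A$ in the direction $\varphi$. *Inverse of a Fisher information.* For a form $J:\Xi_A\to[0,\infty]$ put $$\langle b_A,J^+b_A\rangle=\sup_{\varphi\in\Xi_A}\frac{b_A(\varphi)^2}{J(\varphi)}\qquad(0/0=0,\ c/\infty=0).$$ If $J(\varphi)=(\varphi,\mathsf J\varphi)$ for a positive operator $\mathsf J$ on a real Hilbert space with Moore–Penrose inverse $\mathsf J^+$, and $b_A=(g,\cdot)$ with $g\in(\ker\mathsf J)^\perp$, this is $(g,\mathsf J^+g)$. *Error.* A POVM $M$ on a measurable space $\Omega$ has, at $\rho$ and in the direction $\varphi$, the classical Fisher information $$J^M(\varphi)=\int_\Omega\Big(\frac{d\operatorname{Tr}[\varphi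 M(\cdot)]}{d\operatorname{Tr}[\rho M(\cdot)]}\Big)^2d\operatorname{Tr}[\rho M(\cdot)].$$ Let $\varepsilon(A;\rho,M)=\langle b_A,(J^M)^+b_A\rangle-\sigma^2(A)$ if $b_A$ vanishes on $\{\varphi\in\Xi_A:J^M(\varphi)=0\}$, and $+\infty$ otherwise. *Instruments.* A CP-instrument $\mathcal I$ on $(\mathbb R,\mathfrak B(\mathbb R))$ is a countably additive family of completely positive linear maps $\mathcal I(X):\mathcal T(\mathcal H)\to\mathcal T(\mathcal H)$, $X\in\mathfrak B(\mathbb R)$, with $\mathcal I(\mathbb R)$ trace preserving. Let $\varepsilon(A;\rho,\mathcal I)$ be the error of $A$ for the POVM $X\mapsto\mathcal I(X)^*(I)$. Let $\eta(B;\rho,\mathcal I)=\langle b_B,J^+b_B\rangle-\sigma^2(B)$ with $J(\varphi)=J^{\mathrm S}_{\mathcal I(\mathbb R)(\rho)}\big(\mathcal I(\mathbb R)(\varphi)\big)$ if $b_B$ vanishes on $\{\varphi\in\Xi_B:J(\varphi)=0\}$, and $+\infty$ otherwise. **Theorem.** Let $A,B$ be self-adjoint operators on $\mathcal H$ with $\rho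 A,\ \rho B,\ \rho A^2,\ \rho B^2,\ \rho AB\in\mathcal T(\mathcal H)$, and let $\mathcal I$ be a CP-instrument on $(\mathbb R,\mathfrak B(\mathbb R))$. Then there is a POVM $M$ on $(\mathbb R\times\mathbb R,\mathfrak B(\mathbb R)\otimes\mathfrak B(\mathbb R))$ such that $$\varepsilon(A;\rho,\mathcal I)\ \ge\ \varepsilon(A;\rho,M)\qquad\text{and}\qquad \eta(B;\rho,\mathcal I)\ \ge\ \varepsilon(B;\rho,M).$$ -/

import Mathlib

open scoped InnerProductSpace ComplexOrder ENNReal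

namespace QEst

variable {H : Type*} [NormedAddCommGroup H] [InnerProductSpace ℂ H]

/-- `T = ∑ₙ |xₙ⟩⟨yₙ|` with `∑ₙ ‖xₙ‖ ‖yₙ‖ < ∞`. -/
def NuclearRep (T : H →L[ℂ] H) (x y : ℕ → H) : Prop :=
  Summable (fun n => ‖x n‖ * ‖y n‖) ∧ ∀ z, HasSum (fun n => ⟪y n, z⟫_ℂ • x n) (T z)

/-- Trace-class operators, described as the nuclear operators on a Hilbert space. -/
def IsTraceClass (T : H →L[ℂ] H) : Prop := ∃ x y : ℕ → H, NuclearRep T x y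

theorem IsTraceClass.add {S T : H →L[ℂ] H} (hS : IsTraceClass S) (hT : IsTraceClass T) :
    IsTraceClass (S + T) := by
  obtain ⟨x, y, hs, h⟩ := hS
  obtain ⟨x', y', hs', h'⟩ := hT
  refine ⟨fun n => if n % 2 = 0 then x (n / 2) else x' (n / 2),
    fun n => if n % 2 = 0 then y (n / 2) else y' (n / 2), ?_, fun z => ?_⟩
  · refine (HasSum.even_add_odd (m := ∑' n, ‖x n‖ * ‖y n‖) (m' := ∑' n, ‖x' n‖ * ‖y' n‖)
      ?_ ?_).summable
    · convert hs.hasSum using 2 with n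
      simp
    · convert hs'.hasSum using 2 with n
      have h1 : (2 * n + 1) % 2 = 1 := by omega
      have h2 : (2 * n + 1) / 2 = n := by omega
      simp [h1, h2]
  · change HasSum _ (S z + T z)
    refine HasSum.even_add_odd ?_ ?_
    · convert h z using 2 with n
      simp
    · convert h' z using 2 with n
      have h1 : (2 * n + 1) % 2 = 1 := by omega
      have h2 : (2 * n + 1) / 2 = n := by omega
      simp [h1, h2]

theorem NuclearRep.mul_left {T : H →L[ℂ] H} {x y : ℕ → H} (h : NuclearRep T x y)
    (a : H →L[ℂ] H) : NuclearRep (a * T) (fun n => a (x n)) y := by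
  refine ⟨?_, fun z => ?_⟩
  · refine Summable.of_nonneg_of_le (fun n => by positivity) (fun n => ?_) (h.1.mul_left ‖a‖)
    rw [← mul_assoc]
    gcongr
    exact a.le_opNorm _
  · simpa using (h.2 z).mapL a

theorem NuclearRep.mul_right [CompleteSpace H] {T : H →L[ℂ] H} {x y : ℕ → H}
    (h : NuclearRep T x y) (a : H →L[ℂ] H) :
    NuclearRep (T * a) x (fun n => ContinuousLinearMap.adjoint a (y n)) := by
  refine ⟨?_, fun z => ?_⟩
  · refine Summable.of_nonneg_of_le (fun n => by positivity) (fun n => ?_)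
      (h.1.mul_left ‖ContinuousLinearMap.adjoint a‖)
    calc ‖x n‖ * ‖ContinuousLinearMap.adjoint a (y n)‖
        ≤ ‖x n‖ * (‖ContinuousLinearMap.adjoint a‖ * ‖y n‖) := by
          gcongr
          exact ContinuousLinearMap.le_opNorm _ _
      _ = _ := by ring
  · simpa [ContinuousLinearMap.adjoint_inner_left] using h.2 (a z)

theorem IsTraceClass.mul_left {T : H →L[ℂ] H} (h : IsTraceClass T) (a : H →L[ℂ] H) :
    IsTraceClass (a * T) := by
  obtain ⟨x, y, h⟩ := h
  exact ⟨_, _, h.mul_left a⟩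

theorem IsTraceClass.mul_right [CompleteSpace H] {T : H →L[ℂ] H} (h : IsTraceClass T)
    (a : H →L[ℂ] H) : IsTraceClass (T * a) := by
  obtain ⟨x, y, h⟩ := h
  exact ⟨_, _, h.mul_right a⟩

variable (H) in
/-- The space of trace-class operators on `H`. -/
def traceClass : Submodule ℂ (H →L[ℂ] H) where
  carrier := {T | IsTraceClass T}
  add_mem' := IsTraceClass.add
  zero_mem' := ⟨0, 0, by simp, fun z => by simp⟩
  smul_mem' := fun c T hT => by
    have := hT.mul_left (c • (1 : H →L[ℂ] H))
    simpa using this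

theorem rankOne_nuclear (x y : H) :
    NuclearRep (InnerProductSpace.rankOne ℂ x y) (fun n => if n = 0 then x else 0) (fun n => if n = 0 then y else 0) := by
  refine ⟨summable_of_hasFiniteSupport ((Set.finite_singleton 0).subset ?_), fun z => ?_⟩
  · intro n hn
    by_contra h
    have : n ≠ 0 := h
    simp [this] at hn
  · have := hasSum_single (f := fun n : ℕ => ⟪(if n = 0 then y else 0 : H), z⟫_ℂ • (if n = 0 then x else 0 : H)) 0 (by intro n hn; simp [hn])
    simpa using this

/-- The rank-one operator `|x⟩⟨y|`, as a trace-class operator. -/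
noncomputable def ketBra (x y : H) : traceClass H := ⟨InnerProductSpace.rankOne ℂ x y, _, _, rankOne_nuclear x y⟩

variable [CompleteSpace H]

variable (H) in
/-- A fixed orthonormal (Hilbert) basis of `H`. -/
noncomputable def onb : HilbertBasis (exists_hilbertBasis ℂ H).choose ℂ H :=
  (exists_hilbertBasis ℂ H).choose_spec.choose

/-- The trace `∑ᵢ ⟨eᵢ, T eᵢ⟩`. -/
noncomputable def trace (T : H →L[ℂ] H) : ℂ := ∑' i, ⟪onb H i, T (onb H i)⟫_ℂ

theorem NuclearRep.hasSum_prod {T : H →L[ℂ] H} {x y : ℕ → H} (h : NuclearRep T x y) :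
    Summable (fun p : ℕ × _ => ⟪y p.1, onb H p.2⟫_ℂ * ⟪onb H p.2, x p.1⟫_ℂ) := by
  have key : ∀ n (s : Finset _), ∑ i ∈ s, ‖⟪y n, onb H i⟫_ℂ * ⟪onb H i, x n⟫_ℂ‖ ≤ ‖x n‖ * ‖y n‖ := by
    intro n s
    have h1 := (onb H).orthonormal.sum_inner_products_le (x n) (s := s)
    have h2 := (onb H).orthonormal.sum_inner_products_le (y n) (s := s)
    calc ∑ i ∈ s, ‖⟪y n, onb H i⟫_ℂ * ⟪onb H i, x n⟫_ℂ‖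
        = ∑ i ∈ s, ‖⟪onb H i, x n⟫_ℂ‖ * ‖⟪onb H i, y n⟫_ℂ‖ := by
          refine Finset.sum_congr rfl fun i _ => ?_
          rw [norm_mul, mul_comm, norm_inner_symm (y n)]
      _ ≤ √(∑ i ∈ s, ‖⟪onb H i, x n⟫_ℂ‖ ^ 2) * √(∑ i ∈ s, ‖⟪onb H i, y n⟫_ℂ‖ ^ 2) :=
          Real.sum_mul_le_sqrt_mul_sqrt _ _ _
      _ ≤ √(‖x n‖ ^ 2) * √(‖y n‖ ^ 2) := by gcongr
      _ = _ := by simp [Real.sqrt_sq]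
  apply Summable.of_norm
  rw [summable_prod_of_nonneg (fun _ => norm_nonneg _)]
  refine ⟨fun n => summable_of_sum_le (fun _ => norm_nonneg _) (key n), ?_⟩
  refine Summable.of_nonneg_of_le (fun n => tsum_nonneg fun _ => norm_nonneg _) (fun n => ?_) h.1
  exact Real.tsum_le_of_sum_le (fun _ => norm_nonneg _) (key n)

theorem NuclearRep.hasSum_trace {T : H →L[ℂ] H} {x y : ℕ → H} (h : NuclearRep T x y) :
    HasSum (fun n => ⟪y n, x n⟫_ℂ) (trace T) := by
  have h1 := h.hasSum_prod
  have e1 : ∀ n, ∑' i, ⟪y n, onb H i⟫_ℂ * ⟪onb H i, x n⟫_ℂ = ⟪y n, x n⟫_ℂ :=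
    fun n => ((onb H).hasSum_inner_mul_inner (y n) (x n)).tsum_eq
  have e2 : ∀ i, ∑' n, ⟪y n, onb H i⟫_ℂ * ⟪onb H i, x n⟫_ℂ = ⟪onb H i, T (onb H i)⟫_ℂ := by
    intro i
    have := (h.2 (onb H i)).mapL (innerSL ℂ (onb H i))
    simpa [inner_smul_right] using this.tsum_eq
  have e3 : trace T = ∑' n, ⟪y n, x n⟫_ℂ := by
    unfold trace
    simp_rw [← e1, ← e2]
    exact (Summable.tsum_comm (f := fun n i => ⟪y n, onb H i⟫_ℂ * ⟪onb H i, x n⟫_ℂ) h1)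
  rw [e3]
  apply Summable.hasSum
  simpa [e1] using h1.prod

theorem trace_add {S T : H →L[ℂ] H} (hS : IsTraceClass S) (hT : IsTraceClass T) : trace (S + T) = trace S + trace T := by
  have hs : ∀ {R : H →L[ℂ] H}, IsTraceClass R → Summable fun i => ⟪onb H i, R (onb H i)⟫_ℂ := by
    rintro R ⟨x, y, h⟩
    have e2 : ∀ i, ∑' n, ⟪y n, onb H i⟫_ℂ * ⟪onb H i, x n⟫_ℂ = ⟪onb H i, R (onb H i)⟫_ℂ := by
      intro i
      have := (h.2 (onb H i)).mapL (innerSL ℂ (onb H i))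
      simpa [inner_smul_right] using this.tsum_eq
    simpa [e2] using (h.hasSum_prod.prod_symm).prod
  simp only [trace, add_apply, inner_add_right]
  exact (hs hS).tsum_add (hs hT)

theorem trace_smul (c : ℂ) (T : H →L[ℂ] H) : trace (c • T) = c * trace T := by
  simp only [trace, smul_apply, inner_smul_right]
  exact tsum_mul_left

theorem trace_mul_comm {T : H →L[ℂ] H} (hT : IsTraceClass T) (a : H →L[ℂ] H) :
    trace (T * a) = trace (a * T) := by
  obtain ⟨x, y, h⟩ := hT
  refine (h.mul_right a).hasSum_trace.unique ?_
  simpa [ContinuousLinearMap.adjoint_inner_left] using (h.mul_left a).hasSum_trace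

theorem trace_nonneg {T : H →L[ℂ] H} (hT : 0 ≤ T) : 0 ≤ trace T :=
  tsum_nonneg fun _ => ((ContinuousLinearMap.nonneg_iff_isPositive T).1 hT).inner_nonneg_right _

theorem trace_mul_nonneg {T a : H →L[ℂ] H} (hT : IsTraceClass T) (h : 0 ≤ T) (ha : 0 ≤ a) :
    0 ≤ trace (T * a) := by
  have h1 : trace (T * a) = trace (CFC.sqrt a * T * CFC.sqrt a) := by
    rw [trace_mul_comm (hT.mul_left _), ← mul_assoc, CFC.sqrt_mul_sqrt_self a ha, trace_mul_comm hT]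
  rw [h1]
  refine trace_nonneg ?_
  have := star_left_conjugate_nonneg h (CFC.sqrt a)
  rwa [(IsSelfAdjoint.of_nonneg (CFC.sqrt_nonneg a)).star_eq] at this

theorem trace_ketBra (x y : H) : trace (ketBra x y : H →L[ℂ] H) = ⟪y, x⟫_ℂ := by
  have h := (rankOne_nuclear x y).hasSum_trace
  refine h.unique ?_
  have := hasSum_single (f := fun n : ℕ => ⟪(if n = 0 then y else 0 : H), (if n = 0 then x else 0 : H)⟫_ℂ) 0 (by intro n hn; simp [hn])
  simpa using this


/-- A positive operator-valued measure on `Ω`: positive, normalized and countably additive in the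
weak operator topology. Only the values on measurable sets matter. -/
structure POVM (Ω : Type*) [MeasurableSpace Ω] (H : Type*) [NormedAddCommGroup H]
    [InnerProductSpace ℂ H] [CompleteSpace H] where
  toFun : Set Ω → (H →L[ℂ] H)
  nonneg' : ∀ s, MeasurableSet s → 0 ≤ toFun s
  univ' : toFun Set.univ = 1
  iUnion' : ∀ f : ℕ → Set Ω, (∀ i, MeasurableSet (f i)) → Pairwise (Function.onFun Disjoint f) →
    ∀ x y : H, HasSum (fun i => ⟪x, toFun (f i) y⟫_ℂ) ⟪x, toFun (⋃ i, f i) y⟫_ℂ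

section POVM

variable {Ω : Type*} [MeasurableSpace Ω]

theorem POVM.empty (M : POVM Ω H) : M.toFun ∅ = 0 := by
  ext y
  refine ext_inner_left ℂ fun x => ?_
  have h := M.iUnion' (fun _ => ∅) (fun _ => .empty) (fun _ _ _ => by simp [Function.onFun]) x y
  have h1 : Summable fun _ : ℕ => ⟪x, M.toFun ∅ y⟫_ℂ := by simpa using h.summable
  simpa using (summable_const_iff _).1 h1

/-- The sequence `s, sᶜ, ∅, ∅, …`. -/
def splitSeq {Ω : Type*} (s : Set Ω) : ℕ → Set Ω := fun n => if n = 0 then s else if n = 1 then sᶜ else ∅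

theorem splitSeq_measurable {s : Set Ω} (hs : MeasurableSet s) (n : ℕ) :
    MeasurableSet (splitSeq s n) := by
  unfold splitSeq
  split_ifs
  exacts [hs, hs.compl, .empty]

theorem splitSeq_disjoint {Ω : Type*} (s : Set Ω) : Pairwise (Function.onFun Disjoint (splitSeq s)) := by
  intro i j hij
  rw [Function.onFun, Set.disjoint_left]
  intro x hi hj
  unfold splitSeq at hi hj
  split_ifs at hi hj <;> simp_all

theorem splitSeq_iUnion {Ω : Type*} (s : Set Ω) : ⋃ i, splitSeq s i = Set.univ := by
  refine Set.eq_univ_of_forall fun x => Set.mem_iUnion.2 ?_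
  by_cases h : x ∈ s
  · exact ⟨0, by simpa [splitSeq] using h⟩
  · exact ⟨1, by simpa [splitSeq] using h⟩

theorem POVM.sum_inner_le (M : POVM Ω H) {f : ℕ → Set Ω} (hf : ∀ i, MeasurableSet (f i))
    (hd : Pairwise (Function.onFun Disjoint f)) (F : Finset ℕ) (x : H) :
    ∑ i ∈ F, (⟪x, M.toFun (f i) x⟫_ℂ).re ≤ (⟪x, M.toFun (⋃ i, f i) x⟫_ℂ).re := by
  have h := (M.iUnion' f hf hd x x).mapL Complex.reCLM
  exact sum_le_hasSum F (fun i _ => ((ContinuousLinearMap.nonneg_iff_isPositive _).1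
    (M.nonneg' _ (hf i))).re_inner_nonneg_right x) h

theorem POVM.norm_sum_le (M : POVM Ω H) {f : ℕ → Set Ω} (hf : ∀ i, MeasurableSet (f i))
    (hd : Pairwise (Function.onFun Disjoint f)) (F : Finset ℕ) :
    ‖∑ i ∈ F, M.toFun (f i)‖ ≤ 1 := by
  have h0 : 0 ≤ ∑ i ∈ F, M.toFun (f i) := Finset.sum_nonneg fun i _ => M.nonneg' _ (hf i)
  rw [CStarAlgebra.norm_le_one_iff_of_nonneg _ h0, ContinuousLinearMap.le_def,
    ContinuousLinearMap.isPositive_iff_complex]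
  intro x
  have hsa : IsSelfAdjoint (1 - ∑ i ∈ F, M.toFun (f i)) :=
    (IsSelfAdjoint.one _).sub (IsSelfAdjoint.of_nonneg h0)
  have hsym := (ContinuousLinearMap.isSelfAdjoint_iff_isSymmetric.1 hsa)
  refine ⟨?_, ?_⟩
  · simpa using hsym.coe_re_inner_apply_self x
  · have h1 := M.sum_inner_le hf hd F x
    have hU : MeasurableSet (⋃ i, f i) := .iUnion hf
    have h2 := M.sum_inner_le (splitSeq_measurable hU) (splitSeq_disjoint _) {0} x
    rw [splitSeq_iUnion, M.univ'] at h2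
    simp only [Finset.sum_singleton, splitSeq, if_true] at h2
    have h3 : (⟪(1 - ∑ i ∈ F, M.toFun (f i)) x, x⟫_ℂ).re
        = (⟪x, (1 : H →L[ℂ] H) x⟫_ℂ).re - ∑ i ∈ F, (⟪x, M.toFun (f i) x⟫_ℂ).re := by
      have : ⟪(1 - ∑ i ∈ F, M.toFun (f i)) x, x⟫_ℂ = ⟪x, (1 - ∑ i ∈ F, M.toFun (f i)) x⟫_ℂ :=
        hsym x x
      rw [this]
      rw [sub_apply, inner_sub_right, Complex.sub_re, sum_apply, inner_sum, Complex.re_sum]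
    change 0 ≤ (⟪(1 - ∑ i ∈ F, M.toFun (f i)) x, x⟫_ℂ).re
    rw [h3]
    linarith

theorem POVM.hasSum_trace (M : POVM Ω H) {T : H →L[ℂ] H} (hT : IsTraceClass T)
    {f : ℕ → Set Ω} (hf : ∀ i, MeasurableSet (f i))
    (hd : Pairwise (Function.onFun Disjoint f)) :
    HasSum (fun i => trace (T * M.toFun (f i))) (trace (T * M.toFun (⋃ i, f i))) := by
  obtain ⟨x, y, h⟩ := id hT
  have key : ∀ a : H →L[ℂ] H, HasSum (fun n => ⟪y n, a (x n)⟫_ℂ) (trace (T * a)) := by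
    intro a
    rw [trace_mul_comm hT]
    exact (h.mul_left a).hasSum_trace
  have e : ∀ F : Finset ℕ, ∑ i ∈ F, trace (T * M.toFun (f i))
      = ∑' n, ⟪y n, (∑ i ∈ F, M.toFun (f i)) (x n)⟫_ℂ := by
    intro F
    simp only [sum_apply, inner_sum]
    rw [Summable.tsum_finsetSum fun i _ => (key _).summable]
    exact Finset.sum_congr rfl fun i _ => (key _).tsum_eq.symm
  unfold HasSum
  simp only [SummationFilter.unconditional_filter, e]
  rw [← (key _).tsum_eq]
  refine tendsto_tsum_of_dominated_convergence h.1 (fun n => ?_) (.of_forall fun F n => ?_)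
  · have := M.iUnion' f hf hd (y n) (x n)
    simp only [sum_apply, inner_sum]
    exact this
  · calc _ ≤ ‖y n‖ * ‖(∑ i ∈ F, M.toFun (f i)) (x n)‖ := norm_inner_le_norm _ _
      _ ≤ ‖y n‖ * (1 * ‖x n‖) := by
        gcongr
        exact ContinuousLinearMap.le_of_opNorm_le _ (M.norm_sum_le hf hd F) _
      _ = _ := by ring

open Classical in
/-- The signed measure `s ↦ Tr[T M(s)]` for a self-adjoint trace-class operator `T`; it is the
derivative in the direction `T` of the outcome law of `M`. -/
noncomputable def POVM.signedLaw (M : POVM Ω H) (T : traceClass H) :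
    MeasureTheory.SignedMeasure Ω where
  measureOf' s := if MeasurableSet s then (trace ((T : H →L[ℂ] H) * M.toFun s)).re else 0
  empty' := by simp [M.empty, trace]
  not_measurable' := fun _ hs => if_neg hs
  m_iUnion' := fun f hf hd => by
    simp only [hf, MeasurableSet.iUnion hf, if_true]
    exact (M.hasSum_trace T.2 hf hd).mapL Complex.reCLM

end POVM

/-- A density operator `ρ > 0`: a strictly positive trace-class operator of trace one. -/
structure FaithfulState (H : Type*) [NormedAddCommGroup H] [InnerProductSpace ℂ H]
    [CompleteSpace H] where
  op : traceClass H
  nonneg' : 0 ≤ (op : H →L[ℂ] H)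
  pos' : ∀ x : H, x ≠ 0 → 0 < ⟪x, (op : H →L[ℂ] H) x⟫_ℂ
  trace' : trace (op : H →L[ℂ] H) = 1

section Fisher

variable {Ω : Type*} [MeasurableSpace Ω]

/-- The outcome law `s ↦ Tr[ρ M(s)]` of the measurement `M` in the state `ρ`. -/
noncomputable def POVM.law (M : POVM Ω H) (ρ : FaithfulState H) : MeasureTheory.Measure Ω :=
  MeasureTheory.Measure.ofMeasurable
    (fun s _ => ENNReal.ofReal (trace ((ρ.op : H →L[ℂ] H) * M.toFun s)).re)
    (by simp [M.empty, trace])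
    (fun f hf hd => by
      have h := (M.hasSum_trace ρ.op.2 hf hd).mapL Complex.reCLM
      have h0 : ∀ i, 0 ≤ (trace ((ρ.op : H →L[ℂ] H) * M.toFun (f i))).re := fun i =>
        (Complex.nonneg_iff.1 (trace_mul_nonneg ρ.op.2 ρ.nonneg' (M.nonneg' _ (hf i)))).1
      rw [← ENNReal.ofReal_tsum_of_nonneg h0 h.summable]
      exact congrArg ENNReal.ofReal h.tsum_eq.symm)

/-- The classical Fisher information `(φ, J φ) = 𝔼[l(X; φ)²]` of the outcome law of `M` at the
state `ρ` in the direction `φ`; the logarithmic derivative `l(·; φ)` is the Radon-Nikodym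
derivative of `s ↦ Tr[φ M(s)]` with respect to `s ↦ Tr[ρ M(s)]`. -/
noncomputable def fisherInfo (M : POVM Ω H) (ρ : FaithfulState H) (φ : traceClass H) : ℝ≥0∞ :=
  ∫⁻ x, ENNReal.ofReal ((M.signedLaw φ).rnDeriv (M.law ρ) x ^ 2) ∂(M.law ρ)

end Fisher

/-- The squared Hilbert-Schmidt norm. -/
noncomputable def hsNormSq (Y : H →L[ℂ] H) : ℝ≥0∞ := ∑' i, ‖Y (onb H i)‖ₑ ^ 2

/-- `Y = L √σ` for a symmetric logarithmic derivative `L` of `σ` in the direction `τ`. The (possibly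
unbounded) `L` is only relevant on the range of `√σ`: it is symmetric there iff `√σ Y = √σ L √σ` is
self-adjoint, and the equation `½ (L σ + σ L) = τ` reads `½ (Y √σ + √σ Y*) = τ`. -/
def IsSLD (σ τ Y : H →L[ℂ] H) : Prop :=
  IsSelfAdjoint (CFC.sqrt σ * Y) ∧ (2⁻¹ : ℂ) • (Y * CFC.sqrt σ + CFC.sqrt σ * star Y) = τ

/-- The SLD Fisher information `Tr[σ L²] = ‖L √σ‖²_HS` of `σ` in the direction `τ`, infinite if there
is no square-integrable symmetric logarithmic derivative `L`. The infimum only discards the part of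
`L` on the kernel of `σ`, which is not determined by the equation. -/
noncomputable def sldInfo (σ τ : H →L[ℂ] H) : ℝ≥0∞ := ⨅ (Y : H →L[ℂ] H) (_ : IsSLD σ τ Y), hsNormSq Y

/-- `R A ∈ 𝒯(H)`: the operator `R A`, defined on the domain of `A`, is given by a trace-class
operator. -/
def MulMemTraceClass (R : H →L[ℂ] H) (A : H →ₗ.[ℂ] H) : Prop :=
  ∃ T : traceClass H, ∀ x : A.domain, (T : H →L[ℂ] H) x = R (A x)

open Classical in
/-- `Tr[R A]`, for a densely defined operator `A` with `R A ∈ 𝒯(H)`. -/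
noncomputable def expVal (R : H →L[ℂ] H) (A : H →ₗ.[ℂ] H) : ℂ :=
  if h : MulMemTraceClass R A then trace (h.choose : H →L[ℂ] H) else 0

/-- The product `A B` of two unbounded operators, on `{x ∈ dom B | B x ∈ dom A}`. -/
def opMul (A B : H →ₗ.[ℂ] H) : H →ₗ.[ℂ] H where
  domain := (A.domain.comap B.toFun).map B.domain.subtype
  toFun :=
    { toFun := fun x => A ⟨B ⟨x, by obtain ⟨z, -, hz⟩ := x.2; exact hz ▸ z.2⟩, by
        obtain ⟨_, z, hz, rfl⟩ := x
        exact hz⟩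
      map_add' := fun x y => by
        rw [← A.map_add]
        congr 1
        ext
        simp only [Submodule.coe_add]
        rw [← B.map_add]
        rfl
      map_smul' := fun c x => by
        rw [RingHom.id_apply, ← A.map_smul]
        congr 1
        ext
        simp only [Submodule.coe_smul]
        rw [← B.map_smul]
        rfl }

/-- `𝒪_ρ`: the (possibly unbounded) self-adjoint operators with finite expectation value in `ρ`. -/
def IsObservable (ρ : FaithfulState H) (A : H →ₗ.[ℂ] H) : Prop :=
  IsSelfAdjoint A ∧ MulMemTraceClass (ρ.op : H →L[ℂ] H) A

/-- The variance `⟨A²⟩ - ⟨A⟩²`. -/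
noncomputable def variance (ρ : FaithfulState H) (A : H →ₗ.[ℂ] H) : ℝ :=
  (expVal (ρ.op : H →L[ℂ] H) (opMul A A)).re - (expVal (ρ.op : H →L[ℂ] H) A).re ^ 2

/-- The directions in which `⟨A⟩` is differentiated at `ρ`: self-adjoint trace-class operators `φ` of
trace zero for which the symmetric logarithmic derivative of the model exists and is square-integrable
and for which `φ A` is trace-class. If `H` is finite-dimensional, the last two conditions are void. -/
def directions (ρ : FaithfulState H) (A : H →ₗ.[ℂ] H) : Set (traceClass H) :=
  {φ | IsSelfAdjoint (φ : H →L[ℂ] H) ∧ trace (φ : H →L[ℂ] H) = 0 ∧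
    sldInfo (ρ.op : H →L[ℂ] H) φ < ⊤ ∧ MulMemTraceClass (φ : H →L[ℂ] H) A}

/-- The derivative of `⟨A⟩` in the direction `φ`, that is `Tr[φ A]`: the states are parametrized
affinely, by `ρ(θ) = ρ₀ + θ`. -/
noncomputable def expDeriv (A : H →ₗ.[ℂ] H) (φ : traceClass H) : ℝ := (expVal (φ : H →L[ℂ] H) A).re

section InverseForm

/-- For a Fisher information form `J` on the directions `D` and a linear functional `b`, the value
`(∇b, J⁺ ∇b)` of the Moore-Penrose inverse of the form `J`. It does not depend on an inner product on
`D`, so that it also makes sense where `b` has no gradient and `J` is not given by an operator;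
`excessError_eq_moorePenrose` is the comparison with the operator expression. -/
noncomputable def inverseForm {V : Type*} (D : Set V) (J : V → ℝ≥0∞) (b : V → ℝ) : ℝ≥0∞ :=
  ⨆ φ ∈ D, ENNReal.ofReal (b φ ^ 2) / J φ

open Classical in
/-- `(∇b, J⁺ ∇b) - v` if `b` vanishes on the kernel of `J`, and `+∞` otherwise. -/
noncomputable def excessError {V : Type*} (D : Set V) (J : V → ℝ≥0∞) (b : V → ℝ) (v : ℝ) : EReal :=
  if ∀ φ ∈ D, J φ = 0 → b φ = 0 then (inverseForm D J b : EReal) - (v : EReal) else ⊤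

/-- `K` is the Moore-Penrose inverse of `J`. -/
structure IsMoorePenrose {Ξ : Type*} [NormedAddCommGroup Ξ] [InnerProductSpace ℝ Ξ]
    [CompleteSpace Ξ] (J K : Ξ →L[ℝ] Ξ) : Prop where
  mul_mul_self : J * K * J = J
  inv_mul_mul : K * J * K = K
  isSelfAdjoint_mul : IsSelfAdjoint (J * K)
  isSelfAdjoint_inv_mul : IsSelfAdjoint (K * J)

open Classical in
/-- If the form is `φ ↦ (φ, J φ)` for a positive operator `J` on a real Hilbert space that has a
Moore-Penrose inverse `K`, and `b = (g, ·)`, then `excessError` is the expected expression. -/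
theorem excessError_eq_moorePenrose {Ξ : Type*} [NormedAddCommGroup Ξ] [InnerProductSpace ℝ Ξ]
    [CompleteSpace Ξ] {J K : Ξ →L[ℝ] Ξ} (hJ : J.IsPositive) (hK : IsMoorePenrose J K)
    (g : Ξ) (v : ℝ) :
    excessError Set.univ (fun φ => ENNReal.ofReal ⟪φ, J φ⟫_ℝ) (fun φ => ⟪g, φ⟫_ℝ) v =
      if g ∈ (LinearMap.ker (J : Ξ →ₗ[ℝ] Ξ))ᗮ then ((⟪g, K g⟫_ℝ - v : ℝ) : EReal) else ⊤ := by
  have hsym : ∀ x y, ⟪J x, y⟫_ℝ = ⟪x, J y⟫_ℝ := fun x y =>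
    (ContinuousLinearMap.isSelfAdjoint_iff_isSymmetric.1 hJ.isSelfAdjoint) x y
  have hpos : ∀ x, 0 ≤ ⟪x, J x⟫_ℝ := fun x => hJ.inner_nonneg_right x
  have hcs : ∀ x y, ⟪x, J y⟫_ℝ ^ 2 ≤ ⟪x, J x⟫_ℝ * ⟪y, J y⟫_ℝ := by
    intro x y
    have hq : ∀ t : ℝ, 0 ≤ ⟪y, J y⟫_ℝ * (t * t) + 2 * ⟪x, J y⟫_ℝ * t + ⟪x, J x⟫_ℝ := by
      intro t
      have := hpos (x + t • y)
      have h1 : ⟪y, J x⟫_ℝ = ⟪x, J y⟫_ℝ := by rw [← hsym, real_inner_comm]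
      simp only [map_add, map_smul, inner_add_left, inner_add_right, inner_smul_left,
        inner_smul_right, h1] at this
      simp at this
      linarith
    have := discrim_le_zero hq
    unfold discrim at this
    nlinarith
  have hker : ∀ x, ⟪x, J x⟫_ℝ = 0 → J x = 0 := by
    intro x hx
    have := hcs (J x) x
    rw [hx, mul_zero] at this
    have h2 : ⟪J x, J x⟫_ℝ = 0 := by nlinarith [sq_nonneg ⟪J x, J x⟫_ℝ]
    simpa using h2
  have hcond : (∀ φ ∈ (Set.univ : Set Ξ), ENNReal.ofReal ⟪φ, J φ⟫_ℝ = 0 → ⟪g, φ⟫_ℝ = 0) ↔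
      g ∈ (LinearMap.ker (J : Ξ →ₗ[ℝ] Ξ))ᗮ := by
    rw [Submodule.mem_orthogonal]
    constructor
    · intro h u hu
      have hu' : J u = 0 := hu
      rw [real_inner_comm]
      exact h u trivial (by simp [hu'])
    · intro h φ _ hφ
      rw [real_inner_comm]
      exact h φ (hker φ (le_antisymm (ENNReal.ofReal_eq_zero.1 hφ) (hpos φ)))
  unfold excessError
  simp only [hcond]
  split_ifs with hg
  · have hg1 : J (K g) = g := by
      have h1 : g - K (J g) ∈ LinearMap.ker (J : Ξ →ₗ[ℝ] Ξ) := by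
        have := congrArg (fun T : Ξ →L[ℝ] Ξ => T g) hK.mul_mul_self
        simp at this
        simp [this]
      have hKJ : ∀ x y, ⟪K (J x), y⟫_ℝ = ⟪x, K (J y)⟫_ℝ := fun x y =>
        (ContinuousLinearMap.isSelfAdjoint_iff_isSymmetric.1 hK.isSelfAdjoint_inv_mul) x y
      have hJK : ∀ x y, ⟪J (K x), y⟫_ℝ = ⟪x, J (K y)⟫_ℝ := fun x y =>
        (ContinuousLinearMap.isSelfAdjoint_iff_isSymmetric.1 hK.isSelfAdjoint_mul) x y
      have hJJK : ∀ x, J (J (K x)) = J x := by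
        intro x
        refine ext_inner_right ℝ fun y => ?_
        have h3 : J (K (J y)) = J y := by
          simpa using congrArg (fun T : Ξ →L[ℝ] Ξ => T y) hK.mul_mul_self
        rw [hsym, hJK, h3, ← hsym]
      have h2 : g - J (K g) ∈ LinearMap.ker (J : Ξ →ₗ[ℝ] Ξ) := by
        simp [hJJK]
      have h3 := (Submodule.mem_orthogonal _ _).1 hg _ h2
      have h4 : ⟪g - J (K g), J (K g)⟫_ℝ = 0 := by
        rw [← hsym]
        have : J (g - J (K g)) = 0 := h2
        simp [this]
      have h5 : ⟪g - J (K g), g - J (K g)⟫_ℝ = 0 := by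
        rw [inner_sub_right, h3, h4, sub_zero]
      have h6 : g - J (K g) = 0 := by simpa using h5
      exact (sub_eq_zero.1 h6).symm
    have hv : ⟪g, K g⟫_ℝ = ⟪K g, J (K g)⟫_ℝ := by rw [hg1, real_inner_comm]
    have hI : inverseForm Set.univ (fun φ => ENNReal.ofReal ⟪φ, J φ⟫_ℝ) (fun φ => ⟪g, φ⟫_ℝ) =
        ENNReal.ofReal ⟪g, K g⟫_ℝ := by
      unfold inverseForm
      refine le_antisymm (iSup₂_le fun φ _ => ?_) ?_
      · refine ENNReal.div_le_of_le_mul ?_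
        rw [hv, ← ENNReal.ofReal_mul (hpos _)]
        refine ENNReal.ofReal_le_ofReal ?_
        have := hcs (K g) φ
        rw [← hsym (K g) φ, hg1] at this
        rwa [hg1]
      · rcases (hpos (K g)).eq_or_lt with h0 | h0
        · rw [hv, ← h0]
          simp
        · refine le_trans ?_ (le_iSup₂_of_le (K g) trivial le_rfl)
          rw [ENNReal.le_div_iff_mul_le (Or.inl (by simpa using h0)) (Or.inl ENNReal.ofReal_ne_top),
            hv, ← ENNReal.ofReal_mul (hpos _), ← hv, ← sq]
    rw [hI, EReal.coe_sub, EReal.coe_ennreal_ofReal, max_eq_left (hv ▸ hpos _)]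
  · rfl

end InverseForm

/-- The measurement error `ε(A; ρ, M)`. -/
noncomputable def POVM.error {Ω : Type*} [MeasurableSpace Ω] (M : POVM Ω H) (ρ : FaithfulState H)
    (A : H →ₗ.[ℂ] H) : EReal :=
  excessError (directions ρ A) (fisherInfo M ρ) (expDeriv A) (variance ρ A)

/-- The disturbance `η(A; ρ, ℰ)` by a map `ℰ` of states. -/
noncomputable def disturbance (E : traceClass H →ₗ[ℂ] traceClass H) (ρ : FaithfulState H)
    (A : H →ₗ.[ℂ] H) : EReal :=
  excessError (directions ρ A) (fun φ => sldInfo (E ρ.op : H →L[ℂ] H) (E φ)) (expDeriv A)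
    (variance ρ A)

/-- Complete positivity: `ℰ ⊗ id` preserves positivity of `n × n` matrices over `𝒯(H)`. -/
def IsCompletelyPositive (E : traceClass H →ₗ[ℂ] traceClass H) : Prop :=
  ∀ (n : ℕ) (T : Fin n → Fin n → traceClass H),
    (∀ v : Fin n → H, 0 ≤ ∑ i, ∑ j, ⟪v i, (T i j : H →L[ℂ] H) (v j)⟫_ℂ) →
    ∀ v : Fin n → H, 0 ≤ ∑ i, ∑ j, ⟪v i, (E (T i j) : H →L[ℂ] H) (v j)⟫_ℂ

/-- A completely positive instrument on `Ω`: a countably additive family of completely positive maps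
on `𝒯(H)` whose total map is trace preserving. -/
structure CPInstrument (Ω : Type*) [MeasurableSpace Ω] (H : Type*) [NormedAddCommGroup H]
    [InnerProductSpace ℂ H] [CompleteSpace H] where
  toFun : Set Ω → (traceClass H →ₗ[ℂ] traceClass H)
  completelyPositive' : ∀ s, MeasurableSet s → IsCompletelyPositive (toFun s)
  trace_univ' : ∀ T, trace (toFun Set.univ T : H →L[ℂ] H) = trace (T : H →L[ℂ] H)
  iUnion' : ∀ f : ℕ → Set Ω, (∀ i, MeasurableSet (f i)) → Pairwise (Function.onFun Disjoint f) →
    ∀ (T : traceClass H) (a : H →L[ℂ] H),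
      HasSum (fun i => trace (a * (toFun (f i) T : H →L[ℂ] H)))
        (trace (a * (toFun (⋃ i, f i) T : H →L[ℂ] H)))

/-- `b = ℰ^*(a)`: the dual map evaluated at `a`, determined by `Tr[ℰ^*(a) T] = Tr[a ℰ(T)]` for the
rank-one operators `T = |y⟩⟨x|`. -/
def IsDual (E : traceClass H →ₗ[ℂ] traceClass H) (a b : H →L[ℂ] H) : Prop :=
  ∀ x y : H, ⟪x, b y⟫_ℂ = trace (a * (E (ketBra y x) : H →L[ℂ] H))

open Classical in
/-- The dual map `ℰ^*` on bounded operators. -/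
noncomputable def dualMap (E : traceClass H →ₗ[ℂ] traceClass H) (a : H →L[ℂ] H) : H →L[ℂ] H :=
  if h : ∃ b, IsDual E a b then h.choose else 0

namespace CPInstrument

variable {Ω : Type*} [MeasurableSpace Ω] (I : CPInstrument Ω H)

theorem ketBra_nonneg {s : Set Ω} (hs : MeasurableSet s) (x : H) :
    0 ≤ trace (I.toFun s (ketBra x x) : H →L[ℂ] H) := by
  have h := I.completelyPositive' s hs 1 (fun _ _ => ketBra x x) (fun v => by
    simp only [Finset.univ_unique, Finset.sum_singleton]
    change 0 ≤ ⟪v _, InnerProductSpace.rankOne ℂ x x (v _)⟫_ℂ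
    rw [InnerProductSpace.rankOne_apply, inner_smul_right, ← inner_conj_symm x, mul_comm,
      Complex.mul_conj]
    exact_mod_cast Complex.normSq_nonneg _)
  refine tsum_nonneg fun i => ?_
  simpa using h (fun _ => onb H i)

theorem ketBra_le {s : Set Ω} (hs : MeasurableSet s) (x : H) :
    (trace (I.toFun s (ketBra x x) : H →L[ℂ] H)).re ≤ ‖x‖ ^ 2 := by
  have h := (I.iUnion' _ (splitSeq_measurable hs) (splitSeq_disjoint s) (ketBra x x) 1).mapL
    Complex.reCLM
  rw [splitSeq_iUnion, one_mul, I.trace_univ', trace_ketBra] at h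
  have h1 := le_hasSum h 0 (fun j _ => by
    simpa using (Complex.nonneg_iff.1 (I.ketBra_nonneg (splitSeq_measurable hs j) x)).1)
  simpa [splitSeq, inner_self_eq_norm_sq_to_K, ← Complex.ofReal_pow] using h1

theorem exists_dual_one {s : Set Ω} (hs : MeasurableSet s) : ∃ L, IsDual (I.toFun s) 1 L := by
  have add_l : ∀ x x' y : H, ketBra (x + x') y = ketBra x y + ketBra x' y := fun x x' y =>
    Subtype.ext (by simp [ketBra])
  have add_r : ∀ x y y' : H, ketBra x (y + y') = ketBra x y + ketBra x y' := fun x y y' =>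
    Subtype.ext (by simp [ketBra])
  have smul_l : ∀ (c : ℂ) (x y : H), ketBra (c • x) y = c • ketBra x y := fun c x y =>
    Subtype.ext (by simp [ketBra])
  have smul_r : ∀ (c : ℂ) (x y : H), ketBra x (c • y) = (starRingEnd ℂ c) • ketBra x y :=
    fun c x y => Subtype.ext (by simp [ketBra])
  have tr_add : ∀ S T : traceClass H, trace (I.toFun s (S + T) : H →L[ℂ] H) =
      trace (I.toFun s S : H →L[ℂ] H) + trace (I.toFun s T : H →L[ℂ] H) := fun S T => by
    rw [map_add]
    exact trace_add (I.toFun s S).2 (I.toFun s T).2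
  have tr_smul : ∀ (c : ℂ) (S : traceClass H), trace (I.toFun s (c • S) : H →L[ℂ] H) =
      c * trace (I.toFun s S : H →L[ℂ] H) := fun c S => by
    rw [map_smul]
    exact trace_smul c _
  let f : H →ₗ⋆[ℂ] H →ₗ[ℂ] ℂ := LinearMap.mk₂'ₛₗ (starRingEnd ℂ) (RingHom.id ℂ)
    (fun x y => trace (I.toFun s (ketBra y x) : H →L[ℂ] H))
    (fun x x' y => by rw [add_r, tr_add])
    (fun c x y => by rw [smul_r, tr_smul]; rfl)
    (fun x y y' => by rw [add_l, tr_add])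
    (fun c x y => by rw [smul_l, tr_smul]; rfl)
  have hq : ∀ x, ‖f x x‖ ≤ ‖x‖ ^ 2 := by
    intro x
    have h0 : 0 ≤ f x x := I.ketBra_nonneg hs x
    have h1 : (f x x).re ≤ ‖x‖ ^ 2 := I.ketBra_le hs x
    have h2 : ‖f x x‖ = (f x x).re := by
      have := Complex.eq_re_of_ofReal_le (r := 0) (by simpa using h0)
      rw [this, Complex.norm_real, Complex.ofReal_re, Real.norm_of_nonneg (Complex.nonneg_iff.1 h0).1]
    rwa [h2]
  have hpol : ∀ x y, 4 * f x y = f (x + y) (x + y) - f (x - y) (x - y)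
      - Complex.I * (f (x + Complex.I • y) (x + Complex.I • y)
        - f (x - Complex.I • y) (x - Complex.I • y)) := by
    intro x y
    simp only [map_add, map_sub, LinearMap.add_apply, LinearMap.sub_apply, map_smul,
      LinearMap.map_smulₛₗ, LinearMap.smul_apply, smul_eq_mul, Complex.conj_I]
    linear_combination (2 * f x y - 2 * f y x) * Complex.I_sq
  have hb : ∀ x y, ‖x‖ ≤ 1 → ‖y‖ ≤ 1 → ‖f x y‖ ≤ 4 := by
    intro x y hx hy
    have hn : ∀ z : H, ‖z‖ ≤ 2 → ‖f z z‖ ≤ 4 := fun z hz => (hq z).trans (by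
      nlinarith [norm_nonneg z])
    have hI : ‖Complex.I • y‖ ≤ 1 := by simpa [norm_smul] using hy
    have h1 := hn (x + y) ((norm_add_le _ _).trans (by linarith))
    have h2 := hn (x - y) ((norm_sub_le _ _).trans (by linarith))
    have h3 := hn (x + Complex.I • y) ((norm_add_le _ _).trans (by linarith))
    have h4 := hn (x - Complex.I • y) ((norm_sub_le _ _).trans (by linarith))
    have h5 : ‖4 * f x y‖ ≤ 16 := by
      rw [hpol]
      refine (norm_sub_le _ _).trans ?_
      rw [norm_mul, Complex.norm_I, one_mul]
      have h6 := norm_sub_le (f (x + y) (x + y)) (f (x - y) (x - y))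
      have h7 := norm_sub_le (f (x + Complex.I • y) (x + Complex.I • y))
        (f (x - Complex.I • y) (x - Complex.I • y))
      linarith
    rw [norm_mul] at h5
    norm_num at h5
    linarith
  have hC : ∀ x y, ‖f x y‖ ≤ 4 * ‖x‖ * ‖y‖ := by
    intro x y
    rcases eq_or_ne x 0 with rfl | hx
    · simp
    rcases eq_or_ne y 0 with rfl | hy
    · simp
    have hx' : (0 : ℝ) < ‖x‖ := norm_pos_iff.2 hx
    have hy' : (0 : ℝ) < ‖y‖ := norm_pos_iff.2 hy
    have h := hb (((‖x‖⁻¹ : ℝ) : ℂ) • x) (((‖y‖⁻¹ : ℝ) : ℂ) • y)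
      (by simp [norm_smul, hx]) (by simp [norm_smul, hy])
    simp only [LinearMap.map_smulₛₗ, LinearMap.smul_apply, map_smul, norm_smul] at h
    simp at h
    rw [inv_mul_le_iff₀ hy', inv_mul_le_iff₀ hx'] at h
    linarith
  refine ⟨ContinuousLinearMap.adjoint
    (InnerProductSpace.continuousLinearMapOfBilin (f.mkContinuous₂ 4 hC)), fun x y => ?_⟩
  rw [ContinuousLinearMap.adjoint_inner_right,
    InnerProductSpace.continuousLinearMapOfBilin_apply, one_mul]
  rfl

theorem isDual_dualMap {s : Set Ω} (hs : MeasurableSet s) :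
    IsDual (I.toFun s) 1 (dualMap (I.toFun s) 1) := by
  unfold dualMap
  rw [dif_pos (I.exists_dual_one hs)]
  exact (I.exists_dual_one hs).choose_spec

/-- The POVM `s ↦ ℐ(s)^*(1)` induced by the instrument. -/
noncomputable def inducedPOVM : POVM Ω H where
  toFun s := dualMap (I.toFun s) 1
  nonneg' s hs := by
    rw [ContinuousLinearMap.nonneg_iff_isPositive, ContinuousLinearMap.isPositive_iff_complex]
    intro x
    have h1 := I.isDual_dualMap hs x x
    rw [one_mul] at h1
    have h2 := I.ketBra_nonneg hs x
    rw [← h1] at h2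
    have h3 := Complex.nonneg_iff.1 h2
    have h4 : ⟪dualMap (I.toFun s) 1 x, x⟫_ℂ = ⟪x, dualMap (I.toFun s) 1 x⟫_ℂ := by
      rw [← inner_conj_symm, Complex.conj_eq_iff_im.2 h3.2.symm]
    rw [h4]
    exact ⟨Complex.ext (by simp) (by simpa using h3.2), h3.1⟩
  univ' := by
    ext y
    refine ext_inner_left ℂ fun x => ?_
    rw [I.isDual_dualMap .univ x y, one_mul, I.trace_univ', trace_ketBra]
    rfl
  iUnion' f hf hd x y := by
    simp only [I.isDual_dualMap (hf _) x y, I.isDual_dualMap (.iUnion hf) x y]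
    exact I.iUnion' f hf hd _ 1

/-- The measurement error `ε(A; ρ, ℐ)`. -/
noncomputable def error (ρ : FaithfulState H) (A : H →ₗ.[ℂ] H) : EReal := I.inducedPOVM.error ρ A

/-- The disturbance `η(A; ρ, ℐ)`, caused by the average evolution `ℐ(Ω)`. -/
noncomputable def disturbance (ρ : FaithfulState H) (A : H →ₗ.[ℂ] H) : EReal :=
  QEst.disturbance (I.toFun Set.univ) ρ A

end CPInstrument

end QEst

/-!
If `⟨b_B, J⁺ b_B⟩ = c` is finite then, by the Riesz representation theorem in the Hilbert space of
families `(X √σ eᵢ)`, `σ = 𝓘(Ω)ρ`, there are bounded self-adjoint `Xₙ` whose expectations in the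
output states have derivatives at `ρ` tending to `b_B` and whose second moments at `σ` tend to a
limit `≤ c`. Replace `Xₙ` by an observable `Gₙ` with finitely many values and measure it after the
instrument. In every input state the joint laws on `Ω × ℝ` of the two outcomes are tight: their
first marginals do not depend on `n`, and at the faithful state `ρ` the second moments of their
second coordinates are bounded, so that effects small at `ρ` are small in every state. Their weak
limits along an ultrafilter are the laws of a POVM `M`.

The first marginal of `M` is the POVM of the instrument, and passing to a marginal loses Fisher
information. At `ρ` the second coordinate has second moment `≤ c`, and in the direction `φ` its mean
has derivative `b_B(φ)`, hence `b_B(φ)² ≤ c J^M(φ)` by the Cauchy–Schwarz inequality.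
-/

namespace QEst

section TraceClass

variable {H : Type*} [NormedAddCommGroup H] [InnerProductSpace ℂ H]

theorem isTraceClass_of_hasSum {ι : Type*} [Countable ι] {T : H →L[ℂ] H} {v w : ι → H}
    (hs : Summable fun i => ‖v i‖ * ‖w i‖) (h : ∀ z, HasSum (fun i => ⟪w i, z⟫_ℂ • v i) (T z)) :
    IsTraceClass T := by
  obtain ⟨e, he⟩ := exists_injective_nat ι
  have extend_zero (u : ι → H) (n : ℕ) (hn : n ∉ Set.range e) :
      Function.extend e u 0 n = 0 :=
    Function.extend_apply' _ _ _ (by simpa only [Set.mem_range] using hn)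
  refine ⟨Function.extend e v 0, Function.extend e w 0, ?_, fun z => ?_⟩
  · rw [← he.summable_iff fun n hn => by simp only [extend_zero _ n hn, norm_zero, mul_zero]]
    simpa only [Function.comp_def, he.extend_apply] using hs
  · rw [← he.hasSum_iff fun n hn => by simp only [extend_zero _ n hn, smul_zero]]
    simpa only [Function.comp_def, he.extend_apply] using h z

theorem countable_of_orthonormal [TopologicalSpace.SeparableSpace H] {ι : Type*} {v : ι → H}
    (hv : Orthonormal ℂ v) : Countable ι := by
  have one_le_dist {i j : ι} (hij : i ≠ j) : 1 ≤ dist (v i) (v j) := by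
    have h := norm_sub_sq (𝕜 := ℂ) (v i) (v j)
    rw [hv.2 hij, hv.1, hv.1, map_zero] at h
    rw [dist_eq_norm]
    nlinarith [norm_nonneg (v i - v j)]
  refine Set.countable_univ_iff.1 (Set.PairwiseDisjoint.countable_of_isOpen
    (s := fun i => Metric.ball (v i) (1 / 2)) (fun i _ j _ hij => ?_)
    (fun i _ => Metric.isOpen_ball) (fun i _ => ⟨v i, Metric.mem_ball_self (by norm_num)⟩))
  exact Metric.ball_disjoint_ball (by linarith [one_le_dist hij])

theorem re_inner_rankOne_self (x y : H) :
    (⟪y, InnerProductSpace.rankOne ℂ x x y⟫_ℂ).re = ‖⟪x, y⟫_ℂ‖ ^ 2 := by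
  rw [InnerProductSpace.rankOne_apply, inner_smul_right, ← inner_conj_symm y, Complex.mul_conj,
    Complex.normSq_eq_norm_sq, Complex.ofReal_re]

theorem ketBra_self_nonneg (x : H) : 0 ≤ (ketBra x x : H →L[ℂ] H) :=
  (ContinuousLinearMap.nonneg_iff_isPositive _).2 (InnerProductSpace.isPositive_rankOne_self x)

variable [CompleteSpace H]

theorem nonneg_iff_re_inner {T : H →L[ℂ] H} :
    0 ≤ T ↔ IsSelfAdjoint T ∧ ∀ x, 0 ≤ (⟪x, T x⟫_ℂ).re := by
  rw [ContinuousLinearMap.nonneg_iff_isPositive, ContinuousLinearMap.isPositive_def']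
  refine and_congr_right fun _ => forall_congr' fun x => ?_
  rw [ContinuousLinearMap.reApplyInnerSelf_apply, inner_re_symm]
  rfl

theorem IsTraceClass.hasSum_inner {T : H →L[ℂ] H} (hT : IsTraceClass T) :
    HasSum (fun i => ⟪onb H i, T (onb H i)⟫_ℂ) (trace T) := by
  obtain ⟨x, y, h⟩ := hT
  have tsum_row (i) :
      ∑' n, ⟪y n, onb H i⟫_ℂ * ⟪onb H i, x n⟫_ℂ = ⟪onb H i, T (onb H i)⟫_ℂ := by
    simpa only [innerSL_apply_apply, inner_smul_right]
      using ((h.2 (onb H i)).mapL (innerSL ℂ (onb H i))).tsum_eq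
  refine Summable.hasSum ?_
  simpa only [Prod.swap_prod_mk, tsum_row] using h.hasSum_prod.prod_symm.prod

theorem IsTraceClass.hasSum_re_inner {T : H →L[ℂ] H} (hT : IsTraceClass T) :
    HasSum (fun i => (⟪onb H i, T (onb H i)⟫_ℂ).re) (trace T).re :=
  hT.hasSum_inner.mapL Complex.reCLM

theorem trace_sub {S T : H →L[ℂ] H} (hS : IsTraceClass S) (hT : IsTraceClass T) :
    trace (S - T) = trace S - trace T := by
  rw [eq_sub_iff_add_eq, ← trace_add ((traceClass H).sub_mem hS hT) hT, sub_add_cancel]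

theorem trace_sum {ι : Type*} (s : Finset ι) {f : ι → H →L[ℂ] H}
    (hf : ∀ i ∈ s, IsTraceClass (f i)) : trace (∑ i ∈ s, f i) = ∑ i ∈ s, trace (f i) := by
  simp only [trace, sum_apply, inner_sum]
  exact Summable.tsum_finsetSum fun i hi => (hf i hi).hasSum_inner.summable

instance countable_onb [TopologicalSpace.SeparableSpace H] :
    Countable (exists_hilbertBasis ℂ H).choose :=
  countable_of_orthonormal (onb H).orthonormal

end TraceClass

section HilbertSchmidtOperators

variable {H : Type*} [NormedAddCommGroup H] [InnerProductSpace ℂ H] [CompleteSpace H]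

/-- The Hilbert-Schmidt operators on `H`. -/
def IsHilbertSchmidt (Z : H →L[ℂ] H) : Prop := hsNormSq Z ≠ ⊤

theorem isHilbertSchmidt_iff_summable {Z : H →L[ℂ] H} :
    IsHilbertSchmidt Z ↔ Summable fun i => ‖Z (onb H i)‖ ^ 2 := by
  simp only [IsHilbertSchmidt, hsNormSq, enorm_eq_nnnorm, ← ENNReal.coe_pow,
    ENNReal.tsum_coe_ne_top_iff_summable, ← NNReal.summable_coe, NNReal.coe_pow, coe_nnnorm]

theorem hasSum_norm_inner_onb_sq (x : H) : HasSum (fun i => ‖⟪onb H i, x⟫_ℂ‖ ^ 2) (‖x‖ ^ 2) := by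
  simpa [HilbertBasis.repr_apply_apply] using lp.hasSum_norm (by simp) ((onb H).repr x)

theorem enorm_sq_eq_tsum_inner_onb (x : H) : ‖x‖ₑ ^ 2 = ∑' i, ‖⟪onb H i, x⟫_ℂ‖ₑ ^ 2 := by
  have h := hasSum_norm_inner_onb_sq x
  have ofReal_sq (r : ℝ) (hr : 0 ≤ r) : ENNReal.ofReal r ^ 2 = ENNReal.ofReal (r ^ 2) :=
    (ENNReal.ofReal_pow hr 2).symm
  simp only [← ofReal_norm, ofReal_sq _ (norm_nonneg _), ← h.tsum_eq]
  exact ENNReal.ofReal_tsum_of_nonneg (fun _ => sq_nonneg _) h.summable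

theorem hsNormSq_star (Z : H →L[ℂ] H) : hsNormSq (star Z) = hsNormSq Z := by
  simp only [hsNormSq]
  rw [tsum_congr fun i => enorm_sq_eq_tsum_inner_onb (star Z (onb H i)),
    tsum_congr fun i => enorm_sq_eq_tsum_inner_onb (Z (onb H i)), ENNReal.tsum_comm]
  refine tsum_congr fun i => tsum_congr fun j => ?_
  rw [ContinuousLinearMap.star_eq_adjoint, ContinuousLinearMap.adjoint_inner_right,
    ← inner_conj_symm, RCLike.enorm_conj]

namespace IsHilbertSchmidt

variable {Z W : H →L[ℂ] H}

protected theorem star (hZ : IsHilbertSchmidt Z) : IsHilbertSchmidt (star Z) := by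
  rwa [IsHilbertSchmidt, hsNormSq_star]

theorem mul_left (a : H →L[ℂ] H) (hZ : IsHilbertSchmidt Z) : IsHilbertSchmidt (a * Z) := by
  rw [isHilbertSchmidt_iff_summable] at hZ ⊢
  refine Summable.of_nonneg_of_le (fun i => sq_nonneg _) (fun i => ?_) (hZ.mul_left (‖a‖ ^ 2))
  rw [← mul_pow]
  gcongr
  exact a.le_opNorm _

theorem add (hZ : IsHilbertSchmidt Z) (hW : IsHilbertSchmidt W) : IsHilbertSchmidt (Z + W) := by
  rw [isHilbertSchmidt_iff_summable] at hZ hW ⊢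
  refine Summable.of_nonneg_of_le (fun i => sq_nonneg _) (fun i => ?_) ((hZ.add hW).mul_left 2)
  exact (pow_le_pow_left₀ (norm_nonneg _) (norm_add_le _ _) 2).trans (add_sq_le)

theorem smul (c : ℂ) (hZ : IsHilbertSchmidt Z) : IsHilbertSchmidt (c • Z) := by
  simpa using hZ.mul_left (c • 1)

theorem isTraceClass_mul_star [TopologicalSpace.SeparableSpace H] (hZ : IsHilbertSchmidt Z)
    (hW : IsHilbertSchmidt W) : IsTraceClass (Z * star W) := by
  rw [isHilbertSchmidt_iff_summable] at hZ hW
  refine isTraceClass_of_hasSum (v := fun i => Z (onb H i)) (w := fun i => W (onb H i)) ?_ ?_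
  · refine Summable.of_nonneg_of_le (fun i => by positivity) (fun i => ?_) (hZ.add hW)
    nlinarith [two_mul_le_add_sq ‖Z (onb H i)‖ ‖W (onb H i)‖, norm_nonneg (Z (onb H i)),
      norm_nonneg (W (onb H i)), mul_nonneg (norm_nonneg (Z (onb H i))) (norm_nonneg (W (onb H i)))]
  · intro z
    simpa [HilbertBasis.repr_apply_apply, ContinuousLinearMap.star_eq_adjoint,
      ContinuousLinearMap.adjoint_inner_right] using ((onb H).hasSum_repr (star W z)).mapL Z

theorem hsNormSq_eq_ofReal_trace (hZ : IsHilbertSchmidt Z) :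
    hsNormSq Z = ENNReal.ofReal (trace (Z * star Z)).re := by
  have hZ' := isHilbertSchmidt_iff_summable.1 hZ.star
  have inner_eq (i) :
      ⟪onb H i, (Z * star Z) (onb H i)⟫_ℂ = ((‖star Z (onb H i)‖ ^ 2 : ℝ) : ℂ) := by
    rw [mul_apply_eq_comp, ← ContinuousLinearMap.adjoint_inner_left,
      ← ContinuousLinearMap.star_eq_adjoint, inner_self_eq_norm_sq_to_K]
    norm_cast
  simp only [trace, inner_eq]
  rw [← Complex.ofReal_tsum, Complex.ofReal_re, ENNReal.ofReal_tsum_of_nonneg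
    (fun _ => sq_nonneg _) hZ', ← hsNormSq_star, hsNormSq]
  simp only [ENNReal.ofReal_pow (norm_nonneg _), ofReal_norm]

end IsHilbertSchmidt

theorem sqrt_mul_sqrt_apply {T : H →L[ℂ] H} (hT : 0 ≤ T) (x : H) :
    CFC.sqrt T (CFC.sqrt T x) = T x :=
  congrArg (fun a : H →L[ℂ] H => a x) (CFC.sqrt_mul_sqrt_self T hT)

theorem star_sqrt (T : H →L[ℂ] H) : star (CFC.sqrt T) = CFC.sqrt T :=
  (IsSelfAdjoint.of_nonneg (CFC.sqrt_nonneg T)).star_eq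

theorem inner_sqrt_left (T : H →L[ℂ] H) (x y : H) :
    ⟪CFC.sqrt T x, y⟫_ℂ = ⟪x, CFC.sqrt T y⟫_ℂ := by
  rw [← ContinuousLinearMap.adjoint_inner_right, ← ContinuousLinearMap.star_eq_adjoint, star_sqrt]

theorem norm_sqrt_apply_sq {T : H →L[ℂ] H} (hT : 0 ≤ T) (x : H) :
    ‖CFC.sqrt T x‖ ^ 2 = (⟪x, T x⟫_ℂ).re := by
  rw [← sqrt_mul_sqrt_apply hT x, ← inner_sqrt_left, inner_self_eq_norm_sq_to_K]
  norm_cast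

theorem IsTraceClass.hasSum_norm_sqrt_sq {T : H →L[ℂ] H} (h : IsTraceClass T) (hT : 0 ≤ T) :
    HasSum (fun i => ‖CFC.sqrt T (onb H i)‖ ^ 2) (trace T).re := by
  simpa only [norm_sqrt_apply_sq hT] using h.hasSum_re_inner

theorem IsTraceClass.isHilbertSchmidt_sqrt {T : H →L[ℂ] H} (h : IsTraceClass T) (hT : 0 ≤ T) :
    IsHilbertSchmidt (CFC.sqrt T) :=
  isHilbertSchmidt_iff_summable.2 (h.hasSum_norm_sqrt_sq hT).summable

theorem sum_ketBra_sqrt_onb_le {T : H →L[ℂ] H} (hT : 0 ≤ T)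
    (F : Finset (exists_hilbertBasis ℂ H).choose) :
    ((∑ i ∈ F, ketBra (CFC.sqrt T (onb H i)) (CFC.sqrt T (onb H i)) : traceClass H) : H →L[ℂ] H)
      ≤ T := by
  rw [← sub_nonneg, nonneg_iff_re_inner, Submodule.coe_sum]
  refine ⟨(IsSelfAdjoint.of_nonneg hT).sub (isSelfAdjoint_sum F fun i _ =>
    .of_nonneg (ketBra_self_nonneg _)), fun x => ?_⟩
  have re_inner_ketBra (i) : (⟪x, (ketBra (CFC.sqrt T (onb H i)) (CFC.sqrt T (onb H i)) :
      H →L[ℂ] H) x⟫_ℂ).re = ‖⟪onb H i, CFC.sqrt T x⟫_ℂ‖ ^ 2 := by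
    rw [← inner_sqrt_left]
    exact re_inner_rankOne_self _ _
  rw [sub_apply, inner_sub_right, Complex.sub_re, ← norm_sqrt_apply_sq hT, sum_apply, inner_sum,
    Complex.re_sum, sub_nonneg]
  simp only [re_inner_ketBra]
  exact (onb H).orthonormal.sum_inner_products_le _

end HilbertSchmidtOperators

section Effects

variable {H : Type*} [NormedAddCommGroup H] [InnerProductSpace ℂ H]

theorem ketBra_smul_smul (c : ℂ) (x : H) :
    ketBra (c • x) (c • x) = ((‖c‖ ^ 2 : ℝ) : ℂ) • ketBra x x := by
  refine Subtype.ext ?_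
  simp only [ketBra, map_smul, Submodule.coe_smul, smul_apply, map_smulₛₗ]
  rw [smul_smul, Complex.conj_mul', Complex.ofReal_pow]

theorem ketBra_add_add_ketBra_sub (x y : H) :
    ketBra (x + y) (x + y) + ketBra (x - y) (x - y) =
      (2 : ℂ) • ketBra x x + (2 : ℂ) • ketBra y y := by
  refine Subtype.ext ?_
  simp only [ketBra, map_add, map_sub, Submodule.coe_add, Submodule.coe_smul, add_apply, sub_apply]
  module

theorem ofReal_smul_nonneg {c : ℝ} (hc : 0 ≤ c) {T : H →L[ℂ] H} (hT : 0 ≤ T) :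
    0 ≤ (c : ℂ) • T := by
  rw [ContinuousLinearMap.nonneg_iff_isPositive] at hT ⊢
  exact hT.smul_of_nonneg (Complex.zero_le_real.2 hc)

variable [CompleteSpace H]

theorem ketBra_le_two_smul_add (x y : H) :
    (ketBra x x : H →L[ℂ] H) ≤ ((2 : ℂ) • ketBra y y + (2 : ℂ) • ketBra (x - y) (x - y) :
      traceClass H) := by
  rw [← ketBra_add_add_ketBra_sub, add_sub_cancel, Submodule.coe_add]
  exact le_add_of_nonneg_right (ketBra_self_nonneg _)

theorem ketBra_sqrt_le {T : traceClass H} (hT : 0 ≤ (T : H →L[ℂ] H)) (u : H) :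
    (ketBra (CFC.sqrt (T : H →L[ℂ] H) u) (CFC.sqrt (T : H →L[ℂ] H) u) : H →L[ℂ] H) ≤
      (((‖u‖ ^ 2 : ℝ) : ℂ) • T : traceClass H) := by
  rw [← sub_nonneg, nonneg_iff_re_inner]
  refine ⟨.sub (.of_nonneg (ofReal_smul_nonneg (sq_nonneg _) hT))
    (.of_nonneg (ketBra_self_nonneg _)), fun x => ?_⟩
  have re_inner_ketBra : (⟪x, (ketBra (CFC.sqrt (T : H →L[ℂ] H) u) (CFC.sqrt (T : H →L[ℂ] H) u) :
      H →L[ℂ] H) x⟫_ℂ).re = ‖⟪u, CFC.sqrt (T : H →L[ℂ] H) x⟫_ℂ‖ ^ 2 := by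
    rw [← inner_sqrt_left]
    exact re_inner_rankOne_self _ _
  rw [sub_apply, inner_sub_right, Complex.sub_re, re_inner_ketBra, Submodule.coe_smul, smul_apply,
    inner_smul_right, Complex.re_ofReal_mul, ← norm_sqrt_apply_sq hT, ← mul_pow, sub_nonneg]
  gcongr
  exact norm_inner_le_norm _ _

theorem FaithfulState.denseRange_sqrt (ρ : FaithfulState H) :
    DenseRange fun x => CFC.sqrt (ρ.op : H →L[ℂ] H) x := by
  have ker_eq_bot : (CFC.sqrt (ρ.op : H →L[ℂ] H)).ker = ⊥ := by
    refine (Submodule.eq_bot_iff _).2 fun x hx => by_contra fun hne => ?_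
    have sqrt_apply : CFC.sqrt (ρ.op : H →L[ℂ] H) x = 0 := hx
    have h := ρ.pos' x hne
    rw [← sqrt_mul_sqrt_apply ρ.nonneg' x, sqrt_apply, map_zero, inner_zero_right] at h
    exact h.false
  have range_orthogonal : (CFC.sqrt (ρ.op : H →L[ℂ] H)).rangeᗮ = ⊥ := by
    rw [ContinuousLinearMap.orthogonal_range, ← ContinuousLinearMap.star_eq_adjoint, star_sqrt,
      ker_eq_bot]
  exact Submodule.dense_iff_topologicalClosure_eq_top.2
    (Submodule.topologicalClosure_eq_top_iff.2 range_orthogonal)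

/-- The functionals `T ↦ Tr[T N]`, `0 ≤ N ≤ 1`, seen on the positive cone of `𝒯(H)`: additive,
positively homogeneous, and between `0` and the trace. Values off the cone are irrelevant. -/
structure IsEffect (p : traceClass H → ℝ) : Prop where
  add : ∀ S T : traceClass H, 0 ≤ (S : H →L[ℂ] H) → 0 ≤ (T : H →L[ℂ] H) → p (S + T) = p S + p T
  smul : ∀ (c : ℝ) (T : traceClass H), 0 ≤ c → 0 ≤ (T : H →L[ℂ] H) → p ((c : ℂ) • T) = c * p T
  nonneg : ∀ T : traceClass H, 0 ≤ (T : H →L[ℂ] H) → 0 ≤ p T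
  le_trace : ∀ T : traceClass H, 0 ≤ (T : H →L[ℂ] H) → p T ≤ (trace (T : H →L[ℂ] H)).re

namespace IsEffect

variable {p : traceClass H → ℝ}

theorem sub (hp : IsEffect p) {S T : traceClass H} (hS : 0 ≤ (S : H →L[ℂ] H))
    (h : (S : H →L[ℂ] H) ≤ T) : p (T - S) = p T - p S := by
  rw [eq_sub_iff_add_eq, ← hp.add _ _ (sub_nonneg.2 h) hS, sub_add_cancel]

theorem mono (hp : IsEffect p) {S T : traceClass H} (hS : 0 ≤ (S : H →L[ℂ] H))
    (h : (S : H →L[ℂ] H) ≤ T) : p S ≤ p T := by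
  linarith [hp.sub hS h, hp.nonneg (T - S) (sub_nonneg.2 h)]

theorem zero (hp : IsEffect p) : p 0 = 0 := by
  simpa using hp.add 0 0 le_rfl le_rfl

theorem sum (hp : IsEffect p) {ι : Type*} (s : Finset ι) (f : ι → traceClass H)
    (hf : ∀ i, 0 ≤ (f i : H →L[ℂ] H)) : p (∑ i ∈ s, f i) = ∑ i ∈ s, p (f i) := by
  classical
  induction s using Finset.induction_on with
  | empty => simpa only [Finset.sum_empty] using hp.zero
  | insert a s ha ih =>
    have sum_nonneg : 0 ≤ ((∑ i ∈ s, f i : traceClass H) : H →L[ℂ] H) := by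
      rw [Submodule.coe_sum]
      exact Finset.sum_nonneg fun i _ => hf i
    rw [Finset.sum_insert ha, Finset.sum_insert ha, hp.add _ _ (hf a) sum_nonneg, ih]

theorem ketBra_self_le (hp : IsEffect p) (x : H) : p (ketBra x x) ≤ ‖x‖ ^ 2 := by
  refine (hp.le_trace _ (ketBra_self_nonneg x)).trans_eq ?_
  rw [trace_ketBra, inner_self_eq_norm_sq_to_K]
  norm_cast

theorem hasSum_ketBra_sqrt_onb (hp : IsEffect p) {T : traceClass H} (hT : 0 ≤ (T : H →L[ℂ] H)) :
    HasSum (fun i => p (ketBra (CFC.sqrt (T : H →L[ℂ] H) (onb H i))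
      (CFC.sqrt (T : H →L[ℂ] H) (onb H i)))) (p T) := by
  set v := fun i => CFC.sqrt (T : H →L[ℂ] H) (onb H i)
  have trace_tail (F : Finset _) : (trace ((T - ∑ i ∈ F, ketBra (v i) (v i) : traceClass H) :
      H →L[ℂ] H)).re = (trace (T : H →L[ℂ] H)).re - ∑ i ∈ F, ‖v i‖ ^ 2 := by
    rw [Submodule.coe_sub, trace_sub T.2 (∑ i ∈ F, ketBra (v i) (v i)).2, Submodule.coe_sum,
      trace_sum F fun i _ => (ketBra (v i) (v i)).2, Complex.sub_re, Complex.re_sum]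
    simp only [trace_ketBra, inner_self_eq_norm_sq_to_K]
    norm_cast
  have apply_tail (F : Finset _) :
      p (T - ∑ i ∈ F, ketBra (v i) (v i)) = p T - ∑ i ∈ F, p (ketBra (v i) (v i)) := by
    rw [hp.sub _ (sum_ketBra_sqrt_onb_le hT F), hp.sum F _ fun i => ketBra_self_nonneg _]
    rw [Submodule.coe_sum]
    exact Finset.sum_nonneg fun i _ => ketBra_self_nonneg _
  have tail_nonneg (F : Finset _) :
      0 ≤ ((T - ∑ i ∈ F, ketBra (v i) (v i) : traceClass H) : H →L[ℂ] H) :=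
    sub_nonneg.2 (sum_ketBra_sqrt_onb_le hT F)
  have trace_tail_tendsto := (T.2.hasSum_norm_sqrt_sq hT).const_sub (trace (T : H →L[ℂ] H)).re
  rw [sub_self] at trace_tail_tendsto
  have tail_tendsto := squeeze_zero (fun F => hp.nonneg _ (tail_nonneg F))
    (fun F => (hp.le_trace _ (tail_nonneg F)).trans_eq (trace_tail F)) trace_tail_tendsto
  simpa only [apply_tail, sub_sub_cancel, sub_zero, HasSum] using tail_tendsto.const_sub (p T)

variable {α : Type*} {l : Filter α} {q : α → traceClass H → ℝ}

theorem tendsto_ketBra_sqrt_zero (hq : ∀ a, IsEffect (q a)) {T : traceClass H}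
    (hT : 0 ≤ (T : H →L[ℂ] H)) (h : Filter.Tendsto (fun a => q a T) l (nhds 0)) (u : H) :
    Filter.Tendsto (fun a => q a (ketBra (CFC.sqrt (T : H →L[ℂ] H) u)
      (CFC.sqrt (T : H →L[ℂ] H) u))) l (nhds 0) := by
  refine squeeze_zero (fun a => (hq a).nonneg _ (ketBra_self_nonneg _)) (fun a => ?_)
    (mul_zero (‖u‖ ^ 2) ▸ h.const_mul (‖u‖ ^ 2))
  rw [← (hq a).smul _ _ (sq_nonneg _) hT]
  exact (hq a).mono (ketBra_self_nonneg _) (ketBra_sqrt_le hT u)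

theorem tendsto_ketBra_zero_of_dense (hq : ∀ a, IsEffect (q a)) {s : Set H} (hs : Dense s)
    (h : ∀ y ∈ s, Filter.Tendsto (fun a => q a (ketBra y y)) l (nhds 0)) (x : H) :
    Filter.Tendsto (fun a => q a (ketBra x x)) l (nhds 0) := by
  refine tendsto_order.2 ⟨fun r hr => .of_forall fun a => hr.trans_le
    ((hq a).nonneg _ (ketBra_self_nonneg _)), fun ε hε => ?_⟩
  obtain ⟨y, hy, hxy⟩ := hs.exists_dist_lt x (ε := √(ε / 4)) (by positivity)
  have norm_sub_sq_lt : ‖x - y‖ ^ 2 < ε / 4 := by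
    rwa [dist_eq_norm, Real.lt_sqrt (norm_nonneg _)] at hxy
  filter_upwards [(tendsto_order.1 (h y hy)).2 (ε / 4) (by positivity)] with a ha
  have double {z : H} : q a ((2 : ℂ) • ketBra z z) = 2 * q a (ketBra z z) := by
    simpa only [Complex.ofReal_ofNat] using (hq a).smul 2 _ zero_le_two (ketBra_self_nonneg z)
  have two_smul_nonneg {z : H} : 0 ≤ (((2 : ℂ) • ketBra z z : traceClass H) : H →L[ℂ] H) := by
    simpa only [Complex.ofReal_ofNat, Submodule.coe_smul] using
      ofReal_smul_nonneg zero_le_two (ketBra_self_nonneg z)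
  have hle := (hq a).mono (ketBra_self_nonneg _) (ketBra_le_two_smul_add x y)
  rw [(hq a).add _ _ two_smul_nonneg two_smul_nonneg, double, double] at hle
  linarith [(hq a).ketBra_self_le (x - y)]

theorem tendsto_zero_of_faithfulState (ρ : FaithfulState H) (hq : ∀ a, IsEffect (q a))
    (h : Filter.Tendsto (fun a => q a ρ.op) l (nhds 0)) {T : traceClass H}
    (hT : 0 ≤ (T : H →L[ℂ] H)) : Filter.Tendsto (fun a => q a T) l (nhds 0) := by
  have tendsto_ketBra (x : H) : Filter.Tendsto (fun a => q a (ketBra x x)) l (nhds 0) :=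
    tendsto_ketBra_zero_of_dense hq ρ.denseRange_sqrt
      (Set.forall_mem_range.2 (tendsto_ketBra_sqrt_zero hq ρ.nonneg' h)) x
  simp only [← ((hq _).hasSum_ketBra_sqrt_onb hT).tsum_eq]
  rw [← tsum_zero (β := (exists_hilbertBasis ℂ H).choose)]
  refine tendsto_tsum_of_dominated_convergence (T.2.hasSum_norm_sqrt_sq hT).summable
    (fun i => tendsto_ketBra _) (.of_forall fun a i => ?_)
  rw [Real.norm_of_nonneg ((hq a).nonneg _ (ketBra_self_nonneg _))]
  exact (hq a).ketBra_self_le _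

end IsEffect

end Effects

section EffectOperators

variable {H : Type*} [NormedAddCommGroup H] [InnerProductSpace ℂ H] {p : traceClass H → ℝ}

/-- Real linear relations between rank one projections are inherited by effect functionals: the
positive and the negative coefficients give two equal sums in the positive cone. -/
theorem IsEffect.sum_mul_eq_zero [CompleteSpace H] (hp : IsEffect p) {ι : Type*} (s : Finset ι)
    (c : ι → ℝ) (v : ι → H)
    (h : ∑ i ∈ s, (c i : ℂ) • ketBra (v i) (v i) = 0) :
    ∑ i ∈ s, c i * p (ketBra (v i) (v i)) = 0 := by
  have apply_sum {d : ι → ℝ} (hd : ∀ i, 0 ≤ d i) : p (∑ i ∈ s, (d i : ℂ) • ketBra (v i) (v i)) =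
      ∑ i ∈ s, d i * p (ketBra (v i) (v i)) := by
    rw [hp.sum s _ fun i => ofReal_smul_nonneg (hd i) (ketBra_self_nonneg _)]
    exact Finset.sum_congr rfl fun i _ => hp.smul _ _ (hd i) (ketBra_self_nonneg _)
  have posPart_eq_negPart : ∑ i ∈ s, (((c i)⁺ : ℝ) : ℂ) • ketBra (v i) (v i) =
      ∑ i ∈ s, (((c i)⁻ : ℝ) : ℂ) • ketBra (v i) (v i) := by
    rw [← sub_eq_zero, ← Finset.sum_sub_distrib, ← h]
    refine Finset.sum_congr rfl fun i _ => ?_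
    exact (sub_smul _ _ _).symm.trans (by rw [← Complex.ofReal_sub, posPart_sub_negPart])
  have apply_eq := congrArg p posPart_eq_negPart
  rw [apply_sum fun i => posPart_nonneg _, apply_sum fun i => negPart_nonneg _, ← sub_eq_zero,
    ← Finset.sum_sub_distrib] at apply_eq
  simpa only [← sub_mul, posPart_sub_negPart] using apply_eq

variable [CompleteSpace H]

theorem IsEffect.ketBra_smul (hp : IsEffect p) (c : ℂ) (x : H) :
    p (ketBra (c • x) (c • x)) = ‖c‖ ^ 2 * p (ketBra x x) := by
  rw [ketBra_smul_smul, hp.smul _ _ (sq_nonneg _) (ketBra_self_nonneg x)]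

theorem IsEffect.ketBra_real_smul (hp : IsEffect p) (a : ℝ) (x : H) :
    p (ketBra (a • x) (a • x)) = a ^ 2 * p (ketBra x x) := by
  rw [← Complex.coe_smul, hp.ketBra_smul, Complex.norm_real, Real.norm_eq_abs, sq_abs]

open QuadraticMap in
theorem IsEffect.polar_add_left (hp : IsEffect p) (x x' y : H) :
    polar (fun x => p (ketBra x x)) (x + x') y =
      polar (fun x => p (ketBra x x)) x y + polar (fun x => p (ketBra x x)) x' y := by
  have h := hp.sum_mul_eq_zero Finset.univ ![1, 1, 1, 1, -1, -1, -1]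
    ![x + x' + y, x, x', y, x + x', x + y, x' + y] (Subtype.ext ?_)
  · simp only [Fin.sum_univ_seven, Matrix.cons_val] at h
    unfold polar
    linarith
  · simp only [Fin.sum_univ_seven, Matrix.cons_val, ketBra, map_add, add_apply, Submodule.coe_add,
      Submodule.coe_smul, Submodule.coe_zero, Complex.ofReal_one, Complex.ofReal_neg]
    module

open QuadraticMap in
theorem IsEffect.polar_smul_left (hp : IsEffect p) (a : ℝ) (x y : H) :
    polar (fun x => p (ketBra x x)) (a • x) y = a • polar (fun x => p (ketBra x x)) x y := by
  have h := hp.sum_mul_eq_zero Finset.univ ![1, a - a ^ 2, a - 1, -a]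
    ![a • x + y, x, y, x + y] (Subtype.ext ?_)
  · simp only [Fin.sum_univ_four, Matrix.cons_val] at h
    rw [polar, polar, hp.ketBra_real_smul, smul_eq_mul]
    linarith
  · simp only [Fin.sum_univ_four, Matrix.cons_val, ketBra, ← Complex.coe_smul, map_add, add_apply,
      map_smul, map_smulₛₗ, Complex.conj_ofReal, smul_apply, Submodule.coe_add,
      Submodule.coe_smul, Submodule.coe_zero]
    push_cast
    module

/-- The quadratic form `x ↦ p |x⟩⟨x|` of an effect functional `p`, on `H` seen as a real space. -/
noncomputable def IsEffect.quadraticForm (hp : IsEffect p) : QuadraticForm ℝ H :=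
  .ofPolar (fun x => p (ketBra x x))
    (fun a x => by rw [hp.ketBra_real_smul, sq, smul_eq_mul])
    hp.polar_add_left hp.polar_smul_left

theorem exists_operator_re_inner_eq (B : LinearMap.BilinForm ℝ H) {C : ℝ}
    (bound : ∀ x y, ‖B x y‖ ≤ C * ‖x‖ * ‖y‖)
    (I_smul : ∀ x y, B (Complex.I • x) (Complex.I • y) = B x y) :
    ∃ N : H →L[ℂ] H, ∀ x y, (⟪N x, y⟫_ℂ).re = B x y := by
  let _ : InnerProductSpace ℝ H := .complexToReal
  let R : H →L[ℝ] H :=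
    InnerProductSpace.continuousLinearMapOfBilin (𝕜 := ℝ) (B.mkContinuous₂ C bound)
  have R_apply (x y : H) : (⟪R x, y⟫_ℂ).re = B x y :=
    InnerProductSpace.continuousLinearMapOfBilin_apply (𝕜 := ℝ) _ x y
  have R_I_smul (x : H) : R (Complex.I • x) = Complex.I • R x := by
    refine ext_inner_right ℝ fun y => ?_
    obtain ⟨z, rfl⟩ : ∃ z, Complex.I • z = y :=
      ⟨-(Complex.I • y), by rw [smul_neg, smul_smul, Complex.I_mul_I, neg_one_smul, neg_neg]⟩
    change (⟪_, _⟫_ℂ).re = (⟪_, _⟫_ℂ).re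
    rw [R_apply, I_smul, ← R_apply, inner_smul_left, inner_smul_right, ← mul_assoc,
      Complex.conj_I, neg_mul, Complex.I_mul_I, neg_neg, one_mul]
  have R_smul (c : ℂ) (x : H) : R (c • x) = c • R x := by
    rw [← Complex.re_add_im c, add_smul, add_smul, mul_smul, mul_smul, Complex.coe_smul,
      Complex.coe_smul, Complex.coe_smul, Complex.coe_smul, map_add, map_smul, map_smul, R_I_smul]
  exact ⟨⟨⟨R.toAddHom, R_smul⟩, R.cont⟩, R_apply⟩

open QuadraticMap in
theorem exists_operator_of_quadraticForm (Q : QuadraticForm ℝ H) (nonneg : ∀ x, 0 ≤ Q x)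
    (le_norm_sq : ∀ x, Q x ≤ ‖x‖ ^ 2) (I_smul : ∀ x, Q (Complex.I • x) = Q x) :
    ∃ N : H →L[ℂ] H, IsSelfAdjoint N ∧ ∀ x, (⟪x, N x⟫_ℂ).re = Q x := by
  set B : LinearMap.BilinForm ℝ H := associated Q
  have B_self (x : H) : B x x = Q x := associated_eq_self_apply ℝ Q x
  have B_comm (x y : H) : B x y = B y x := associated_isSymm ℝ Q x y
  have norm_B_le (x y : H) : ‖B x y‖ ≤ 1 * ‖x‖ * ‖y‖ := by
    rw [one_mul]
    refine abs_le_of_sq_le_sq ?_ (by positivity)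
    refine (LinearMap.BilinForm.apply_sq_le_of_symm B
      (fun x => (nonneg x).trans_eq (B_self x).symm) ⟨B_comm⟩ x y).trans ?_
    rw [mul_pow, B_self, B_self]
    exact mul_le_mul (le_norm_sq x) (le_norm_sq y) (nonneg y) (sq_nonneg _)
  have B_I (x y : H) : B (Complex.I • x) (Complex.I • y) = B x y := by
    simp only [B, associated_apply, ← smul_add, I_smul]
  obtain ⟨N, hN⟩ := exists_operator_re_inner_eq B norm_B_le B_I
  let _ : InnerProductSpace ℝ H := .complexToReal
  refine ⟨N, ContinuousLinearMap.ext fun x => ext_inner_right ℝ fun y => ?_, fun x => ?_⟩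
  · change (⟪(star N) x, y⟫_ℂ).re = (⟪N x, y⟫_ℂ).re
    rw [ContinuousLinearMap.star_eq_adjoint, ContinuousLinearMap.adjoint_inner_left, hN,
      B_comm, ← hN]
    exact inner_re_symm (𝕜 := ℂ) _ _
  · rw [← B_self, ← hN]
    exact inner_re_symm (𝕜 := ℂ) _ _

theorem re_trace_ketBra_mul (x : H) (N : H →L[ℂ] H) :
    (trace ((ketBra x x : H →L[ℂ] H) * N)).re = (⟪x, N x⟫_ℂ).re := by
  have mul_ketBra : N * (ketBra x x : H →L[ℂ] H) = ketBra (N x) x :=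
    ContinuousLinearMap.ext fun z => map_smul N _ _
  rw [trace_mul_comm (ketBra x x).2, mul_ketBra, trace_ketBra]

theorem isEffect_trace_mul {N : H →L[ℂ] H} (h0 : 0 ≤ N) (h1 : N ≤ 1) :
    IsEffect fun T : traceClass H => (trace ((T : H →L[ℂ] H) * N)).re where
  add S T _ _ := by
    rw [Submodule.coe_add, add_mul, trace_add (S.2.mul_right N) (T.2.mul_right N), Complex.add_re]
  smul c T _ _ := by
    rw [Submodule.coe_smul, smul_mul_assoc, trace_smul, Complex.re_ofReal_mul]
  nonneg T hT := (Complex.nonneg_iff.1 (trace_mul_nonneg T.2 hT h0)).1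
  le_trace T hT := by
    have h := (Complex.nonneg_iff.1 (trace_mul_nonneg T.2 hT (sub_nonneg.2 h1))).1
    rwa [mul_sub, mul_one, trace_sub T.2 (T.2.mul_right N), Complex.sub_re, sub_nonneg] at h

theorem IsEffect.exists_operator (hp : IsEffect p) :
    ∃ N : H →L[ℂ] H, 0 ≤ N ∧ N ≤ 1 ∧
      ∀ T : traceClass H, 0 ≤ (T : H →L[ℂ] H) → p T = (trace ((T : H →L[ℂ] H) * N)).re := by
  obtain ⟨N, N_selfAdjoint, hN⟩ := exists_operator_of_quadraticForm hp.quadraticForm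
    (fun x => hp.nonneg _ (ketBra_self_nonneg x)) hp.ketBra_self_le
    (fun x => (hp.ketBra_smul Complex.I x).trans
      (by rw [Complex.norm_I, one_pow, one_mul]; rfl))
  replace hN (x : H) : (⟪x, N x⟫_ℂ).re = p (ketBra x x) := hN x
  have N_nonneg : 0 ≤ N := nonneg_iff_re_inner.2
    ⟨N_selfAdjoint, fun x => (hp.nonneg _ (ketBra_self_nonneg x)).trans_eq (hN x).symm⟩
  have N_le_one : N ≤ 1 := by
    refine sub_nonneg.1 (nonneg_iff_re_inner.2 ⟨.sub (.one _) N_selfAdjoint, fun x => ?_⟩)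
    rw [sub_apply, inner_sub_right, Complex.sub_re, hN, sub_nonneg]
    exact (hp.ketBra_self_le x).trans_eq (inner_self_eq_norm_sq (𝕜 := ℂ) x).symm
  refine ⟨N, N_nonneg, N_le_one, fun T hT => (hp.hasSum_ketBra_sqrt_onb hT).unique ?_⟩
  simpa only [re_trace_ketBra_mul, hN] using
    (isEffect_trace_mul N_nonneg N_le_one).hasSum_ketBra_sqrt_onb hT

end EffectOperators

section FisherInformation

open MeasureTheory

variable {Ω : Type*} [MeasurableSpace Ω] {μ ν₁ ν₂ : Measure Ω}

theorem ofReal_sq_integral_mul_le {g l : Ω → ℝ} (hg : AEMeasurable g μ) (hl : AEMeasurable l μ) :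
    ENNReal.ofReal ((∫ x, g x * l x ∂μ) ^ 2) ≤
      (∫⁻ x, ENNReal.ofReal (g x ^ 2) ∂μ) * ∫⁻ x, ENNReal.ofReal (l x ^ 2) ∂μ := by
  have ofReal_sq (r : ℝ) : ENNReal.ofReal (r ^ 2) = ‖r‖ₑ ^ (2 : ℝ) := by
    rw [ENNReal.rpow_two, ← enorm_pow, Real.enorm_of_nonneg (sq_nonneg r)]
  have rpow_half_rpow_two (a : ℝ≥0∞) : (a ^ (1 / 2 : ℝ)) ^ (2 : ℝ) = a := by
    rw [← ENNReal.rpow_mul, one_div, inv_mul_cancel₀ two_ne_zero, ENNReal.rpow_one]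
  simp only [ofReal_sq]
  calc ‖∫ x, g x * l x ∂μ‖ₑ ^ (2 : ℝ)
      ≤ ((∫⁻ x, ‖g x‖ₑ ^ (2 : ℝ) ∂μ) ^ (1 / 2 : ℝ) *
          (∫⁻ x, ‖l x‖ₑ ^ (2 : ℝ) ∂μ) ^ (1 / 2 : ℝ)) ^ (2 : ℝ) := by
        gcongr
        refine (enorm_integral_le_lintegral_enorm _).trans ?_
        simp only [enorm_mul]
        exact ENNReal.lintegral_mul_le_Lp_mul_Lq μ .two_two hg.enorm hl.enorm
    _ = (∫⁻ x, ‖g x‖ₑ ^ (2 : ℝ) ∂μ) * ∫⁻ x, ‖l x‖ₑ ^ (2 : ℝ) ∂μ := by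
        rw [ENNReal.mul_rpow_of_nonneg _ _ zero_le_two, rpow_half_rpow_two, rpow_half_rpow_two]

theorem setLIntegral_ofReal_sq_le_of_forall_bounded [IsFiniteMeasure μ] {l : Ω → ℝ}
    (hl : Measurable l) {K : ℝ≥0∞}
    (h : ∀ g : Ω → ℝ, Measurable g → (∃ C, ∀ x, |g x| ≤ C) →
      ENNReal.ofReal ((∫ x, g x * l x ∂μ) ^ 2) ≤ (∫⁻ x, ENNReal.ofReal (g x ^ 2) ∂μ) * K)
    {S : Set Ω} (hS : MeasurableSet S) {C : ℝ} (hC : ∀ x ∈ S, |l x| ≤ C) :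
    ∫⁻ x in S, ENNReal.ofReal (l x ^ 2) ∂μ ≤ K := by
  have integrableOn_sq : IntegrableOn (fun x => l x ^ 2) S μ := by
    refine .of_bound (measure_lt_top _ _) (hl.pow_const 2).aestronglyMeasurable (C ^ 2)
      (ae_restrict_of_forall_mem hS fun x hx => ?_)
    rw [norm_pow]
    exact pow_le_pow_left₀ (norm_nonneg _) (hC x hx) 2
  have abs_indicator_le (x : Ω) : |S.indicator l x| ≤ |C| := by
    by_cases hx : x ∈ S
    · simpa only [Set.indicator_of_mem hx] using (hC x hx).trans (le_abs_self C)
    · simpa only [Set.indicator_of_notMem hx, abs_zero] using abs_nonneg C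
  have sq_indicator : (fun x => ENNReal.ofReal (S.indicator l x ^ 2)) =
      S.indicator fun x => ENNReal.ofReal (l x ^ 2) := by
    ext x
    by_cases hx : x ∈ S <;> simp [hx]
  have indicator_mul : (fun x => S.indicator l x * l x) = S.indicator fun x => l x ^ 2 := by
    ext x
    by_cases hx : x ∈ S <;> simp [hx, sq]
  have sq_le_mul := h (S.indicator l) (hl.indicator hS) ⟨|C|, abs_indicator_le⟩
  rw [sq_indicator, indicator_mul, lintegral_indicator hS, integral_indicator hS,
    ENNReal.ofReal_pow (integral_nonneg fun x => sq_nonneg _),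
    ofReal_integral_eq_lintegral_ofReal integrableOn_sq (.of_forall fun x => sq_nonneg _),
    sq] at sq_le_mul
  have ne_top : ∫⁻ x in S, ENNReal.ofReal (l x ^ 2) ∂μ ≠ ⊤ := by
    rw [← ofReal_integral_eq_lintegral_ofReal integrableOn_sq (.of_forall fun x => sq_nonneg _)]
    exact ENNReal.ofReal_ne_top
  rcases eq_or_ne (∫⁻ x in S, ENNReal.ofReal (l x ^ 2) ∂μ) 0 with h0 | h0
  · exact h0.trans_le zero_le
  · exact (ENNReal.mul_le_mul_iff_right h0 ne_top).1 sq_le_mul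

theorem lintegral_ofReal_sq_le_of_forall_bounded [IsFiniteMeasure μ] {l : Ω → ℝ} (hl : Measurable l)
    {K : ℝ≥0∞}
    (h : ∀ g : Ω → ℝ, Measurable g → (∃ C, ∀ x, |g x| ≤ C) →
      ENNReal.ofReal ((∫ x, g x * l x ∂μ) ^ 2) ≤ (∫⁻ x, ENNReal.ofReal (g x ^ 2) ∂μ) * K) :
    ∫⁻ x, ENNReal.ofReal (l x ^ 2) ∂μ ≤ K := by
  let S (n : ℕ) : Set Ω := {x | |l x| ≤ n}
  have measurableSet_S (n : ℕ) : MeasurableSet (S n) := measurableSet_le hl.abs measurable_const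
  have directed_S : Directed (· ⊆ ·) S :=
    directed_of_isDirected_le fun m n hmn x (hx : |l x| ≤ m) => hx.trans (Nat.cast_le.2 hmn)
  have iUnion_S : ⋃ n, S n = Set.univ :=
    Set.eq_univ_of_forall fun x => Set.mem_iUnion.2 (exists_nat_ge |l x|)
  rw [← setLIntegral_univ, ← iUnion_S, setLIntegral_iUnion_of_directed _ directed_S]
  exact iSup_le fun n =>
    setLIntegral_ofReal_sq_le_of_forall_bounded hl h (measurableSet_S n) fun _ hx => hx

theorem integral_mul_eq_of_setIntegral_eq [IsFiniteMeasure ν₁] [IsFiniteMeasure ν₂] {l : Ω → ℝ}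
    (hl : Integrable l μ) (h : ∀ S, MeasurableSet S → ∫ x in S, l x ∂μ = ν₁.real S - ν₂.real S)
    {g : Ω → ℝ} (hg : Measurable g) {C : ℝ} (hC : ∀ x, |g x| ≤ C) :
    ∫ x, g x * l x ∂μ = ∫ x, g x ∂ν₁ - ∫ x, g x ∂ν₂ := by
  let pos : Measure Ω := μ.withDensity fun x => ENNReal.ofReal (l x)
  let neg : Measure Ω := μ.withDensity fun x => ENNReal.ofReal (-l x)
  have : IsFiniteMeasure pos := isFiniteMeasure_withDensity_ofReal hl.2
  have : IsFiniteMeasure neg := isFiniteMeasure_withDensity_ofReal hl.neg.2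
  have integrable_g (ν : Measure Ω) [IsFiniteMeasure ν] : Integrable g ν :=
    .of_bound hg.aestronglyMeasurable C (.of_forall hC)
  have integral_withDensity {k : Ω → ℝ} (hk : Integrable k μ) :
      ∫ x, g x ∂(μ.withDensity fun x => ENNReal.ofReal (k x)) = ∫ x, g x * max (k x) 0 ∂μ := by
    rw [integral_withDensity_eq_integral_toReal_smul₀ hk.aemeasurable.ennreal_ofReal
      (.of_forall fun _ => ENNReal.ofReal_lt_top)]
    simp only [ENNReal.toReal_ofReal', smul_eq_mul, mul_comm]
  have pos_add : pos + ν₂ = neg + ν₁ := by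
    refine Measure.ext fun S hS => ?_
    have split := h S hS
    rw [integral_eq_lintegral_pos_part_sub_lintegral_neg_part hl.integrableOn,
      ← withDensity_apply _ hS, ← withDensity_apply _ hS] at split
    rw [← measureReal_eq_measureReal_iff, measureReal_add_apply, measureReal_add_apply]
    simp only [measureReal_def] at split ⊢
    linarith
  have integral_add := congrArg (fun ν : Measure Ω => ∫ x, g x ∂ν) pos_add
  rw [integral_add_measure (integrable_g _) (integrable_g _),
    integral_add_measure (integrable_g _) (integrable_g _), integral_withDensity hl,
    show ∫ x, g x ∂neg = ∫ x, g x * max (-l x) 0 ∂μ from integral_withDensity hl.neg]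
    at integral_add
  calc ∫ x, g x * l x ∂μ = ∫ x, (g x * max (l x) 0 - g x * max (-l x) 0) ∂μ := by
        simp only [← mul_sub, max_zero_sub_max_neg_zero_eq_self]
    _ = ∫ x, g x * max (l x) 0 ∂μ - ∫ x, g x * max (-l x) 0 ∂μ :=
        integral_sub (hl.pos_part.bdd_mul hg.aestronglyMeasurable (.of_forall hC))
          (hl.neg.pos_part.bdd_mul hg.aestronglyMeasurable (.of_forall hC))
    _ = ∫ x, g x ∂ν₁ - ∫ x, g x ∂ν₂ := by linarith

variable {H : Type*} [NormedAddCommGroup H] [InnerProductSpace ℂ H] [CompleteSpace H]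
  {Ω' : Type*} [MeasurableSpace Ω']

theorem POVM.law_apply (M : POVM Ω H) (ρ : FaithfulState H) {S : Set Ω} (hS : MeasurableSet S) :
    M.law ρ S = ENNReal.ofReal (trace ((ρ.op : H →L[ℂ] H) * M.toFun S)).re :=
  Measure.ofMeasurable_apply S hS

instance POVM.isFiniteMeasure_law (M : POVM Ω H) (ρ : FaithfulState H) :
    IsFiniteMeasure (M.law ρ) :=
  ⟨by rw [M.law_apply ρ .univ]; exact ENNReal.ofReal_lt_top⟩

theorem POVM.signedLaw_apply (M : POVM Ω H) (T : traceClass H) {S : Set Ω} (hS : MeasurableSet S) :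
    M.signedLaw T S = (trace ((T : H →L[ℂ] H) * M.toFun S)).re :=
  if_pos hS

theorem FaithfulState.eq_zero_of_trace_mul (ρ : FaithfulState H) {N : H →L[ℂ] H} (hN : 0 ≤ N)
    (h : (trace ((ρ.op : H →L[ℂ] H) * N)).re = 0) : N = 0 := by
  have trace_eq : trace ((ρ.op : H →L[ℂ] H) * N) =
      trace (CFC.sqrt N * (ρ.op : H →L[ℂ] H) * CFC.sqrt N) := by
    rw [trace_mul_comm (ρ.op.2.mul_left _), ← mul_assoc, CFC.sqrt_mul_sqrt_self N hN,
      trace_mul_comm ρ.op.2]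
  have inner_eq (x : H) : ⟪x, (CFC.sqrt N * (ρ.op : H →L[ℂ] H) * CFC.sqrt N) x⟫_ℂ =
      ⟪CFC.sqrt N x, (ρ.op : H →L[ℂ] H) (CFC.sqrt N x)⟫_ℂ :=
    (inner_sqrt_left N x _).symm
  have hasSum_zero := ((ρ.op.2.mul_left (CFC.sqrt N)).mul_right (CFC.sqrt N)).hasSum_re_inner
  simp only [← trace_eq, h, inner_eq] at hasSum_zero
  have inner_zero := (hasSum_zero_iff_of_nonneg fun i =>
    (nonneg_iff_re_inner.1 ρ.nonneg').2 (CFC.sqrt N (onb H i))).1 hasSum_zero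
  have sqrt_zero : CFC.sqrt N = 0 := by
    refine ContinuousLinearMap.ext_on
      (Submodule.dense_iff_topologicalClosure_eq_top.2 (onb H).dense_span) ?_
    rintro _ ⟨i, rfl⟩
    by_contra hne
    exact (Complex.pos_iff.1 (ρ.pos' _ hne)).1.ne' (congrFun inner_zero i)
  rw [← CFC.sqrt_mul_sqrt_self N hN, sqrt_zero, mul_zero]

theorem POVM.signedLaw_absolutelyContinuous (M : POVM Ω H) (ρ : FaithfulState H)
    (T : traceClass H) : M.signedLaw T ≪ᵥ (M.law ρ).toENNRealVectorMeasure := by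
  refine VectorMeasure.AbsolutelyContinuous.mk fun S hS h => ?_
  rw [Measure.toENNRealVectorMeasure_apply_measurable hS, M.law_apply ρ hS,
    ENNReal.ofReal_eq_zero] at h
  have nonneg := (Complex.nonneg_iff.1 (trace_mul_nonneg ρ.op.2 ρ.nonneg' (M.nonneg' S hS))).1
  rw [M.signedLaw_apply T hS, ρ.eq_zero_of_trace_mul (M.nonneg' S hS) (le_antisymm h nonneg),
    mul_zero]
  simp [trace]

theorem fisherInfo_le_iff {M : POVM Ω H} {ρ : FaithfulState H} {φ : traceClass H}
    [IsFiniteMeasure ν₁] [IsFiniteMeasure ν₂]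
    (h : ∀ S, MeasurableSet S → M.signedLaw φ S = ν₁.real S - ν₂.real S) {K : ℝ≥0∞} :
    fisherInfo M ρ φ ≤ K ↔ ∀ g : Ω → ℝ, Measurable g → (∃ C, ∀ x, |g x| ≤ C) →
      ENNReal.ofReal ((∫ x, g x ∂ν₁ - ∫ x, g x ∂ν₂) ^ 2) ≤
        (∫⁻ x, ENNReal.ofReal (g x ^ 2) ∂M.law ρ) * K := by
  have measurable_rnDeriv := SignedMeasure.measurable_rnDeriv (M.signedLaw φ) (M.law ρ)
  have integrable_rnDeriv := SignedMeasure.integrable_rnDeriv (M.signedLaw φ) (M.law ρ)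
  have setIntegral_rnDeriv (S : Set Ω) (hS : MeasurableSet S) :
      ∫ x in S, (M.signedLaw φ).rnDeriv (M.law ρ) x ∂M.law ρ = ν₁.real S - ν₂.real S := by
    rw [← h S hS, ← withDensityᵥ_apply integrable_rnDeriv hS,
      SignedMeasure.withDensityᵥ_rnDeriv_eq _ _ (M.signedLaw_absolutelyContinuous ρ φ)]
  have integral_mul {g : Ω → ℝ} (hg : Measurable g) {C : ℝ} (hC : ∀ x, |g x| ≤ C) :=
    integral_mul_eq_of_setIntegral_eq integrable_rnDeriv setIntegral_rnDeriv hg hC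
  constructor
  · rintro hK g hg ⟨C, hC⟩
    rw [← integral_mul hg hC]
    exact (ofReal_sq_integral_mul_le hg.aemeasurable measurable_rnDeriv.aemeasurable).trans
      (by gcongr; exact hK)
  · refine fun hK => lintegral_ofReal_sq_le_of_forall_bounded measurable_rnDeriv ?_
    rintro g hg ⟨C, hC⟩
    rw [integral_mul hg hC]
    exact hK g hg ⟨C, hC⟩

theorem signedMeasure_apply_eq_sub (s : SignedMeasure Ω) {S : Set Ω} (hS : MeasurableSet S) :
    s S = s.toJordanDecomposition.posPart.real S - s.toJordanDecomposition.negPart.real S := by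
  conv_lhs => rw [← s.toSignedMeasure_toJordanDecomposition]
  rw [JordanDecomposition.toSignedMeasure, sub_apply,
    Measure.toSignedMeasure_apply_measurable hS, Measure.toSignedMeasure_apply_measurable hS]

theorem fisherInfo_le_of_preimage {M : POVM Ω H} {M' : POVM Ω' H} {f : Ω → Ω'} (hf : Measurable f)
    (h : ∀ S, MeasurableSet S → M'.toFun S = M.toFun (f ⁻¹' S)) (ρ : FaithfulState H)
    (φ : traceClass H) : fisherInfo M' ρ φ ≤ fisherInfo M ρ φ := by
  let j := (M.signedLaw φ).toJordanDecomposition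
  have signedLaw_eq (S : Set Ω') (hS : MeasurableSet S) :
      M'.signedLaw φ S = (j.posPart.map f).real S - (j.negPart.map f).real S := by
    rw [map_measureReal_apply hf hS, map_measureReal_apply hf hS,
      ← signedMeasure_apply_eq_sub _ (hf hS), M.signedLaw_apply φ (hf hS),
      M'.signedLaw_apply φ hS, h S hS]
  have law_eq : M'.law ρ = (M.law ρ).map f := by
    refine Measure.ext fun S hS => ?_
    rw [Measure.map_apply hf hS, M'.law_apply ρ hS, M.law_apply ρ (hf hS), h S hS]
  refine (fisherInfo_le_iff signedLaw_eq).2 ?_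
  rintro g hg ⟨C, hC⟩
  rw [law_eq, integral_map hf.aemeasurable hg.aestronglyMeasurable,
    integral_map hf.aemeasurable hg.aestronglyMeasurable, lintegral_map (by fun_prop) hf]
  exact (fisherInfo_le_iff fun _ => signedMeasure_apply_eq_sub _).1 le_rfl (g ∘ f) (hg.comp hf)
    ⟨C, fun x => hC (f x)⟩

end FisherInformation

section ExcessError

variable {V : Type*} {D : Set V} {J J' : V → ℝ≥0∞}

theorem inverseForm_anti (b : V → ℝ) (h : ∀ φ ∈ D, J' φ ≤ J φ) :
    inverseForm D J b ≤ inverseForm D J' b :=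
  iSup₂_mono fun φ hφ => ENNReal.div_le_div_left (h φ hφ) _

theorem excessError_anti (b : V → ℝ) (v : ℝ) (h : ∀ φ ∈ D, J' φ ≤ J φ) :
    excessError D J b v ≤ excessError D J' b v := by
  unfold excessError
  split_ifs with hb hb' hb'
  · exact EReal.sub_le_sub (EReal.coe_ennreal_le_coe_ennreal_iff.2 (inverseForm_anti b h)) le_rfl
  · exact le_top
  · exact absurd (fun φ hφ h0 => hb' φ hφ (le_antisymm ((h φ hφ).trans h0.le) zero_le)) hb
  · rfl

end ExcessError

section POVMOfMeasures

open MeasureTheory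

variable {H : Type*} [NormedAddCommGroup H] [InnerProductSpace ℂ H]

theorem hasSum_inner_of_hasSum_inner_self {ι : Type*} {N : ι → H →L[ℂ] H} {L : H →L[ℂ] H}
    (h : ∀ x, HasSum (fun i => ⟪x, N i x⟫_ℂ) ⟪x, L x⟫_ℂ) (x y : H) :
    HasSum (fun i => ⟪x, N i y⟫_ℂ) ⟪x, L y⟫_ℂ := by
  have polarization (T : H →L[ℂ] H) : ⟪x, T y⟫_ℂ =
      (⟪x + y, T (x + y)⟫_ℂ - ⟪x - y, T (x - y)⟫_ℂ
        - Complex.I * ⟪x + Complex.I • y, T (x + Complex.I • y)⟫_ℂ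
        + Complex.I * ⟪x - Complex.I • y, T (x - Complex.I • y)⟫_ℂ) / 4 := by
    simp only [map_add, map_sub, map_smul, inner_add_left, inner_add_right, inner_sub_left,
      inner_sub_right, inner_smul_left, inner_smul_right, Complex.conj_I]
    linear_combination (⟪x, T y⟫_ℂ / 2 - ⟪y, T x⟫_ℂ / 2) * Complex.I_sq
  simp only [polarization]
  exact ((((h _).sub (h _)).sub ((h _).mul_left _)).add ((h _).mul_left _)).div_const 4

variable [CompleteSpace H] {Ω : Type*} [MeasurableSpace Ω]

theorem isEffect_measureReal {m : traceClass H → Measure Ω} [∀ T, IsFiniteMeasure (m T)]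
    (hadd : ∀ S T : traceClass H, 0 ≤ (S : H →L[ℂ] H) → 0 ≤ (T : H →L[ℂ] H) →
      m (S + T) = m S + m T)
    (hsmul : ∀ (c : ℝ) (T : traceClass H), 0 ≤ c → 0 ≤ (T : H →L[ℂ] H) →
      m ((c : ℂ) • T) = ENNReal.ofReal c • m T)
    (huniv : ∀ T : traceClass H, 0 ≤ (T : H →L[ℂ] H) →
      (m T).real Set.univ = (trace (T : H →L[ℂ] H)).re) (S : Set Ω) :
    IsEffect fun T => (m T).real S where
  add U T hU hT := by rw [hadd U T hU hT, measureReal_add_apply]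
  smul c T hc hT := by
    rw [hsmul c T hc hT, measureReal_ennreal_smul_apply, ENNReal.toReal_ofReal hc]
  nonneg _ _ := measureReal_nonneg
  le_trace T hT := (measureReal_mono (Set.subset_univ S)).trans_eq (huniv T hT)

theorem exists_povm_of_measures {m : traceClass H → Measure Ω} [∀ T, IsFiniteMeasure (m T)]
    (hadd : ∀ S T : traceClass H, 0 ≤ (S : H →L[ℂ] H) → 0 ≤ (T : H →L[ℂ] H) →
      m (S + T) = m S + m T)
    (hsmul : ∀ (c : ℝ) (T : traceClass H), 0 ≤ c → 0 ≤ (T : H →L[ℂ] H) →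
      m ((c : ℂ) • T) = ENNReal.ofReal c • m T)
    (huniv : ∀ T : traceClass H, 0 ≤ (T : H →L[ℂ] H) →
      (m T).real Set.univ = (trace (T : H →L[ℂ] H)).re) :
    ∃ M : POVM Ω H, ∀ T : traceClass H, 0 ≤ (T : H →L[ℂ] H) → ∀ S, MeasurableSet S →
      (trace ((T : H →L[ℂ] H) * M.toFun S)).re = (m T).real S := by
  choose N hN0 _ hN using fun S => (isEffect_measureReal hadd hsmul huniv S).exists_operator
  have inner_self (S : Set Ω) (x : H) : ⟪x, N S x⟫_ℂ = ((m (ketBra x x)).real S : ℂ) := by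
    rw [hN S _ (ketBra_self_nonneg x), re_trace_ketBra_mul]
    exact (((ContinuousLinearMap.nonneg_iff_isPositive _).1 (hN0 S)).isSymmetric
      |>.coe_re_inner_self_apply x).symm
  have univ_eq : N Set.univ = 1 := by
    have symm_univ := ((ContinuousLinearMap.nonneg_iff_isPositive _).1 (hN0 Set.univ)).isSymmetric
    have coe_eq : (N Set.univ : H →ₗ[ℂ] H) = (1 : H →L[ℂ] H) := (ext_inner_map _ _).1 fun x => by
      rw [symm_univ x x, ContinuousLinearMap.coe_coe, inner_self, huniv _ (ketBra_self_nonneg x),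
        trace_ketBra]
      exact inner_self_ofReal_re x
    exact ContinuousLinearMap.coe_injective coe_eq
  refine ⟨⟨N, fun S _ => hN0 S, univ_eq, fun f hf hd =>
    hasSum_inner_of_hasSum_inner_self fun x => ?_⟩, fun T hT S _ => (hN S T hT).symm⟩
  have hasSum_real := (m (ketBra x x)).toSignedMeasure.m_iUnion hf hd
  simp only [Measure.toSignedMeasure_apply_measurable (hf _),
    Measure.toSignedMeasure_apply_measurable (.iUnion hf)] at hasSum_real
  simp only [inner_self]
  exact hasSum_real.mapL Complex.ofRealCLM

end POVMOfMeasures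

section Duality

open Filter Topology

variable {V S F : Type*} [AddCommGroup V] [Module ℝ V] [AddCommGroup S] [Module ℝ S]
  [NormedAddCommGroup F] [InnerProductSpace ℝ F] [CompleteSpace F]

theorem exists_inner_eq_of_abs_le_norm (K : V →ₗ[ℝ] F) (l : V →ₗ[ℝ] ℝ) {C : ℝ} (hC : 0 ≤ C)
    (h : ∀ v, |l v| ≤ C * ‖K v‖) : ∃ Z : F, ‖Z‖ ≤ C ∧ ∀ v, ⟪Z, K v⟫_ℝ = l v := by
  obtain ⟨f, hf⟩ : l ∈ LinearMap.range K.dualMap := by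
    rw [LinearMap.range_dualMap_eq_dualAnnihilator_ker, Submodule.mem_dualAnnihilator]
    intro v hv
    have := h v
    rwa [LinearMap.mem_ker.1 hv, norm_zero, mul_zero, abs_nonpos_iff] at this
  have apply_eq (v : V) : f (K v) = l v := LinearMap.congr_fun hf v
  have bound : ∀ x : LinearMap.range K, ‖f.domRestrict (LinearMap.range K) x‖ ≤ C * ‖x‖ := by
    rintro ⟨_, v, rfl⟩
    rw [LinearMap.domRestrict_apply, apply_eq]
    exact h v
  obtain ⟨g, hg, norm_g⟩ := exists_extension_norm_eq _ ((f.domRestrict _).mkContinuous C bound)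
  refine ⟨(InnerProductSpace.toDual ℝ F).symm g, ?_, fun v => ?_⟩
  · rw [LinearIsometryEquiv.norm_map, norm_g]
    exact LinearMap.mkContinuous_norm_le _ hC _
  · rw [InnerProductSpace.toDual_symm_apply, ← apply_eq]
    exact hg ⟨K v, v, rfl⟩

theorem exists_linearMap_inner_eq {j : S →ₗ[ℝ] F} (hj : DenseRange j) (m : V →ₗ[ℝ] S →ₗ[ℝ] ℝ)
    (h : ∀ v, ∃ C, 0 ≤ C ∧ ∀ s, |m v s| ≤ C * ‖j s‖) :
    ∃ K : V →ₗ[ℝ] F, ∀ v s, ⟪K v, j s⟫_ℝ = m v s := by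
  have exists_representative (v : V) : ∃ Z : F, ∀ s, ⟪Z, j s⟫_ℝ = m v s := by
    obtain ⟨C, hC, bound⟩ := h v
    obtain ⟨Z, -, hZ⟩ := exists_inner_eq_of_abs_le_norm j (m v) hC bound
    exact ⟨Z, hZ⟩
  choose K hK using exists_representative
  have ext_inner {Z W : F} (hZW : ∀ s, ⟪Z, j s⟫_ℝ = ⟪W, j s⟫_ℝ) : Z = W :=
    ext_inner_right ℝ <| congrFun <| hj.equalizer (by fun_prop) (by fun_prop) (funext hZW)
  exact ⟨{
    toFun := K
    map_add' := fun v w => ext_inner fun s => by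
      simp only [inner_add_left, hK, map_add, LinearMap.add_apply]
    map_smul' := fun a v => ext_inner fun s => by
      simp only [real_inner_smul_left, hK, map_smul, LinearMap.smul_apply, smul_eq_mul,
        RingHom.id_apply] },
    hK⟩

/-- The Riesz representative of `l` lies in the closure of the range of `j`; approximate it from
within that range. -/
theorem exists_seq_tendsto_of_abs_le (j : S →ₗ[ℝ] F) (m : V →ₗ[ℝ] S →ₗ[ℝ] ℝ)
    (h : ∀ v, ∃ C, 0 ≤ C ∧ ∀ s, |m v s| ≤ C * ‖j s‖) (l : V →ₗ[ℝ] ℝ) {C : ℝ} (hC : 0 ≤ C)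
    (hl : ∀ v, ∀ Z ∈ (LinearMap.range j).topologicalClosure, (∀ s, ⟪Z, j s⟫_ℝ = m v s) →
      |l v| ≤ C * ‖Z‖) :
    ∃ (s : ℕ → S), ∃ c ∈ Set.Icc 0 C, (∀ v, Tendsto (fun n => m v (s n)) atTop (𝓝 (l v))) ∧
      Tendsto (fun n => ‖j (s n)‖) atTop (𝓝 c) := by
  let U := (LinearMap.range j).topologicalClosure
  have : CompleteSpace U := (Submodule.isClosed_topologicalClosure _).completeSpace_coe
  let j' : S →ₗ[ℝ] U := j.codRestrict U fun s => Submodule.le_topologicalClosure _ ⟨s, rfl⟩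
  have denseRange_j' : DenseRange j' := fun Z => by
    rw [closure_subtype, ← Set.range_comp]
    exact Z.2
  obtain ⟨K, hK⟩ := exists_linearMap_inner_eq denseRange_j' m h
  obtain ⟨Z, norm_Z, hZ⟩ := exists_inner_eq_of_abs_le_norm K l hC fun v =>
    hl v (K v) (K v).2 (hK v)
  obtain ⟨W, hW, tendsto_W⟩ := mem_closure_iff_seq_limit.1 (denseRange_j' Z)
  choose s hs using hW
  refine ⟨s, ‖Z‖, ⟨norm_nonneg Z, norm_Z⟩, fun v => ?_, ?_⟩
  · rw [← hZ, real_inner_comm]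
    exact (tendsto_const_nhds.inner tendsto_W).congr fun n => by rw [← hs, hK]
  · exact tendsto_W.norm.congr fun n => by rw [← hs]; rfl

end Duality

section HilbertSchmidtFamilies

theorem memℓp_two_iff {ι F : Type*} [NormedAddCommGroup F] {f : ι → F} :
    Memℓp f 2 ↔ Summable fun i => ‖f i‖ ^ 2 := by
  rw [memℓp_gen_iff (by norm_num)]
  simp only [ENNReal.toReal_ofNat, Real.rpow_ofNat]

variable {H : Type*} [NormedAddCommGroup H] [InnerProductSpace ℂ H] [CompleteSpace H]

variable (H) in
/-- The Hilbert space of square-summable families indexed by the fixed orthonormal basis; a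
Hilbert-Schmidt operator `Z` is encoded as the family `(Z eᵢ)`. -/
def HSFamily : Type _ := lp (fun _ : (exists_hilbertBasis ℂ H).choose => H) 2

namespace HSFamily

noncomputable instance : NormedAddCommGroup (HSFamily H) :=
  inferInstanceAs (NormedAddCommGroup (lp (fun _ : (exists_hilbertBasis ℂ H).choose => H) 2))

noncomputable instance : InnerProductSpace ℂ (HSFamily H) :=
  inferInstanceAs (InnerProductSpace ℂ (lp (fun _ : (exists_hilbertBasis ℂ H).choose => H) 2))

noncomputable instance : InnerProductSpace ℝ (HSFamily H) := InnerProductSpace.complexToReal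

instance : CompleteSpace (HSFamily H) :=
  inferInstanceAs (CompleteSpace (lp (fun _ : (exists_hilbertBasis ℂ H).choose => H) 2))

instance : CoeFun (HSFamily H) fun _ => (exists_hilbertBasis ℂ H).choose → H := ⟨Subtype.val⟩

theorem ext {Z W : HSFamily H} (h : ∀ i, Z i = W i) : Z = W := Subtype.ext (funext h)

/-- The family `(Y eᵢ)` of a Hilbert-Schmidt operator `Y`. -/
noncomputable def ofOperator {Y : H →L[ℂ] H} (hY : IsHilbertSchmidt Y) : HSFamily H :=
  ⟨fun i => Y (onb H i), memℓp_two_iff.2 (isHilbertSchmidt_iff_summable.1 hY)⟩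

theorem ofOperator_apply {Y : H →L[ℂ] H} (hY : IsHilbertSchmidt Y)
    (i : (exists_hilbertBasis ℂ H).choose) : ofOperator hY i = Y (onb H i) := rfl

theorem add_apply (Z W : HSFamily H) (i : (exists_hilbertBasis ℂ H).choose) :
    (Z + W) i = Z i + W i := rfl

theorem smul_apply (c : ℝ) (Z : HSFamily H) (i : (exists_hilbertBasis ℂ H).choose) :
    (c • Z) i = (c : ℂ) • Z i := rfl

theorem norm_sq (Z : HSFamily H) : ‖Z‖ ^ 2 = ∑' i, ‖Z i‖ ^ 2 := by
  have := lp.norm_rpow_eq_tsum (p := 2) (by norm_num) Z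
  simp only [ENNReal.toReal_ofNat, Real.rpow_ofNat] at this
  exact this

theorem hasSum_re_inner (Z W : HSFamily H) :
    HasSum (fun i => (⟪Z i, W i⟫_ℂ).re) ⟪Z, W⟫_ℝ :=
  (lp.hasSum_inner (𝕜 := ℂ) Z W).mapL Complex.reCLM

theorem continuous_apply (i : (exists_hilbertBasis ℂ H).choose) :
    Continuous fun Z : HSFamily H => Z i :=
  (lp.lipschitzWith_one_eval (E := fun _ => H) 2 i).continuous

theorem isHilbertSchmidt {Z : HSFamily H} {Y : H →L[ℂ] H} (hY : ∀ i, Y (onb H i) = Z i) :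
    IsHilbertSchmidt Y :=
  isHilbertSchmidt_iff_summable.2 <| by simpa only [hY] using memℓp_two_iff.1 Z.2

theorem hsNormSq_eq {Z : HSFamily H} {Y : H →L[ℂ] H} (hY : ∀ i, Y (onb H i) = Z i) :
    hsNormSq Y = ENNReal.ofReal (‖Z‖ ^ 2) := by
  have := isHilbertSchmidt_iff_summable.1 (isHilbertSchmidt hY)
  rw [norm_sq, ENNReal.ofReal_tsum_of_nonneg (fun i => sq_nonneg _) (memℓp_two_iff.1 Z.2)]
  simp only [hsNormSq, hY, ENNReal.ofReal_pow (norm_nonneg _), ofReal_norm]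

end HSFamily

theorem exists_operator_of_family [TopologicalSpace.SeparableSpace H] (Z : HSFamily H) :
    ∃ Y : H →L[ℂ] H, (∀ i, Y (onb H i) = Z i) ∧
      ∀ z, HasSum (fun i => ⟪onb H i, z⟫_ℂ • Z i) (Y z) := by
  have summable_Z : Summable fun i => ‖Z i‖ ^ 2 := memℓp_two_iff.1 Z.2
  have summable_smul (z : H) : Summable fun i => ⟪onb H i, z⟫_ℂ • Z i := by
    refine .of_norm_bounded (((hasSum_norm_inner_onb_sq z).summable.add summable_Z).div_const 2)
      fun i => ?_
    rw [norm_smul]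
    linarith [two_mul_le_add_sq ‖⟪onb H i, z⟫_ℂ‖ ‖Z i‖]
  have tendsto_sum : Filter.Tendsto (fun s : Finset _ => fun z =>
      (∑ i ∈ s, InnerProductSpace.rankOne ℂ (Z i) (onb H i)) z) Filter.atTop
      (nhds fun z => ∑' i, ⟪onb H i, z⟫_ℂ • Z i) := tendsto_pi_nhds.2 fun z => by
    simp only [sum_apply, InnerProductSpace.rankOne_apply]
    exact (summable_smul z).hasSum
  refine ⟨continuousLinearMapOfTendsto _ tendsto_sum, fun i => ?_,
    fun z => (summable_smul z).hasSum⟩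
  refine (summable_smul (onb H i)).hasSum.unique ?_
  convert hasSum_single i fun k hk => ?_
  · simp [(onb H).orthonormal.1 i]
  · rw [(onb H).orthonormal.2 hk, zero_smul]

/-- The real-linear map `X ↦ X √σ` from bounded observables to Hilbert-Schmidt operators. -/
noncomputable def sqrtFamily {σ : H →L[ℂ] H} (hσ : IsHilbertSchmidt (CFC.sqrt σ)) :
    selfAdjoint (H →L[ℂ] H) →ₗ[ℝ] HSFamily H where
  toFun X := HSFamily.ofOperator (hσ.mul_left (X : H →L[ℂ] H))
  map_add' X X' := HSFamily.ext fun i => by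
    simp only [HSFamily.add_apply, HSFamily.ofOperator_apply, AddSubgroup.coe_add, add_mul,
      add_apply]
  map_smul' c X := HSFamily.ext fun i => by
    simp only [HSFamily.smul_apply, HSFamily.ofOperator_apply, selfAdjoint.val_smul,
      smul_mul_assoc, smul_apply, Complex.coe_smul, RingHom.id_apply]

theorem sqrtFamily_apply {σ : H →L[ℂ] H} (hσ : IsHilbertSchmidt (CFC.sqrt σ))
    (X : selfAdjoint (H →L[ℂ] H)) (i : (exists_hilbertBasis ℂ H).choose) :
    sqrtFamily hσ X i = (X : H →L[ℂ] H) (CFC.sqrt σ (onb H i)) := rfl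

theorem norm_sqrtFamily_sq {σ : H →L[ℂ] H} (hσ₀ : 0 ≤ σ) (hσ : IsHilbertSchmidt (CFC.sqrt σ))
    (X : selfAdjoint (H →L[ℂ] H)) :
    ‖sqrtFamily hσ X‖ ^ 2 = (trace ((X : H →L[ℂ] H) * σ * (X : H →L[ℂ] H))).re := by
  have apply_onb (i) : ((X : H →L[ℂ] H) * CFC.sqrt σ) (onb H i) = sqrtFamily hσ X i := rfl
  have mul_star : (X : H →L[ℂ] H) * CFC.sqrt σ * star ((X : H →L[ℂ] H) * CFC.sqrt σ) =
      X * σ * X := by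
    rw [star_mul, star_sqrt, X.2.star_eq, mul_assoc (X : H →L[ℂ] H), ← mul_assoc (CFC.sqrt σ),
      CFC.sqrt_mul_sqrt_self σ hσ₀, ← mul_assoc]
  have trace_nonneg_re : 0 ≤ (trace ((X : H →L[ℂ] H) * σ * (X : H →L[ℂ] H))).re := by
    rw [← mul_star]
    exact (Complex.nonneg_iff.1 (trace_nonneg (mul_star_self_nonneg _))).1
  have h := (hσ.mul_left (X : H →L[ℂ] H)).hsNormSq_eq_ofReal_trace
  rwa [HSFamily.hsNormSq_eq apply_onb, mul_star,
    ENNReal.ofReal_eq_ofReal_iff (sq_nonneg _) trace_nonneg_re] at h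

theorem isSelfAdjoint_ext_inner {S T : H →L[ℂ] H} (hS : IsSelfAdjoint S) (hT : IsSelfAdjoint T)
    (h : ∀ x, (⟪x, S x⟫_ℂ).re = (⟪x, T x⟫_ℂ).re) : S = T := by
  have le {S T : H →L[ℂ] H} (hS : IsSelfAdjoint S) (hT : IsSelfAdjoint T)
      (h : ∀ x, (⟪x, S x⟫_ℂ).re = (⟪x, T x⟫_ℂ).re) : S ≤ T := by
    rw [← sub_nonneg, nonneg_iff_re_inner]
    refine ⟨hT.sub hS, fun x => ?_⟩
    rw [sub_apply, inner_sub_right, Complex.sub_re, h, sub_self]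
  exact le_antisymm (le hS hT h) (le hT hS fun x => (h x).symm)

variable {σ : H →L[ℂ] H} {hσ : IsHilbertSchmidt (CFC.sqrt σ)} {Z : HSFamily H}

theorem inner_sqrt_onb_comm_of_mem_closure
    (hZ : Z ∈ (LinearMap.range (sqrtFamily hσ)).topologicalClosure)
    (i j : (exists_hilbertBasis ℂ H).choose) :
    ⟪CFC.sqrt σ (onb H j), Z i⟫_ℂ = ⟪Z j, CFC.sqrt σ (onb H i)⟫_ℂ := by
  have isClosed_comm : IsClosed {W : HSFamily H |
      ⟪CFC.sqrt σ (onb H j), W i⟫_ℂ = ⟪W j, CFC.sqrt σ (onb H i)⟫_ℂ} := by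
    exact isClosed_eq (continuous_const.inner (HSFamily.continuous_apply i))
      ((HSFamily.continuous_apply j).inner continuous_const)
  refine isClosed_comm.closure_subset_iff.2 ?_ hZ
  rintro _ ⟨X, rfl⟩
  exact ((ContinuousLinearMap.isSelfAdjoint_iff_isSymmetric.1 X.2) _ _).symm

theorem isSelfAdjoint_sqrt_mul_of_mem_closure
    (hZ : Z ∈ (LinearMap.range (sqrtFamily hσ)).topologicalClosure) {Y : H →L[ℂ] H}
    (hY : ∀ i, Y (onb H i) = Z i) : IsSelfAdjoint (CFC.sqrt σ * Y) := by
  refine ContinuousLinearMap.ext_on (s := Set.range (onb H))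
    (Submodule.dense_iff_topologicalClosure_eq_top.2 (onb H).dense_span) ?_
  rintro _ ⟨i, rfl⟩
  refine (onb H).repr.injective (lp.ext (funext fun j => ?_))
  rw [HilbertBasis.repr_apply_apply, HilbertBasis.repr_apply_apply,
    ContinuousLinearMap.star_eq_adjoint, ContinuousLinearMap.adjoint_inner_right,
    mul_apply_eq_comp, mul_apply_eq_comp, ← inner_sqrt_left, hY, hY,
    inner_sqrt_onb_comm_of_mem_closure hZ, inner_sqrt_left]

theorem re_inner_apply_sqrt_eq {Y : H →L[ℂ] H}
    (hY : ∀ z, HasSum (fun i => ⟪onb H i, z⟫_ℂ • Z i) (Y z)) (u : H) :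
    (⟪u, Y (CFC.sqrt σ u)⟫_ℂ).re =
      ⟪Z, sqrtFamily hσ ⟨_, IsSelfAdjoint.of_nonneg (ketBra_self_nonneg u)⟩⟫_ℝ := by
  refine HasSum.unique (((hY (CFC.sqrt σ u)).mapL (innerSL ℂ u)).mapL Complex.reCLM) ?_
  convert HSFamily.hasSum_re_inner Z _ using 2 with i
  rw [sqrtFamily_apply]
  change (⟪u, ⟪onb H i, CFC.sqrt σ u⟫_ℂ • Z i⟫_ℂ).re =
    (⟪Z i, ⟪u, CFC.sqrt σ (onb H i)⟫_ℂ • u⟫_ℂ).re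
  rw [inner_smul_right, inner_smul_right, ← inner_sqrt_left, ← inner_conj_symm u (Z i),
    ← inner_conj_symm _ u, ← map_mul, Complex.conj_re]

theorem sldInfo_le_of_inner_eq [TopologicalSpace.SeparableSpace H] {τ : H →L[ℂ] H}
    (hτ : IsSelfAdjoint τ) (hZ : Z ∈ (LinearMap.range (sqrtFamily hσ)).topologicalClosure)
    (h : ∀ X : selfAdjoint (H →L[ℂ] H),
      ⟪Z, sqrtFamily hσ X⟫_ℝ = (trace ((X : H →L[ℂ] H) * τ)).re) :
    sldInfo σ τ ≤ ENNReal.ofReal (‖Z‖ ^ 2) := by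
  obtain ⟨Y, apply_onb, hasSum_apply⟩ := exists_operator_of_family Z
  rw [← HSFamily.hsNormSq_eq apply_onb]
  refine iInf₂_le Y ⟨isSelfAdjoint_sqrt_mul_of_mem_closure hZ apply_onb,
    isSelfAdjoint_ext_inner ?_ hτ fun u => ?_⟩
  · rw [isSelfAdjoint_iff, star_smul, star_add, star_mul, star_mul, star_star, star_sqrt, add_comm]
    congr 1
    simp
  · have re_inner_sqrt_star : (⟪u, CFC.sqrt σ (star Y u)⟫_ℂ).re = (⟪u, Y (CFC.sqrt σ u)⟫_ℂ).re := by
      rw [← inner_sqrt_left, ContinuousLinearMap.star_eq_adjoint,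
        ContinuousLinearMap.adjoint_inner_right, ← inner_conj_symm, Complex.conj_re]
    rw [← re_trace_ketBra_mul u τ, ← h ⟨_, IsSelfAdjoint.of_nonneg (ketBra_self_nonneg u)⟩,
      ← re_inner_apply_sqrt_eq hasSum_apply, smul_apply, inner_smul_right, add_apply,
      inner_add_right, mul_apply_eq_comp, mul_apply_eq_comp]
    rw [show (2⁻¹ : ℂ) = ((2⁻¹ : ℝ) : ℂ) by norm_num, Complex.re_ofReal_mul, Complex.add_re,
      re_inner_sqrt_star]
    ring

end HilbertSchmidtFamilies

section Directions

variable {H : Type*} [NormedAddCommGroup H] [InnerProductSpace ℂ H] [CompleteSpace H]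
  {σ τ τ' Y Y' : H →L[ℂ] H}

theorem sldInfo_lt_top_iff : sldInfo σ τ < ⊤ ↔ ∃ Y, IsSLD σ τ Y ∧ IsHilbertSchmidt Y := by
  simp only [sldInfo, iInf_lt_iff, exists_prop]
  simp only [IsHilbertSchmidt, lt_top_iff_ne_top]

theorem IsSLD.zero : IsSLD σ 0 0 := by
  simp [IsSLD]

theorem IsSLD.add (h : IsSLD σ τ Y) (h' : IsSLD σ τ' Y') : IsSLD σ (τ + τ') (Y + Y') := by
  refine ⟨?_, ?_⟩
  · rw [mul_add]
    exact h.1.add h'.1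
  · rw [← h.2, ← h'.2, star_add, add_mul, mul_add, ← smul_add, add_add_add_comm]

theorem IsSLD.smul (h : IsSLD σ τ Y) (c : ℝ) : IsSLD σ (c • τ) (c • Y) := by
  refine ⟨?_, ?_⟩
  · rw [mul_smul_comm]
    exact (IsSelfAdjoint.all c).smul h.1
  · rw [← h.2, star_smul, star_trivial, smul_mul_assoc, mul_smul_comm, ← smul_add,
      smul_comm c]

theorem expVal_eq_trace {A : H →ₗ.[ℂ] H} (hA : Dense (A.domain : Set H)) {R : H →L[ℂ] H}
    {T : traceClass H} (hT : ∀ x : A.domain, (T : H →L[ℂ] H) x = R (A x)) :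
    expVal R A = trace (T : H →L[ℂ] H) := by
  have exists_extension : MulMemTraceClass R A := ⟨T, hT⟩
  rw [expVal, dif_pos exists_extension]
  congr 1
  refine ContinuousLinearMap.coeFn_injective <|
    Continuous.ext_on hA (map_continuous _) (map_continuous _) fun x hx => ?_
  rw [hT ⟨x, hx⟩]
  exact exists_extension.choose_spec ⟨x, hx⟩

theorem trace_real_smul (c : ℝ) (T : H →L[ℂ] H) : trace (c • T) = c * trace T := by
  rw [← Complex.coe_smul, trace_smul]

/-- The directions in which `⟨A⟩` is differentiated at `ρ`, as a real vector space. -/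
noncomputable def directionSpace (ρ : FaithfulState H) (A : H →ₗ.[ℂ] H) :
    Submodule ℝ (traceClass H) where
  carrier := directions ρ A
  add_mem' := by
    rintro φ ψ ⟨hφ, trace_φ, info_φ, T, hT⟩ ⟨hψ, trace_ψ, info_ψ, T', hT'⟩
    obtain ⟨Y, hY, hs_Y⟩ := sldInfo_lt_top_iff.1 info_φ
    obtain ⟨Y', hY', hs_Y'⟩ := sldInfo_lt_top_iff.1 info_ψ
    refine ⟨hφ.add hψ, ?_, sldInfo_lt_top_iff.2 ⟨_, hY.add hY', hs_Y.add hs_Y'⟩, T + T',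
      fun x => ?_⟩
    · rw [Submodule.coe_add, trace_add φ.2 ψ.2, trace_φ, trace_ψ, add_zero]
    · rw [Submodule.coe_add, Submodule.coe_add, add_apply, add_apply, hT, hT']
  zero_mem' := by
    refine ⟨.zero _, by simp [trace], sldInfo_lt_top_iff.2 ⟨0, .zero, ?_⟩, 0, fun x => by simp⟩
    simp [IsHilbertSchmidt, hsNormSq]
  smul_mem' := by
    rintro c φ ⟨hφ, trace_φ, info_φ, T, hT⟩
    obtain ⟨Y, hY, hs_Y⟩ := sldInfo_lt_top_iff.1 info_φ
    refine ⟨(IsSelfAdjoint.all c).smul hφ, ?_, sldInfo_lt_top_iff.2 ⟨_, hY.smul c, hs_Y.smul c⟩,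
      c • T, fun x => ?_⟩
    · rw [Submodule.coe_smul_of_tower, trace_real_smul, trace_φ, mul_zero]
    · rw [Submodule.coe_smul_of_tower, Submodule.coe_smul_of_tower, smul_apply, smul_apply, hT]

noncomputable instance (ρ : FaithfulState H) (A : H →ₗ.[ℂ] H) : AddCommGroup (directionSpace ρ A) :=
  Submodule.addCommGroup _

/-- The derivative `φ ↦ Tr[φ A]` as a linear functional on the directions. Density of the domain
makes `Tr[φ A]` independent of the trace-class extension of `φ A`. -/
noncomputable def expDerivLinear (ρ : FaithfulState H) {A : H →ₗ.[ℂ] H}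
    (hA : Dense (A.domain : Set H)) : directionSpace ρ A →ₗ[ℝ] ℝ where
  toFun φ := expDeriv A φ
  map_add' := by
    rintro ⟨φ, -, -, -, T, hT⟩ ⟨ψ, -, -, -, T', hT'⟩
    have hTT' : ∀ x : A.domain, ((T + T' : traceClass H) : H →L[ℂ] H) x =
        ((φ + ψ : traceClass H) : H →L[ℂ] H) (A x) := fun x => by
      rw [Submodule.coe_add, Submodule.coe_add, add_apply, add_apply, hT, hT']
    change (expVal _ A).re = (expVal _ A).re + (expVal _ A).re
    rw [expVal_eq_trace hA hT, expVal_eq_trace hA hT', ← Complex.add_re, ← trace_add T.2 T'.2]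
    exact congrArg Complex.re (expVal_eq_trace hA hTT')
  map_smul' := by
    rintro c ⟨φ, -, -, -, T, hT⟩
    have hcT : ∀ x : A.domain, ((c • T : traceClass H) : H →L[ℂ] H) x =
        ((c • φ : traceClass H) : H →L[ℂ] H) (A x) := fun x => by
      rw [Submodule.coe_smul_of_tower, Submodule.coe_smul_of_tower, smul_apply, smul_apply, hT]
    change (expVal _ A).re = c * (expVal _ A).re
    rw [expVal_eq_trace hA hT, ← Complex.re_ofReal_mul, ← trace_real_smul]
    exact congrArg Complex.re (expVal_eq_trace hA hcT)

/-- The pairing `(T, X) ↦ Tr[X T]` of trace-class operators with bounded observables. -/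
noncomputable def tracePairing : traceClass H →ₗ[ℝ] selfAdjoint (H →L[ℂ] H) →ₗ[ℝ] ℝ :=
  LinearMap.mk₂ ℝ (fun T X => (trace ((X : H →L[ℂ] H) * (T : H →L[ℂ] H))).re)
    (fun T T' X => by
      rw [Submodule.coe_add, mul_add, trace_add (T.2.mul_left _) (T'.2.mul_left _), Complex.add_re])
    (fun c T X => by
      rw [Submodule.coe_smul_of_tower, mul_smul_comm, trace_real_smul, Complex.re_ofReal_mul,
        smul_eq_mul])
    (fun T X X' => by
      rw [AddSubgroup.coe_add, add_mul, trace_add (T.2.mul_left _) (T.2.mul_left _),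
        Complex.add_re])
    (fun c T X => by
      rw [selfAdjoint.val_smul, smul_mul_assoc, trace_real_smul, Complex.re_ofReal_mul,
        smul_eq_mul])

theorem tracePairing_apply (T : traceClass H) (X : selfAdjoint (H →L[ℂ] H)) :
    tracePairing T X = (trace ((X : H →L[ℂ] H) * (T : H →L[ℂ] H))).re := rfl

end Directions

section Channel

variable {H : Type*} [NormedAddCommGroup H] [InnerProductSpace ℂ H]

theorem IsCompletelyPositive.map_nonneg {E : traceClass H →ₗ[ℂ] traceClass H}
    (hE : IsCompletelyPositive E) {T : traceClass H} (hT : 0 ≤ (T : H →L[ℂ] H)) :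
    0 ≤ (E T : H →L[ℂ] H) := by
  rw [ContinuousLinearMap.nonneg_iff_isPositive] at hT
  rw [ContinuousLinearMap.nonneg_iff_isPositive, ContinuousLinearMap.isPositive_iff_complex]
  intro x
  have h := hE 1 (fun _ _ => T) (fun v => by simpa using hT.inner_nonneg_right (v 0)) fun _ => x
  simp only [Finset.univ_unique, Finset.sum_const, Finset.card_singleton, one_smul] at h
  have h' : 0 ≤ ⟪(E T : H →L[ℂ] H) x, x⟫_ℂ := by
    rw [← inner_conj_symm]
    exact star_nonneg_iff.2 h
  rw [Complex.nonneg_iff] at h'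
  exact ⟨Complex.ext rfl h'.2, h'.1⟩

variable [CompleteSpace H] {E : traceClass H →ₗ[ℂ] traceClass H} {ρ : FaithfulState H}
  {φ : traceClass H} {Y R Z W : H →L[ℂ] H}

theorem IsHilbertSchmidt.sub (hZ : IsHilbertSchmidt Z) (hW : IsHilbertSchmidt W) :
    IsHilbertSchmidt (Z - W) := by
  have := hZ.add (hW.smul (-1))
  rwa [neg_one_smul, ← sub_eq_add_neg] at this

theorem FaithfulState.isHilbertSchmidt_sqrt (ρ : FaithfulState H) :
    IsHilbertSchmidt (CFC.sqrt (ρ.op : H →L[ℂ] H)) :=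
  ρ.op.2.isHilbertSchmidt_sqrt ρ.nonneg'

variable [TopologicalSpace.SeparableSpace H]

/-- The product `Z W*` of Hilbert-Schmidt operators, as a trace-class operator. -/
noncomputable def IsHilbertSchmidt.mulStar (hZ : IsHilbertSchmidt Z) (hW : IsHilbertSchmidt W) :
    traceClass H :=
  ⟨Z * star W, hZ.isTraceClass_mul_star hW⟩

theorem IsHilbertSchmidt.coe_mulStar (hZ : IsHilbertSchmidt Z) (hW : IsHilbertSchmidt W) :
    (hZ.mulStar hW : H →L[ℂ] H) = Z * star W := rfl

theorem IsHilbertSchmidt.mulStar_self_nonneg (hZ : IsHilbertSchmidt Z) :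
    0 ≤ (hZ.mulStar hZ : H →L[ℂ] H) :=
  mul_star_self_nonneg Z

/-- The entries of the positive block operator `!![Y; R] * !![Y; R]ᴴ` are mapped by `E` to those of
a positive block operator. -/
theorem IsCompletelyPositive.re_inner_map_mulStar_nonneg (hE : IsCompletelyPositive E)
    (hY : IsHilbertSchmidt Y) (hR : IsHilbertSchmidt R) (x y : H) :
    0 ≤ (⟪x, (E (hY.mulStar hY) : H →L[ℂ] H) x⟫_ℂ + ⟪x, (E (hY.mulStar hR) : H →L[ℂ] H) y⟫_ℂ +
      (⟪y, (E (hR.mulStar hY) : H →L[ℂ] H) x⟫_ℂ +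
        ⟪y, (E (hR.mulStar hR) : H →L[ℂ] H) y⟫_ℂ)).re := by
  have block_nonneg (v : Fin 2 → H) : 0 ≤ ∑ i, ∑ j, ⟪v i, (!![hY.mulStar hY, hY.mulStar hR;
      hR.mulStar hY, hR.mulStar hR] i j : H →L[ℂ] H) (v j)⟫_ℂ := by
    have eq_inner_self : ∑ i, ∑ j, ⟪v i, (!![hY.mulStar hY, hY.mulStar hR;
        hR.mulStar hY, hR.mulStar hR] i j : H →L[ℂ] H) (v j)⟫_ℂ =
        ⟪star Y (v 0) + star R (v 1), star Y (v 0) + star R (v 1)⟫_ℂ := by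
      simp only [Fin.sum_univ_two, Matrix.of_apply, Matrix.cons_val_zero, Matrix.cons_val_one,
        IsHilbertSchmidt.coe_mulStar, mul_apply_eq_comp, inner_add_left, inner_add_right,
        ContinuousLinearMap.star_eq_adjoint, ContinuousLinearMap.adjoint_inner_left]
      ring
    rw [eq_inner_self]
    exact Complex.nonneg_iff.2 ⟨inner_self_nonneg (𝕜 := ℂ), (inner_self_im (𝕜 := ℂ) _).symm⟩
  have := (Complex.nonneg_iff.1 (hE 2 _ block_nonneg ![x, y])).1
  simpa only [Fin.sum_univ_two, Matrix.of_apply, Matrix.cons_val_zero, Matrix.cons_val_one]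
    using this

theorem IsCompletelyPositive.sq_re_trace_le (hE : IsCompletelyPositive E)
    (hY : IsHilbertSchmidt Y) (hR : IsHilbertSchmidt R) (S T : H →L[ℂ] H) :
    (trace (star S * (E (hY.mulStar hR) : H →L[ℂ] H) * T +
      star T * (E (hR.mulStar hY) : H →L[ℂ] H) * S)).re ^ 2 ≤
      4 * (trace (star S * (E (hY.mulStar hY) : H →L[ℂ] H) * S)).re *
        (trace (star T * (E (hR.mulStar hR) : H →L[ℂ] H) * T)).re := by
  have isTraceClass (S T : H →L[ℂ] H) (φ : traceClass H) :
      IsTraceClass (star S * (φ : H →L[ℂ] H) * T) := (φ.2.mul_left _).mul_right T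
  have quadratic_nonneg (u : ℝ) :
      0 ≤ (trace (star S * (E (hY.mulStar hY) : H →L[ℂ] H) * S)).re * (u * u) +
        (trace (star S * (E (hY.mulStar hR) : H →L[ℂ] H) * T +
          star T * (E (hR.mulStar hY) : H →L[ℂ] H) * S)).re * u +
        (trace (star T * (E (hR.mulStar hR) : H →L[ℂ] H) * T)).re := by
    rw [trace_add (isTraceClass S T _) (isTraceClass T S _), Complex.add_re]
    refine ((((isTraceClass S S _).hasSum_re_inner.mul_right (u * u)).add
      (((isTraceClass S T _).hasSum_re_inner.add
        (isTraceClass T S _).hasSum_re_inner).mul_right u)).add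
      (isTraceClass T T _).hasSum_re_inner).nonneg fun i => ?_
    have := hE.re_inner_map_mulStar_nonneg hY hR ((u : ℂ) • S (onb H i)) (T (onb H i))
    simp only [map_smul, inner_smul_left, inner_smul_right, Complex.conj_ofReal, Complex.add_re,
      Complex.re_ofReal_mul] at this
    simp only [mul_apply_eq_comp, ContinuousLinearMap.star_eq_adjoint,
      ContinuousLinearMap.adjoint_inner_right]
    linarith
  have := discrim_le_zero quadratic_nonneg
  rw [discrim] at this
  linarith

theorem FaithfulState.mulStar_sqrt (ρ : FaithfulState H) :
    ρ.isHilbertSchmidt_sqrt.mulStar ρ.isHilbertSchmidt_sqrt = ρ.op := by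
  refine Subtype.ext ?_
  rw [IsHilbertSchmidt.coe_mulStar, star_sqrt, CFC.sqrt_mul_sqrt_self _ ρ.nonneg']

theorem IsSLD.mulStar_add_mulStar (h : IsSLD (ρ.op : H →L[ℂ] H) φ Y) (hY : IsHilbertSchmidt Y) :
    hY.mulStar ρ.isHilbertSchmidt_sqrt + ρ.isHilbertSchmidt_sqrt.mulStar hY = (2 : ℂ) • φ := by
  refine Subtype.ext ?_
  rw [Submodule.coe_add, Submodule.coe_smul, IsHilbertSchmidt.coe_mulStar,
    IsHilbertSchmidt.coe_mulStar, star_sqrt, ← h.2, smul_inv_smul₀ two_ne_zero]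

/-- Polarization: `2 (Y √ρ + √ρ Y*) = (Y + √ρ)(Y + √ρ)* - (Y - √ρ)(Y - √ρ)*`. -/
theorem IsSLD.exists_eq_add (h : IsSLD (ρ.op : H →L[ℂ] H) φ Y) (hY : IsHilbertSchmidt Y) :
    ∃ P N : traceClass H, 0 ≤ (P : H →L[ℂ] H) ∧ 0 ≤ (N : H →L[ℂ] H) ∧ P = N + φ := by
  have hadd := hY.add ρ.isHilbertSchmidt_sqrt
  have hsub := hY.sub ρ.isHilbertSchmidt_sqrt
  refine ⟨((4⁻¹ : ℝ) : ℂ) • hadd.mulStar hadd, ((4⁻¹ : ℝ) : ℂ) • hsub.mulStar hsub,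
    ofReal_smul_nonneg (by norm_num) hadd.mulStar_self_nonneg,
    ofReal_smul_nonneg (by norm_num) hsub.mulStar_self_nonneg, ?_⟩
  have polarization : hadd.mulStar hadd = hsub.mulStar hsub + (4 : ℂ) • φ := by
    rw [show (4 : ℂ) = 2 * 2 by norm_num, mul_smul, ← h.mulStar_add_mulStar hY, two_smul]
    refine Subtype.ext ?_
    simp only [Submodule.coe_add, IsHilbertSchmidt.coe_mulStar, star_add, star_sub]
    noncomm_ring
  rw [polarization, smul_add, smul_smul]
  norm_num

theorem IsCompletelyPositive.isSelfAdjoint_map (hE : IsCompletelyPositive E)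
    (h : IsSLD (ρ.op : H →L[ℂ] H) φ Y) (hY : IsHilbertSchmidt Y) :
    IsSelfAdjoint (E φ : H →L[ℂ] H) := by
  obtain ⟨P, N, hP, hN, hPN⟩ := h.exists_eq_add hY
  rw [eq_sub_of_add_eq' hPN.symm, map_sub, Submodule.coe_sub]
  exact (IsSelfAdjoint.of_nonneg (hE.map_nonneg hP)).sub (.of_nonneg (hE.map_nonneg hN))

theorem IsCompletelyPositive.sq_re_trace_le_of_isSLD (hE : IsCompletelyPositive E)
    (h : IsSLD (ρ.op : H →L[ℂ] H) φ Y) (hY : IsHilbertSchmidt Y) {X : H →L[ℂ] H}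
    (hX : IsSelfAdjoint X) :
    (trace (X * (E φ : H →L[ℂ] H))).re ^ 2 ≤
      (trace (E (hY.mulStar hY) : H →L[ℂ] H)).re *
        (trace (X * (E ρ.op : H →L[ℂ] H) * X)).re := by
  have key := hE.sq_re_trace_le hY ρ.isHilbertSchmidt_sqrt 1 X
  have two_mul_trace : trace ((E (hY.mulStar ρ.isHilbertSchmidt_sqrt) : H →L[ℂ] H) * X +
      X * (E (ρ.isHilbertSchmidt_sqrt.mulStar hY) : H →L[ℂ] H)) =
      ((2 : ℝ) : ℂ) * trace (X * (E φ : H →L[ℂ] H)) := by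
    rw [trace_add ((E _).2.mul_right X) ((E _).2.mul_left X), trace_mul_comm (E _).2,
      ← trace_add ((E _).2.mul_left X) ((E _).2.mul_left X), ← mul_add, ← Submodule.coe_add,
      ← map_add, h.mulStar_add_mulStar hY, map_smul, Submodule.coe_smul, mul_smul_comm, trace_smul]
    simp
  simp only [star_one, one_mul, mul_one, hX.star_eq, ρ.mulStar_sqrt, two_mul_trace,
    Complex.re_ofReal_mul] at key
  linarith

theorem IsCompletelyPositive.sq_re_trace_mul_le_of_isSLD (hE : IsCompletelyPositive E)
    (h : IsSLD (ρ.op : H →L[ℂ] H) φ Y) (hY : IsHilbertSchmidt Y) {a : H →L[ℂ] H} (ha : 0 ≤ a) :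
    (trace (a * (E φ : H →L[ℂ] H))).re ^ 2 ≤
      (trace (a * (E (hY.mulStar hY) : H →L[ℂ] H))).re *
        (trace (a * (E ρ.op : H →L[ℂ] H))).re := by
  have key := hE.sq_re_trace_le hY ρ.isHilbertSchmidt_sqrt (CFC.sqrt a) (CFC.sqrt a)
  have trace_sqrt_mul (T : traceClass H) :
      trace (CFC.sqrt a * (T : H →L[ℂ] H) * CFC.sqrt a) = trace (a * (T : H →L[ℂ] H)) := by
    rw [trace_mul_comm (T.2.mul_left _), ← mul_assoc, CFC.sqrt_mul_sqrt_self a ha]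
  rw [star_sqrt, ← add_mul, ← mul_add, ← Submodule.coe_add, ← map_add, h.mulStar_add_mulStar hY,
    ρ.mulStar_sqrt, trace_sqrt_mul, trace_sqrt_mul, trace_sqrt_mul, map_smul, Submodule.coe_smul,
    mul_smul_comm, trace_smul, show (2 : ℂ) = (2 : ℝ) by norm_num, Complex.re_ofReal_mul] at key
  linarith

section OutputObservables

variable (hσ : IsHilbertSchmidt (CFC.sqrt (E ρ.op : H →L[ℂ] H)))

theorem IsCompletelyPositive.abs_tracePairing_le (hE : IsCompletelyPositive E)
    (h : IsSLD (ρ.op : H →L[ℂ] H) φ Y) (hY : IsHilbertSchmidt Y) (X : selfAdjoint (H →L[ℂ] H)) :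
    |tracePairing (E φ) X| ≤
      √(trace (E (hY.mulStar hY) : H →L[ℂ] H)).re * ‖sqrtFamily hσ X‖ := by
  have trace_re_nonneg : 0 ≤ (trace (E (hY.mulStar hY) : H →L[ℂ] H)).re :=
    (Complex.nonneg_iff.1 (trace_nonneg (hE.map_nonneg hY.mulStar_self_nonneg))).1
  refine abs_le_of_sq_le_sq ?_ (by positivity)
  rw [mul_pow, Real.sq_sqrt trace_re_nonneg, norm_sqrtFamily_sq (hE.map_nonneg ρ.nonneg') hσ]
  exact hE.sq_re_trace_le_of_isSLD h hY X.2

variable {A : H →ₗ.[ℂ] H}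

theorem IsCompletelyPositive.abs_expDeriv_le (hE : IsCompletelyPositive E)
    (hker : ∀ φ ∈ directions ρ A, sldInfo (E ρ.op : H →L[ℂ] H) (E φ) = 0 → expDeriv A φ = 0)
    (hfin : inverseForm (directions ρ A) (fun φ => sldInfo (E ρ.op : H →L[ℂ] H) (E φ))
      (expDeriv A) ≠ ⊤)
    (hφ : φ ∈ directions ρ A) {Z : HSFamily H}
    (hZ : Z ∈ (LinearMap.range (sqrtFamily hσ)).topologicalClosure)
    (h : ∀ X, ⟪Z, sqrtFamily hσ X⟫_ℝ = tracePairing (E φ) X) :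
    |expDeriv A φ| ≤ √(inverseForm (directions ρ A)
      (fun φ => sldInfo (E ρ.op : H →L[ℂ] H) (E φ)) (expDeriv A)).toReal * ‖Z‖ := by
  set σ := (E ρ.op : H →L[ℂ] H)
  set c := inverseForm (directions ρ A) (fun φ => sldInfo σ (E φ)) (expDeriv A)
  obtain ⟨Y, hY, hs_Y⟩ := sldInfo_lt_top_iff.1 hφ.2.2.1
  have sldInfo_le : sldInfo σ (E φ) ≤ ENNReal.ofReal (‖Z‖ ^ 2) :=
    sldInfo_le_of_inner_eq (hE.isSelfAdjoint_map hY hs_Y) hZ h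
  have div_le : ENNReal.ofReal (expDeriv A φ ^ 2) / sldInfo σ (E φ) ≤ c :=
    le_iSup₂ (f := fun φ (_ : φ ∈ directions ρ A) =>
      ENNReal.ofReal (expDeriv A φ ^ 2) / sldInfo σ (E φ)) φ hφ
  have sq_le : ENNReal.ofReal (expDeriv A φ ^ 2) ≤ c * ENNReal.ofReal (‖Z‖ ^ 2) := by
    by_cases h0 : sldInfo σ (E φ) = 0
    · simp [hker φ hφ h0]
    · rw [ENNReal.div_le_iff_le_mul (.inl h0)
        (.inl (sldInfo_le.trans_lt ENNReal.ofReal_lt_top).ne)] at div_le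
      exact div_le.trans (by gcongr)
  rw [← ENNReal.ofReal_toReal hfin, ← ENNReal.ofReal_mul ENNReal.toReal_nonneg,
    ENNReal.ofReal_le_ofReal_iff (by positivity)] at sq_le
  refine abs_le_of_sq_le_sq ?_ (by positivity)
  rwa [mul_pow, Real.sq_sqrt ENNReal.toReal_nonneg]

theorem IsCompletelyPositive.exists_tendsto_expDeriv (hE : IsCompletelyPositive E)
    (hker : ∀ φ ∈ directions ρ A, sldInfo (E ρ.op : H →L[ℂ] H) (E φ) = 0 → expDeriv A φ = 0)
    (hfin : inverseForm (directions ρ A) (fun φ => sldInfo (E ρ.op : H →L[ℂ] H) (E φ))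
      (expDeriv A) ≠ ⊤)
    (hA : Dense (A.domain : Set H)) :
    ∃ (X : ℕ → selfAdjoint (H →L[ℂ] H)) (c : ℝ),
      (∀ φ ∈ directions ρ A, Filter.Tendsto
        (fun n => (trace ((X n : H →L[ℂ] H) * (E φ : H →L[ℂ] H))).re) Filter.atTop
          (nhds (expDeriv A φ))) ∧
      Filter.Tendsto (fun n => (trace ((X n : H →L[ℂ] H) * (E ρ.op : H →L[ℂ] H) *
        (X n : H →L[ℂ] H))).re) Filter.atTop (nhds c) ∧
      ENNReal.ofReal c ≤ inverseForm (directions ρ A)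
        (fun φ => sldInfo (E ρ.op : H →L[ℂ] H) (E φ)) (expDeriv A) := by
  have hσ₀ : 0 ≤ (E ρ.op : H →L[ℂ] H) := hE.map_nonneg ρ.nonneg'
  have hσ := (E ρ.op).2.isHilbertSchmidt_sqrt hσ₀
  obtain ⟨X, c, hc, tendsto_mean, tendsto_norm⟩ := exists_seq_tendsto_of_abs_le
    (V := directionSpace ρ A) (sqrtFamily hσ)
    ((tracePairing ∘ₗ E.restrictScalars ℝ).domRestrict (directionSpace ρ A))
    (fun φ => by
      obtain ⟨Y, hY, hs_Y⟩ := sldInfo_lt_top_iff.1 φ.2.2.2.1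
      exact ⟨_, Real.sqrt_nonneg _, hE.abs_tracePairing_le hσ hY hs_Y⟩)
    (expDerivLinear ρ hA) (Real.sqrt_nonneg _)
    (fun φ Z hZ h => hE.abs_expDeriv_le hσ hker hfin φ.2 hZ h)
  refine ⟨X, c ^ 2, fun φ hφ => tendsto_mean ⟨φ, hφ⟩, ?_, ?_⟩
  · exact (tendsto_norm.pow 2).congr fun n => norm_sqrtFamily_sq hσ₀ hσ (X n)
  · refine (ENNReal.ofReal_le_ofReal (pow_le_pow_left₀ hc.1 hc.2 2)).trans_eq ?_
    rw [Real.sq_sqrt ENNReal.toReal_nonneg, ENNReal.ofReal_toReal hfin]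

end OutputObservables

end Channel

section Discretization

/-- The hat function of width `δ` centred at `y`. -/
noncomputable def hat (δ y x : ℝ) : ℝ := max 0 (1 - |x / δ - y / δ|)

theorem hat_nonneg (δ y x : ℝ) : 0 ≤ hat δ y x := le_max_left _ _

theorem continuous_hat (δ y : ℝ) : Continuous (hat δ y) := by
  unfold hat
  fun_prop

/-- The multiples `j δ` with `|j| ≤ K`. -/
noncomputable def lattice (δ : ℝ) (K : ℤ) : Finset ℝ :=
  (Finset.Icc (-K) K).image fun j : ℤ => j * δ

variable {δ : ℝ}

theorem hat_intCast_mul (hδ : 0 < δ) (j : ℤ) (x : ℝ) :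
    hat δ (j * δ) x = max 0 (1 - |x / δ - j|) := by
  rw [hat, mul_div_cancel_right₀ _ hδ.ne']

theorem hat_floor (hδ : 0 < δ) (x : ℝ) : hat δ (⌊x / δ⌋ * δ) x = 1 - Int.fract (x / δ) := by
  rw [hat_intCast_mul hδ, Int.self_sub_floor, abs_of_nonneg (Int.fract_nonneg _),
    max_eq_right (sub_nonneg.2 (Int.fract_lt_one _).le)]

theorem hat_floor_add_one (hδ : 0 < δ) (x : ℝ) :
    hat δ ((⌊x / δ⌋ + 1) * δ) x = Int.fract (x / δ) := by
  have := hat_intCast_mul hδ (⌊x / δ⌋ + 1) x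
  push_cast at this
  rw [this, ← sub_sub, Int.self_sub_floor, abs_sub_comm,
    abs_of_nonneg (sub_nonneg.2 (Int.fract_lt_one _).le), sub_sub_cancel,
    max_eq_right (Int.fract_nonneg _)]

theorem hat_eq_zero_of_ne (hδ : 0 < δ) {j : ℤ} {x : ℝ} (hj : j ≠ ⌊x / δ⌋)
    (hj' : j ≠ ⌊x / δ⌋ + 1) : hat δ (j * δ) x = 0 := by
  rw [hat_intCast_mul hδ, max_eq_left]
  have floor_le := Int.floor_le (x / δ)
  have lt_floor_add_one := Int.lt_floor_add_one (x / δ)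
  rw [sub_nonpos, le_abs]
  rcases lt_or_gt_of_ne hj with hlt | hgt
  · have : (j : ℝ) + 1 ≤ ⌊x / δ⌋ := by exact_mod_cast hlt
    exact .inl (by linarith)
  · have : (⌊x / δ⌋ : ℝ) + 2 ≤ j := by exact_mod_cast (by lia : ⌊x / δ⌋ + 2 ≤ j)
    exact .inr (by linarith)

theorem sum_lattice_mul_hat (hδ : 0 < δ) {x : ℝ} {K : ℤ} (hK : |x| / δ + 1 ≤ K) (f : ℝ → ℝ) :
    ∑ y ∈ lattice δ K, f y * hat δ y x =
      f (⌊x / δ⌋ * δ) * (1 - Int.fract (x / δ)) + f ((⌊x / δ⌋ + 1) * δ) * Int.fract (x / δ) := by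
  have injOn : Set.InjOn (fun j : ℤ => (j : ℝ) * δ) (Finset.Icc (-K) K) := fun i _ j _ h => by
    simpa only [mul_eq_mul_right_iff, Int.cast_inj, hδ.ne', or_false] using h
  have neighbours_subset : ({⌊x / δ⌋, ⌊x / δ⌋ + 1} : Finset ℤ) ⊆ Finset.Icc (-K) K := by
    obtain ⟨hlow, hup⟩ := abs_le.1 (show |x / δ| ≤ ((K - 1 : ℤ) : ℝ) by
      rw [abs_div, abs_of_pos hδ]
      push_cast
      linarith)
    have le_floor : -(K - 1) ≤ ⌊x / δ⌋ := Int.le_floor.2 (by exact_mod_cast hlow)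
    have floor_le : ⌊x / δ⌋ ≤ K - 1 := by exact_mod_cast (Int.floor_le _).trans hup
    simp only [Finset.insert_subset_iff, Finset.singleton_subset_iff, Finset.mem_Icc]
    lia
  rw [lattice, Finset.sum_image injOn, ← Finset.sum_subset neighbours_subset,
    Finset.sum_pair (by lia)]
  · push_cast
    rw [hat_floor hδ, hat_floor_add_one hδ]
  · intro j _ hj
    simp only [Finset.mem_insert, Finset.mem_singleton, not_or] at hj
    rw [hat_eq_zero_of_ne hδ hj.1 hj.2, mul_zero]

theorem sum_lattice_hat (hδ : 0 < δ) {x : ℝ} {K : ℤ} (hK : |x| / δ + 1 ≤ K) :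
    ∑ y ∈ lattice δ K, hat δ y x = 1 := by
  simpa only [one_mul, sub_add_cancel] using sum_lattice_mul_hat hδ hK fun _ => 1

theorem mul_floor_add_fract (hδ : 0 < δ) (x : ℝ) :
    δ * (⌊x / δ⌋ + Int.fract (x / δ)) = x := by
  rw [Int.floor_add_fract, mul_div_cancel₀ _ hδ.ne']

theorem sum_lattice_self_mul_hat (hδ : 0 < δ) {x : ℝ} {K : ℤ} (hK : |x| / δ + 1 ≤ K) :
    ∑ y ∈ lattice δ K, y * hat δ y x = x := by
  rw [sum_lattice_mul_hat hδ hK fun y => y]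
  linear_combination mul_floor_add_fract hδ x

theorem sum_lattice_sq_mul_hat_le (hδ : 0 < δ) {x : ℝ} {K : ℤ} (hK : |x| / δ + 1 ≤ K) :
    ∑ y ∈ lattice δ K, y ^ 2 * hat δ y x ≤ x ^ 2 + δ ^ 2 := by
  set t := Int.fract (x / δ)
  have variance_eq : ∑ y ∈ lattice δ K, y ^ 2 * hat δ y x = x ^ 2 + δ ^ 2 * (t * (1 - t)) := by
    rw [sum_lattice_mul_hat hδ hK fun y => y ^ 2]
    linear_combination (δ * (⌊x / δ⌋ + t) + x) * mul_floor_add_fract hδ x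
  have variance_le : t * (1 - t) ≤ 1 := by nlinarith [sq_nonneg (t - 1 / 2)]
  rw [variance_eq]
  gcongr
  exact mul_le_of_le_one_right (sq_nonneg δ) variance_le

/-- A real-valued quantum measurement with finitely many possible values; `effect y` is the
operator whose expectation is the probability of the value `y`. -/
structure FiniteObservable (H : Type*) [NormedAddCommGroup H] [InnerProductSpace ℂ H]
    [CompleteSpace H] where
  values : Finset ℝ
  effect : ℝ → H →L[ℂ] H
  nonneg : ∀ y, 0 ≤ effect y
  sum_effect : ∑ y ∈ values, effect y = 1

variable {H : Type*} [NormedAddCommGroup H] [InnerProductSpace ℂ H] [CompleteSpace H]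
  {X : H →L[ℂ] H}

theorem sum_smul_cfc {ι : Type*} (s : Finset ι) (c : ι → ℝ) {g : ι → ℝ → ℝ}
    (hg : ∀ i, Continuous (g i)) :
    ∑ i ∈ s, (c i : ℂ) • cfc (g i) X = cfc (fun x => ∑ i ∈ s, c i * g i x) X := by
  simp only [Complex.coe_smul, ← cfc_const_mul _ _ X (hg _).continuousOn]
  rw [← cfc_sum (fun i x => c i * g i x) X s fun i _ => ((hg i).const_mul (c i)).continuousOn]
  congr 1
  ext x
  rw [Finset.sum_apply]

/-- Spread the spectrum of `X` over the two nearest points of a lattice of mesh `δ`, by linear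
interpolation: this preserves the mean and adds at most `δ ^ 2` to the second moment. -/
theorem exists_finiteObservable (hX : IsSelfAdjoint X) (hδ : 0 < δ) :
    ∃ G : FiniteObservable H, ∑ y ∈ G.values, (y : ℂ) • G.effect y = X ∧
      ∑ y ∈ G.values, ((y ^ 2 : ℝ) : ℂ) • G.effect y ≤ X * X + ((δ ^ 2 : ℝ) : ℂ) • 1 := by
  obtain ⟨K, hK⟩ := exists_int_ge (‖X‖ / δ + 1)
  have spectrum_le (x : ℝ) (hx : x ∈ spectrum ℝ X) : |x| / δ + 1 ≤ K := by
    have : Nontrivial H := by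
      by_contra h
      rw [not_nontrivial_iff_subsingleton] at h
      simp at hx
    refine hK.trans' ?_
    gcongr
    exact spectrum.norm_le_norm_of_mem hx
  refine ⟨⟨lattice δ K, fun y => cfc (hat δ y) X, fun y => cfc_nonneg fun x _ => hat_nonneg δ y x,
    ?_⟩, ?_, ?_⟩
  · have := sum_smul_cfc (X := X) (lattice δ K) (fun _ => 1) (continuous_hat δ)
    simp only [Complex.ofReal_one, one_smul, one_mul] at this
    rw [this, cfc_congr fun x hx => sum_lattice_hat hδ (spectrum_le x hx), cfc_const_one ℝ X]
  · rw [sum_smul_cfc (lattice δ K) (fun y => y) (continuous_hat δ),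
      cfc_congr fun x hx => sum_lattice_self_mul_hat hδ (spectrum_le x hx), cfc_id' ℝ X]
  · calc
      _ = cfc (fun x => ∑ y ∈ lattice δ K, y ^ 2 * hat δ y x) X :=
        sum_smul_cfc (lattice δ K) (fun y => y ^ 2) (continuous_hat δ)
      _ ≤ cfc (fun x => x ^ 2 + δ ^ 2) X :=
        cfc_mono (fun x hx => sum_lattice_sq_mul_hat_le hδ (spectrum_le x hx))
          (by have := continuous_hat δ; fun_prop)
      _ = X * X + ((δ ^ 2 : ℝ) : ℂ) • 1 := by
        rw [cfc_add_const (δ ^ 2) (fun x => x ^ 2) X, cfc_pow_id X 2, sq X,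
          Algebra.algebraMap_eq_smul_one, Complex.coe_smul]

end Discretization

section JointMeasurement

open MeasureTheory

variable {H : Type*} [NormedAddCommGroup H] [InnerProductSpace ℂ H] [CompleteSpace H]

theorem sum_re_trace_mul {ι : Type*} (s : Finset ι) (a : ι → H →L[ℂ] H) {T : H →L[ℂ] H}
    (hT : IsTraceClass T) :
    ∑ i ∈ s, (trace (a i * T)).re = (trace ((∑ i ∈ s, a i) * T)).re := by
  rw [Finset.sum_mul, trace_sum s fun i _ => hT.mul_left (a i), Complex.re_sum]

theorem sum_mul_re_trace_mul {ι : Type*} (s : Finset ι) (f : ι → ℝ) (a : ι → H →L[ℂ] H)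
    {T : H →L[ℂ] H} (hT : IsTraceClass T) :
    ∑ i ∈ s, f i * (trace (a i * T)).re = (trace ((∑ i ∈ s, (f i : ℂ) • a i) * T)).re := by
  rw [← sum_re_trace_mul s _ hT]
  refine Finset.sum_congr rfl fun i _ => ?_
  rw [smul_mul_assoc, trace_smul, Complex.re_ofReal_mul]

theorem re_trace_mul_mono {a b T : H →L[ℂ] H} (hT : IsTraceClass T) (hT₀ : 0 ≤ T) (hab : a ≤ b) :
    (trace (a * T)).re ≤ (trace (b * T)).re := by
  have := (Complex.nonneg_iff.1 (trace_mul_nonneg hT hT₀ (sub_nonneg.2 hab))).1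
  rwa [mul_sub, trace_sub (hT.mul_right b) (hT.mul_right a), trace_mul_comm hT, trace_mul_comm hT,
    Complex.sub_re, sub_nonneg] at this

theorem finiteMeasure_ext_of_real_eq {Ω : Type*} [MeasurableSpace Ω] {μ ν : FiniteMeasure Ω}
    (h : ∀ S, MeasurableSet S → (μ : Measure Ω).real S = (ν : Measure Ω).real S) : μ = ν :=
  FiniteMeasure.eq_of_forall_toMeasure_apply_eq _ _ fun S hS =>
    (measureReal_eq_measureReal_iff).1 (h S hS)

namespace CPInstrument

variable {Ω : Type*} [MeasurableSpace Ω] (I : CPInstrument Ω H)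

theorem re_trace_mul_nonneg {s : Set Ω} (hs : MeasurableSet s) {a : H →L[ℂ] H} (ha : 0 ≤ a)
    {T : traceClass H} (hT : 0 ≤ (T : H →L[ℂ] H)) :
    0 ≤ (trace (a * (I.toFun s T : H →L[ℂ] H))).re := by
  rw [← trace_mul_comm (I.toFun s T).2]
  exact (Complex.nonneg_iff.1 (trace_mul_nonneg (I.toFun s T).2
    ((I.completelyPositive' s hs).map_nonneg hT) ha)).1

theorem trace_mul_empty (a : H →L[ℂ] H) (T : traceClass H) :
    trace (a * (I.toFun ∅ T : H →L[ℂ] H)) = 0 := by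
  have := (I.iUnion' (fun _ => ∅) (fun _ => .empty)
    (fun _ _ _ => disjoint_bot_left) T a).summable
  rwa [summable_const_iff] at this

/-- The measure `s ↦ Tr[a ℐ(s)(T)]`. -/
noncomputable def outcomeMeasure {a : H →L[ℂ] H} (ha : 0 ≤ a) {T : traceClass H}
    (hT : 0 ≤ (T : H →L[ℂ] H)) : Measure Ω :=
  Measure.ofMeasurable (fun s _ => ENNReal.ofReal (trace (a * (I.toFun s T : H →L[ℂ] H))).re)
    (by rw [trace_mul_empty, Complex.zero_re, ENNReal.ofReal_zero])
    (fun f hf hd => by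
      have := Complex.hasSum_re (I.iUnion' f hf hd T a)
      rw [← this.tsum_eq, ENNReal.ofReal_tsum_of_nonneg
        (fun i => I.re_trace_mul_nonneg (hf i) ha hT) this.summable])

variable {a : H →L[ℂ] H} (ha : 0 ≤ a) {T T' : traceClass H} (hT : 0 ≤ (T : H →L[ℂ] H))

theorem outcomeMeasure_apply {s : Set Ω} (hs : MeasurableSet s) :
    I.outcomeMeasure ha hT s = ENNReal.ofReal (trace (a * (I.toFun s T : H →L[ℂ] H))).re :=
  Measure.ofMeasurable_apply s hs

instance : IsFiniteMeasure (I.outcomeMeasure ha hT) :=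
  ⟨by
    rw [I.outcomeMeasure_apply ha hT .univ]
    exact ENNReal.ofReal_lt_top⟩

theorem outcomeMeasure_real {s : Set Ω} (hs : MeasurableSet s) :
    (I.outcomeMeasure ha hT).real s = (trace (a * (I.toFun s T : H →L[ℂ] H))).re := by
  rw [measureReal_def, I.outcomeMeasure_apply ha hT hs,
    ENNReal.toReal_ofReal (I.re_trace_mul_nonneg hs ha hT)]

variable (G : FiniteObservable H)

open Classical in
/-- The joint law of the outcome of the instrument and of a subsequent measurement of the observable
`G`, for the unnormalized initial state `T`; zero if `T` is not positive. -/
noncomputable def jointLaw (T : traceClass H) : FiniteMeasure (Ω × ℝ) :=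
  if hT : 0 ≤ (T : H →L[ℂ] H) then
    ⟨∑ y ∈ G.values, (I.outcomeMeasure (G.nonneg y) hT).map (fun ω => (ω, y)), inferInstance⟩
  else 0

theorem jointLaw_toMeasure (hT : 0 ≤ (T : H →L[ℂ] H)) : (I.jointLaw G T : Measure (Ω × ℝ)) =
    ∑ y ∈ G.values, (I.outcomeMeasure (G.nonneg y) hT).map (fun ω => (ω, y)) :=
  congrArg FiniteMeasure.toMeasure (dif_pos hT)

theorem jointLaw_real (hT : 0 ≤ (T : H →L[ℂ] H)) {S : Set (Ω × ℝ)} (hS : MeasurableSet S) :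
    (I.jointLaw G T : Measure (Ω × ℝ)).real S = ∑ y ∈ G.values,
      (trace (G.effect y * (I.toFun ((fun ω => (ω, y)) ⁻¹' S) T : H →L[ℂ] H))).re := by
  rw [I.jointLaw_toMeasure G hT, measureReal_def, Measure.finsetSum_apply,
    ENNReal.toReal_sum fun y _ => measure_ne_top _ _]
  refine Finset.sum_congr rfl fun y _ => ?_
  rw [Measure.map_apply measurable_prodMk_right hS, ← measureReal_def,
    I.outcomeMeasure_real _ hT (measurable_prodMk_right hS)]

theorem jointLaw_add (hT : 0 ≤ (T : H →L[ℂ] H)) (hT' : 0 ≤ (T' : H →L[ℂ] H)) :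
    I.jointLaw G (T + T') = I.jointLaw G T + I.jointLaw G T' := by
  refine finiteMeasure_ext_of_real_eq fun S hS => ?_
  rw [FiniteMeasure.toMeasure_add, measureReal_add_apply, I.jointLaw_real G hT hS,
    I.jointLaw_real G hT' hS, I.jointLaw_real G (T := T + T') (add_nonneg hT hT') hS,
    ← Finset.sum_add_distrib]
  refine Finset.sum_congr rfl fun y _ => ?_
  rw [map_add, Submodule.coe_add, mul_add, trace_add ((I.toFun _ T).2.mul_left _)
    ((I.toFun _ T').2.mul_left _), Complex.add_re]

theorem jointLaw_smul (hT : 0 ≤ (T : H →L[ℂ] H)) (c : NNReal) :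
    I.jointLaw G (((c : ℝ) : ℂ) • T) = c • I.jointLaw G T := by
  refine finiteMeasure_ext_of_real_eq fun S hS => ?_
  rw [FiniteMeasure.toMeasure_smul, measureReal_nnreal_smul_apply, I.jointLaw_real G hT hS,
    I.jointLaw_real G (T := ((c : ℝ) : ℂ) • T) (ofReal_smul_nonneg c.2 hT) hS, Finset.mul_sum]
  refine Finset.sum_congr rfl fun y _ => ?_
  rw [map_smul, Submodule.coe_smul, mul_smul_comm, trace_smul, Complex.re_ofReal_mul]

theorem jointLaw_real_fst (hT : 0 ≤ (T : H →L[ℂ] H)) {S : Set Ω} (hS : MeasurableSet S) :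
    (I.jointLaw G T : Measure (Ω × ℝ)).real (Prod.fst ⁻¹' S) =
      (trace (I.toFun S T : H →L[ℂ] H)).re := by
  rw [I.jointLaw_real G hT (measurable_fst hS)]
  change ∑ y ∈ G.values, (trace (G.effect y * (I.toFun S T : H →L[ℂ] H))).re = _
  rw [sum_re_trace_mul _ _ (I.toFun S T).2, G.sum_effect, one_mul]

theorem jointLaw_mass (hT : 0 ≤ (T : H →L[ℂ] H)) :
    ((I.jointLaw G T).mass : ℝ) = (trace (T : H →L[ℂ] H)).re := by
  rw [← I.trace_univ', ← I.jointLaw_real_fst G hT .univ, Set.preimage_univ]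
  rfl

theorem integrable_jointLaw (hT : 0 ≤ (T : H →L[ℂ] H)) {f : Ω × ℝ → ℝ} (hf : Measurable f)
    (hb : ∀ y, ∃ C, ∀ ω, |f (ω, y)| ≤ C) :
    Integrable f (I.jointLaw G T : Measure (Ω × ℝ)) := by
  rw [I.jointLaw_toMeasure G hT, integrable_finsetSum_measure]
  intro y _
  rw [integrable_map_measure hf.aestronglyMeasurable measurable_prodMk_right.aemeasurable]
  obtain ⟨C, hC⟩ := hb y
  exact .of_bound (hf.comp measurable_prodMk_right).aestronglyMeasurable C (ae_of_all _ hC)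

theorem integral_jointLaw (hT : 0 ≤ (T : H →L[ℂ] H)) {f : ℝ → ℝ} (hf : Measurable f) :
    ∫ p, f p.2 ∂(I.jointLaw G T : Measure (Ω × ℝ)) = ∑ y ∈ G.values,
      f y * (trace (G.effect y * (I.toFun Set.univ T : H →L[ℂ] H))).re := by
  have hf_snd : Measurable fun p : Ω × ℝ => f p.2 := hf.comp measurable_snd
  rw [I.jointLaw_toMeasure G hT, integral_finsetSum_measure fun y _ => ?_]
  · refine Finset.sum_congr rfl fun y _ => ?_
    rw [integral_map measurable_prodMk_right.aemeasurable hf_snd.aestronglyMeasurable]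
    simp only [integral_const, smul_eq_mul]
    rw [I.outcomeMeasure_real _ hT .univ, mul_comm]
  · rw [integrable_map_measure hf_snd.aestronglyMeasurable measurable_prodMk_right.aemeasurable]
    exact integrable_const (f y)

theorem isEffect_jointLaw (S : Set (Ω × ℝ)) :
    IsEffect fun T => (I.jointLaw G T : Measure (Ω × ℝ)).real S where
  add T T' hT hT' := by
    rw [I.jointLaw_add G hT hT', FiniteMeasure.toMeasure_add, measureReal_add_apply]
  smul c T hc hT := by
    lift c to NNReal using hc
    rw [I.jointLaw_smul G hT, FiniteMeasure.toMeasure_smul, measureReal_nnreal_smul_apply]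
  nonneg T _ := measureReal_nonneg
  le_trace T hT := by
    rw [← I.jointLaw_mass G hT]
    exact measureReal_mono (Set.subset_univ S)

end CPInstrument

end JointMeasurement

section LimitPOVM

open MeasureTheory Filter Topology

theorem exists_tendsto_of_tight {ι E : Type*} [TopologicalSpace E] [T2Space E] [NormalSpace E]
    [MeasurableSpace E] [BorelSpace E] {μ : ι → FiniteMeasure E} {C : NNReal}
    (mass_le : ∀ i, (μ i).mass ≤ C)
    (tight : ∀ ε > 0, ∃ K, IsCompact K ∧ ∀ i, (μ i : Measure E).real Kᶜ ≤ ε)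
    (U : Ultrafilter ι) : ∃ ν, Tendsto μ U (𝓝 ν) := by
  obtain ⟨u, -, u_pos, u_tendsto⟩ := exists_seq_strictAnti_tendsto (0 : NNReal)
  choose K hK μ_le using fun n => tight (u n) (NNReal.coe_pos.2 (u_pos n))
  have compact := isCompact_setOfPred_finiteMeasure_mass_le_compl_isCompact_le C u_tendsto hK
    (.inl inferInstance)
  obtain ⟨ν, -, hν⟩ := isCompact_iff_ultrafilter_le_nhds.1 compact (U.map μ) (by
    rw [le_principal_iff, Ultrafilter.coe_map, mem_map]
    exact univ_mem' fun i => ⟨mass_le i, fun n => by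
      simpa only [FiniteMeasure.measureReal_eq_coe_coeFn, NNReal.coe_le_coe] using μ_le n i⟩)
  exact ⟨ν, hν⟩

theorem exists_isCompact_measureReal_compl_le {Ω : Type*} [TopologicalSpace Ω] [PolishSpace Ω]
    [MeasurableSpace Ω] [BorelSpace Ω] (μ : Measure Ω) [IsFiniteMeasure μ] {ε : ℝ} (hε : 0 < ε) :
    ∃ K, IsCompact K ∧ μ.real Kᶜ ≤ ε := by
  obtain ⟨K, hK, μ_le⟩ := isTightMeasureSet_iff_exists_isCompact_measure_compl_le.1
    (isTightMeasureSet_singleton (μ := μ)) _ (ENNReal.ofReal_pos.2 hε)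
  exact ⟨K, hK, ENNReal.toReal_le_of_le_ofReal hε.le (μ_le μ rfl)⟩

theorem measureReal_compl_prod_le {Ω : Type*} [MeasurableSpace Ω] {μ : Measure (Ω × ℝ)}
    [IsFiniteMeasure μ] (hμ : Integrable (fun p => p.2 ^ 2) μ) (K : Set Ω) {R : ℝ} (hR : 0 < R) :
    μ.real (K ×ˢ Metric.closedBall 0 R)ᶜ ≤
      μ.real (Prod.fst ⁻¹' Kᶜ) + (∫ p, p.2 ^ 2 ∂μ) / R ^ 2 := by
  have compl_subset : (K ×ˢ Metric.closedBall (0 : ℝ) R)ᶜ ⊆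
      Prod.fst ⁻¹' Kᶜ ∪ {p | R ^ 2 ≤ p.2 ^ 2} := fun p hp => by
    by_contra h
    simp only [Set.mem_union, Set.mem_preimage, Set.mem_compl_iff, not_or, not_not,
      Set.mem_ofPred_eq, not_le] at h
    exact hp ⟨h.1, mem_closedBall_zero_iff.2 (abs_lt_of_sq_lt_sq h.2 hR.le).le⟩
  have chebyshev : μ.real {p | R ^ 2 ≤ p.2 ^ 2} ≤ (∫ p, p.2 ^ 2 ∂μ) / R ^ 2 := by
    rw [le_div_iff₀' (by positivity)]
    exact mul_meas_ge_le_integral_of_nonneg (ae_of_all _ fun p => sq_nonneg _) hμ _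
  exact (measureReal_mono compl_subset).trans
    ((measureReal_union_le _ _).trans (add_le_add_right chebyshev _))

variable {H : Type*} [NormedAddCommGroup H] [InnerProductSpace ℂ H] [CompleteSpace H]

theorem IsEffect.exists_pos_forall_le (ρ : FaithfulState H) {T : traceClass H}
    (hT : 0 ≤ (T : H →L[ℂ] H)) {ε : ℝ} (hε : 0 < ε) :
    ∃ δ > 0, ∀ q : traceClass H → ℝ, IsEffect q → q ρ.op ≤ δ → q T ≤ ε := by
  have small := (tendsto_zero_of_faithfulState ρ
    (q := fun q : {q : traceClass H → ℝ // IsEffect q} => q.1)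
    (l := comap (fun q => q.1 ρ.op) (𝓝 0)) (fun q => q.2) tendsto_comap hT).eventually_lt_const hε
  obtain ⟨δ, hδ, ball_subset⟩ := Metric.eventually_nhds_iff.1 (eventually_comap.1 small)
  refine ⟨δ / 2, half_pos hδ, fun q hq hqδ => (ball_subset ?_ ⟨q, hq⟩ rfl).le⟩
  rw [Real.dist_0_eq_abs, abs_of_nonneg (hq.nonneg _ ρ.nonneg')]
  linarith

namespace CPInstrument

variable {Ω : Type*} [MeasurableSpace Ω] (I : CPInstrument Ω H)

/-- The POVM `M`, with laws `m T = Tr[T M(·)]` for positive `T`, is the weak limit along `l` of the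
joint measurements of the instrument `I` and, subsequently, of the observables `G i`. The values of
`m` at operators that are not positive are irrelevant. -/
structure IsLimitPOVM [TopologicalSpace Ω] [OpensMeasurableSpace (Ω × ℝ)] {ι : Type*} (l : Filter ι)
    (G : ι → FiniteObservable H) (M : POVM (Ω × ℝ) H)
    (m : traceClass H → FiniteMeasure (Ω × ℝ)) : Prop where
  re_trace_mul : ∀ T : traceClass H, 0 ≤ (T : H →L[ℂ] H) → ∀ S, MeasurableSet S →
    (trace ((T : H →L[ℂ] H) * M.toFun S)).re = (m T : Measure (Ω × ℝ)).real S
  tendsto : ∀ T : traceClass H, 0 ≤ (T : H →L[ℂ] H) →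
    Tendsto (fun i => I.jointLaw (G i) T) l (𝓝 (m T))

theorem jointLaw_map_fst (G : FiniteObservable H) {T : traceClass H} (hT : 0 ≤ (T : H →L[ℂ] H)) :
    (I.jointLaw G T).map Prod.fst =
      ⟨I.outcomeMeasure (zero_le_one (α := H →L[ℂ] H)) hT, inferInstance⟩ := by
  refine finiteMeasure_ext_of_real_eq fun S hS => ?_
  rw [FiniteMeasure.toMeasure_map, map_measureReal_apply measurable_fst hS,
    I.jointLaw_real_fst G hT hS, FiniteMeasure.toMeasure_mk, I.outcomeMeasure_real _ hT hS, one_mul]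

theorem integrable_sq_jointLaw (G : FiniteObservable H) {T : traceClass H}
    (hT : 0 ≤ (T : H →L[ℂ] H)) :
    Integrable (fun p => p.2 ^ 2) (I.jointLaw G T : Measure (Ω × ℝ)) :=
  I.integrable_jointLaw G hT (by fun_prop) fun y => ⟨|y ^ 2|, fun _ => le_rfl⟩

variable [TopologicalSpace Ω] [PolishSpace Ω] [BorelSpace Ω] {ι : Type*}
  {G : ι → FiniteObservable H} {ρ : FaithfulState H} {C : ℝ}

theorem exists_isCompact_jointLaw_compl_le
    (hC : ∀ i, ∫ p, p.2 ^ 2 ∂(I.jointLaw (G i) ρ.op : Measure (Ω × ℝ)) ≤ C) {ε : ℝ} (hε : 0 < ε) :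
    ∃ K, IsCompact K ∧ ∀ i, (I.jointLaw (G i) ρ.op : Measure (Ω × ℝ)).real Kᶜ ≤ ε := by
  obtain ⟨K, hK, K_le⟩ := exists_isCompact_measureReal_compl_le
    (I.outcomeMeasure (zero_le_one (α := H →L[ℂ] H)) ρ.nonneg') (half_pos hε)
  have tail : Tendsto (fun R : ℝ => C / R ^ 2) atTop (𝓝 0) :=
    tendsto_const_nhds.div_atTop (tendsto_pow_atTop two_ne_zero)
  obtain ⟨R, R_pos, R_le⟩ :=
    ((eventually_gt_atTop 0).and (tail.eventually_lt_const (half_pos hε))).exists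
  refine ⟨_, hK.prod (isCompact_closedBall 0 R), fun i => ?_⟩
  refine (measureReal_compl_prod_le (I.integrable_sq_jointLaw (G i) ρ.nonneg') K R_pos).trans ?_
  rw [I.outcomeMeasure_real _ _ hK.isClosed.measurableSet.compl, one_mul,
    ← I.jointLaw_real_fst (G i) ρ.nonneg' hK.isClosed.measurableSet.compl] at K_le
  have : (∫ p, p.2 ^ 2 ∂(I.jointLaw (G i) ρ.op : Measure (Ω × ℝ))) / R ^ 2 ≤ C / R ^ 2 := by
    gcongr
    exact hC i
  linarith

theorem exists_tendsto_jointLaw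
    (hC : ∀ i, ∫ p, p.2 ^ 2 ∂(I.jointLaw (G i) ρ.op : Measure (Ω × ℝ)) ≤ C) (U : Ultrafilter ι)
    {T : traceClass H} (hT : 0 ≤ (T : H →L[ℂ] H)) :
    ∃ ν, Tendsto (fun i => I.jointLaw (G i) T) U (𝓝 ν) := by
  refine exists_tendsto_of_tight (C := (trace (T : H →L[ℂ] H)).re.toNNReal) (fun i => ?_)
    (fun ε hε => ?_) U
  · rw [← NNReal.coe_le_coe, I.jointLaw_mass (G i) hT]
    exact Real.le_coe_toNNReal _
  · obtain ⟨δ, hδ, le_of_le⟩ := IsEffect.exists_pos_forall_le ρ hT hε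
    obtain ⟨K, hK, K_le⟩ := I.exists_isCompact_jointLaw_compl_le hC hδ
    exact ⟨K, hK, fun i => le_of_le _ (I.isEffect_jointLaw (G i) Kᶜ) (K_le i)⟩

theorem exists_isLimitPOVM
    (hC : ∀ i, ∫ p, p.2 ^ 2 ∂(I.jointLaw (G i) ρ.op : Measure (Ω × ℝ)) ≤ C) (U : Ultrafilter ι) :
    ∃ M m, I.IsLimitPOVM U G M m := by
  have exists_law (T : traceClass H) : ∃ ν, 0 ≤ (T : H →L[ℂ] H) →
      Tendsto (fun i => I.jointLaw (G i) T) U (𝓝 ν) := by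
    by_cases hT : 0 ≤ (T : H →L[ℂ] H)
    · exact (I.exists_tendsto_jointLaw hC U hT).imp fun _ h _ => h
    · exact ⟨0, fun h => absurd h hT⟩
  choose m hm using exists_law
  have m_add (S T : traceClass H) (hS : 0 ≤ (S : H →L[ℂ] H)) (hT : 0 ≤ (T : H →L[ℂ] H)) :
      m (S + T) = m S + m T :=
    tendsto_nhds_unique (hm (S + T) (add_nonneg hS hT))
      (((hm S hS).add (hm T hT)).congr fun i => (I.jointLaw_add (G i) hS hT).symm)
  have m_smul (c : NNReal) (T : traceClass H) (hT : 0 ≤ (T : H →L[ℂ] H)) :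
      m (((c : ℝ) : ℂ) • T) = c • m T :=
    tendsto_nhds_unique (hm _ (ofReal_smul_nonneg c.2 hT))
      (((hm T hT).const_smul c).congr fun i => (I.jointLaw_smul (G i) hT c).symm)
  have m_mass (T : traceClass H) (hT : 0 ≤ (T : H →L[ℂ] H)) :
      ((m T).mass : ℝ) = (trace (T : H →L[ℂ] H)).re :=
    tendsto_nhds_unique ((NNReal.continuous_coe.tendsto _).comp (hm T hT).mass)
      (tendsto_const_nhds.congr fun i => (I.jointLaw_mass (G i) hT).symm)
  obtain ⟨M, hM⟩ := exists_povm_of_measures (m := fun T => (m T : Measure (Ω × ℝ)))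
    (fun S T hS hT => by rw [m_add S T hS hT, FiniteMeasure.toMeasure_add])
    (fun c T hc hT => by
      lift c to NNReal using hc
      rw [m_smul c T hT, FiniteMeasure.toMeasure_smul, ENNReal.ofReal_coe_nnreal]
      rfl)
    m_mass
  exact ⟨M, m, hM, hm⟩

variable {I} in
theorem IsLimitPOVM.inducedPOVM_apply {l : Filter ι} [l.NeBot] {M : POVM (Ω × ℝ) H}
    {m : traceClass H → FiniteMeasure (Ω × ℝ)} (h : I.IsLimitPOVM l G M m) {S : Set Ω}
    (hS : MeasurableSet S) : I.inducedPOVM.toFun S = M.toFun (Prod.fst ⁻¹' S) := by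
  refine isSelfAdjoint_ext_inner (.of_nonneg (I.inducedPOVM.nonneg' S hS))
    (.of_nonneg (M.nonneg' _ (measurable_fst hS))) fun x => ?_
  have hx := ketBra_self_nonneg x
  have map_fst : (m (ketBra x x)).map Prod.fst =
      ⟨I.outcomeMeasure (zero_le_one (α := H →L[ℂ] H)) hx, inferInstance⟩ :=
    tendsto_nhds_unique
      (FiniteMeasure.tendsto_map_of_tendsto_of_continuous _ _ (h.tendsto _ hx) continuous_fst)
      (tendsto_const_nhds.congr fun i => (I.jointLaw_map_fst (G i) hx).symm)
  rw [← re_trace_ketBra_mul x (M.toFun _), h.re_trace_mul _ hx _ (measurable_fst hS),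
    ← map_measureReal_apply measurable_fst hS, ← FiniteMeasure.toMeasure_map, map_fst,
    FiniteMeasure.toMeasure_mk, I.outcomeMeasure_real _ hx hS, ← I.isDual_dualMap hS x x]
  rfl

end CPInstrument

end LimitPOVM

section Truncation

open MeasureTheory Filter Topology

variable {R : ℝ}

/-- A continuous cutoff of the region where `|y|` is large compared with `R`. -/
noncomputable def tailWeight (R y : ℝ) : ℝ := y ^ 2 / (R ^ 2 + y ^ 2)

theorem continuous_tailWeight (hR : 0 < R) : Continuous (tailWeight R) := by
  unfold tailWeight
  exact (continuous_pow 2).div₀ (by fun_prop) fun y => by positivity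

theorem tailWeight_nonneg (R y : ℝ) : 0 ≤ tailWeight R y := by
  unfold tailWeight
  positivity

theorem tailWeight_le_one (R y : ℝ) : tailWeight R y ≤ 1 :=
  div_le_one_of_le₀ (by linarith [sq_nonneg R]) (by positivity)

theorem abs_tailWeight_le_one (R y : ℝ) : |tailWeight R y| ≤ 1 :=
  (abs_of_nonneg (tailWeight_nonneg R y)).trans_le (tailWeight_le_one R y)

theorem tendsto_tailWeight_zero (y : ℝ) : Tendsto (fun R => tailWeight R y) atTop (𝓝 0) :=
  tendsto_const_nhds.div_atTop
    (tendsto_atTop_add_const_right _ _ (tendsto_pow_atTop two_ne_zero))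

/-- A bounded continuous truncation of `y`, close to `y` when `|y|` is small compared with `R`. -/
noncomputable def truncate (R y : ℝ) : ℝ := y * (1 - tailWeight R y)

theorem continuous_truncate (hR : 0 < R) : Continuous (truncate R) :=
  continuous_id.mul (continuous_const.sub (continuous_tailWeight hR))

theorem abs_truncate_le (hR : 0 < R) (y : ℝ) : |truncate R y| ≤ R := by
  have one_sub_tailWeight : 1 - tailWeight R y = R ^ 2 / (R ^ 2 + y ^ 2) := by
    unfold tailWeight
    field_simp
    ring
  have quotient_nonneg : 0 ≤ R ^ 2 / (R ^ 2 + y ^ 2) := by positivity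
  rw [truncate, one_sub_tailWeight, abs_mul, abs_of_nonneg quotient_nonneg, ← mul_div_assoc,
    div_le_iff₀ (by positivity), ← sq_abs y]
  nlinarith [mul_nonneg hR.le (sq_nonneg (R - |y|)), mul_nonneg (abs_nonneg y) (sq_nonneg R)]

theorem truncate_sq_le (R y : ℝ) : truncate R y ^ 2 ≤ y ^ 2 := by
  rw [truncate, mul_pow]
  refine mul_le_of_le_one_right (sq_nonneg y) (pow_le_one₀ ?_ ?_)
  · linarith [tailWeight_le_one R y]
  · linarith [tailWeight_nonneg R y]

theorem tendsto_integral_tailWeight_zero {Ω : Type*} [MeasurableSpace Ω] (ν : Measure (Ω × ℝ))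
    [IsFiniteMeasure ν] :
    Tendsto (fun R => ∫ p, tailWeight R p.2 ∂ν) atTop (𝓝 0) := by
  have tendsto_integral : Tendsto (fun R => ∫ p, tailWeight R p.2 ∂ν) atTop (𝓝 (∫ _, 0 ∂ν)) := by
    refine tendsto_integral_filter_of_dominated_convergence (fun _ => 1) ?_ ?_
      (integrable_const 1) (ae_of_all _ fun p => tendsto_tailWeight_zero p.2)
    · filter_upwards [eventually_gt_atTop 0] with R hR
      exact ((continuous_tailWeight hR).measurable.comp measurable_snd).aestronglyMeasurable
    · exact Eventually.of_forall fun R => ae_of_all _ fun p => abs_tailWeight_le_one R p.2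
  rwa [integral_zero] at tendsto_integral

end Truncation

section Moments

open MeasureTheory Filter Topology

variable {H : Type*} [NormedAddCommGroup H] [InnerProductSpace ℂ H] [CompleteSpace H]
  {Ω : Type*} [MeasurableSpace Ω] {I : CPInstrument Ω H} {φ P N : traceClass H}

namespace CPInstrument

theorem integral_jointLaw_sub (G : FiniteObservable H) (hP : 0 ≤ (P : H →L[ℂ] H))
    (hN : 0 ≤ (N : H →L[ℂ] H)) (hφ : P = N + φ) {f : ℝ → ℝ} (hf : Measurable f) :
    ∫ p, f p.2 ∂(I.jointLaw G P : Measure (Ω × ℝ)) -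
        ∫ p, f p.2 ∂(I.jointLaw G N : Measure (Ω × ℝ)) =
      ∑ y ∈ G.values, f y * (trace (G.effect y * (I.toFun Set.univ φ : H →L[ℂ] H))).re := by
  rw [I.integral_jointLaw G hP hf, I.integral_jointLaw G hN hf, ← Finset.sum_sub_distrib]
  refine Finset.sum_congr rfl fun y _ => ?_
  rw [hφ, map_add, Submodule.coe_add, mul_add, trace_add ((I.toFun _ N).2.mul_left _)
    ((I.toFun _ φ).2.mul_left _), Complex.add_re, mul_add, add_sub_cancel_left]

theorem integral_sq_jointLaw_le (ρ : FaithfulState H) {X : H →L[ℂ] H} {δ : ℝ}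
    {G : FiniteObservable H}
    (hG : ∑ y ∈ G.values, ((y ^ 2 : ℝ) : ℂ) • G.effect y ≤ X * X + ((δ ^ 2 : ℝ) : ℂ) • 1) :
    ∫ p, p.2 ^ 2 ∂(I.jointLaw G ρ.op : Measure (Ω × ℝ)) ≤
      (trace (X * (I.toFun Set.univ ρ.op : H →L[ℂ] H) * X)).re + δ ^ 2 := by
  have hσ := (I.toFun Set.univ ρ.op).2
  rw [I.integral_jointLaw G ρ.nonneg' (f := fun y => y ^ 2) (by fun_prop),
    sum_mul_re_trace_mul _ _ _ hσ]
  have hσ_nonneg := (I.completelyPositive' _ .univ).map_nonneg ρ.nonneg'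
  refine (re_trace_mul_mono hσ hσ_nonneg hG).trans_eq ?_
  rw [add_mul, trace_add (hσ.mul_left _) (hσ.mul_left _), smul_mul_assoc, trace_smul, one_mul,
    I.trace_univ', ρ.trace', mul_one, Complex.add_re, Complex.ofReal_re, mul_assoc,
    ← trace_mul_comm (hσ.mul_left X)]

theorem sq_sum_sub_truncate_le [TopologicalSpace.SeparableSpace H] {ρ : FaithfulState H}
    {Y : H →L[ℂ] H} (h : IsSLD (ρ.op : H →L[ℂ] H) φ Y) (hY : IsHilbertSchmidt Y)
    (G : FiniteObservable H) {R : ℝ} (hR : 0 < R) :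
    (∑ y ∈ G.values, y * (trace (G.effect y * (I.toFun Set.univ φ : H →L[ℂ] H))).re -
      ∑ y ∈ G.values, truncate R y *
        (trace (G.effect y * (I.toFun Set.univ φ : H →L[ℂ] H))).re) ^ 2 ≤
      (∫ p, tailWeight R p.2 ∂(I.jointLaw G (hY.mulStar hY) : Measure (Ω × ℝ))) *
        ∫ p, p.2 ^ 2 ∂(I.jointLaw G ρ.op : Measure (Ω × ℝ)) := by
  rw [I.integral_jointLaw G hY.mulStar_self_nonneg (continuous_tailWeight hR).measurable,
    I.integral_jointLaw G ρ.nonneg' (f := fun y => y ^ 2) (by fun_prop), ← Finset.sum_sub_distrib]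
  have weighted_nonneg (y : ℝ) : 0 ≤ (trace (G.effect y *
      (I.toFun Set.univ (hY.mulStar hY) : H →L[ℂ] H))).re :=
    I.re_trace_mul_nonneg .univ (G.nonneg y) hY.mulStar_self_nonneg
  have prob_nonneg (y : ℝ) : 0 ≤ (trace (G.effect y *
      (I.toFun Set.univ ρ.op : H →L[ℂ] H))).re :=
    I.re_trace_mul_nonneg .univ (G.nonneg y) ρ.nonneg'
  refine Finset.sum_sq_le_sum_mul_sum_of_sq_le_mul _
    (fun y _ => mul_nonneg (tailWeight_nonneg R y) (weighted_nonneg y))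
    (fun y _ => mul_nonneg (sq_nonneg y) (prob_nonneg y)) fun y _ => ?_
  have cauchy_schwarz :=
    (I.completelyPositive' Set.univ .univ).sq_re_trace_mul_le_of_isSLD h hY (G.nonneg y)
  have tailWeight_sq_le : tailWeight R y ^ 2 ≤ tailWeight R y :=
    pow_le_of_le_one (tailWeight_nonneg R y) (tailWeight_le_one R y) two_ne_zero
  calc _ = tailWeight R y ^ 2 * y ^ 2 *
        (trace (G.effect y * (I.toFun Set.univ φ : H →L[ℂ] H))).re ^ 2 := by
        rw [truncate]
        ring
    _ ≤ tailWeight R y * y ^ 2 *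
        ((trace (G.effect y * (I.toFun Set.univ (hY.mulStar hY) : H →L[ℂ] H))).re *
          (trace (G.effect y * (I.toFun Set.univ ρ.op : H →L[ℂ] H))).re) := by
        gcongr
        exact mul_nonneg (tailWeight_nonneg R y) (sq_nonneg y)
    _ = _ := by ring

namespace IsLimitPOVM

variable [TopologicalSpace Ω] [OpensMeasurableSpace (Ω × ℝ)] {ι : Type*} {l : Filter ι}
  {G : ι → FiniteObservable H} {M : POVM (Ω × ℝ) H} {m : traceClass H → FiniteMeasure (Ω × ℝ)}

theorem law_eq (h : I.IsLimitPOVM l G M m) (ρ : FaithfulState H) :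
    M.law ρ = (m ρ.op : Measure (Ω × ℝ)) :=
  Measure.ext fun S hS => by
    rw [M.law_apply ρ hS, h.re_trace_mul _ ρ.nonneg' S hS, ofReal_measureReal]

theorem signedLaw_eq_sub (h : I.IsLimitPOVM l G M m) (hP : 0 ≤ (P : H →L[ℂ] H))
    (hN : 0 ≤ (N : H →L[ℂ] H)) (hφ : P = N + φ) {S : Set (Ω × ℝ)} (hS : MeasurableSet S) :
    M.signedLaw φ S = (m P : Measure (Ω × ℝ)).real S - (m N : Measure (Ω × ℝ)).real S := by
  rw [M.signedLaw_apply φ hS, ← h.re_trace_mul _ hP S hS, ← h.re_trace_mul _ hN S hS, hφ,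
    Submodule.coe_add, add_mul, trace_add (N.2.mul_right _) (φ.2.mul_right _), Complex.add_re,
    add_sub_cancel_left]

theorem tendsto_integral_snd (h : I.IsLimitPOVM l G M m) {T : traceClass H}
    (hT : 0 ≤ (T : H →L[ℂ] H)) {f : ℝ → ℝ} (hf : Continuous f) {C : ℝ} (hC : ∀ y, |f y| ≤ C) :
    Tendsto (fun i => ∫ p, f p.2 ∂(I.jointLaw (G i) T : Measure (Ω × ℝ))) l
      (𝓝 (∫ p, f p.2 ∂(m T : Measure (Ω × ℝ)))) :=
  FiniteMeasure.tendsto_iff_forall_integral_tendsto.1 (h.tendsto T hT)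
    (BoundedContinuousFunction.ofNormedAddCommGroup (fun p : Ω × ℝ => f p.2)
      (hf.comp continuous_snd) C fun p => hC p.2)

variable [l.NeBot] {ρ : FaithfulState H} {d : ι → ℝ} {c : ℝ}

theorem lintegral_truncate_sq_le (h : I.IsLimitPOVM l G M m)
    (hd : ∀ i, ∫ p, p.2 ^ 2 ∂(I.jointLaw (G i) ρ.op : Measure (Ω × ℝ)) ≤ d i)
    (hdc : Tendsto d l (𝓝 c)) {R : ℝ} (hR : 0 < R) :
    ∫⁻ p, ENNReal.ofReal (truncate R p.2 ^ 2) ∂M.law ρ ≤ ENNReal.ofReal c := by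
  have abs_sq_le (y : ℝ) : |truncate R y ^ 2| ≤ R ^ 2 := by
    rw [abs_pow]
    exact pow_le_pow_left₀ (abs_nonneg _) (abs_truncate_le hR y) 2
  have measurable_sq : Measurable fun p : Ω × ℝ => truncate R p.2 ^ 2 :=
    ((continuous_truncate hR).measurable.comp measurable_snd).pow_const 2
  have integral_le (i : ι) :
      ∫ p, truncate R p.2 ^ 2 ∂(I.jointLaw (G i) ρ.op : Measure (Ω × ℝ)) ≤ d i :=
    (integral_mono (.of_bound measurable_sq.aestronglyMeasurable _
      (ae_of_all _ fun p => abs_sq_le p.2)) (I.integrable_sq_jointLaw (G i) ρ.nonneg')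
      fun p => truncate_sq_le R p.2).trans (hd i)
  rw [h.law_eq, ← ofReal_integral_eq_lintegral_ofReal (.of_bound measurable_sq.aestronglyMeasurable
    _ (ae_of_all _ fun p => abs_sq_le p.2)) (ae_of_all _ fun p => sq_nonneg _)]
  exact ENNReal.ofReal_le_ofReal (le_of_tendsto_of_tendsto'
    (h.tendsto_integral_snd ρ.nonneg' ((continuous_truncate hR).pow 2) abs_sq_le) hdc integral_le)

variable [TopologicalSpace.SeparableSpace H] {Y : H →L[ℂ] H} {b : ℝ}

theorem tendsto_integral_truncate_sub (h : I.IsLimitPOVM l G M m)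
    (hd : ∀ i, ∫ p, p.2 ^ 2 ∂(I.jointLaw (G i) ρ.op : Measure (Ω × ℝ)) ≤ d i)
    (hdc : Tendsto d l (𝓝 c)) (hφ : IsSLD (ρ.op : H →L[ℂ] H) φ Y) (hY : IsHilbertSchmidt Y)
    (hP : 0 ≤ (P : H →L[ℂ] H)) (hN : 0 ≤ (N : H →L[ℂ] H)) (hPN : P = N + φ)
    (hb : Tendsto (fun i => ∑ y ∈ (G i).values,
      y * (trace ((G i).effect y * (I.toFun Set.univ φ : H →L[ℂ] H))).re) l (𝓝 b)) :
    Tendsto (fun R => ∫ p, truncate R p.2 ∂(m P : Measure (Ω × ℝ)) -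
      ∫ p, truncate R p.2 ∂(m N : Measure (Ω × ℝ))) atTop (𝓝 b) := by
  have sq_sub_le {R : ℝ} (hR : 0 < R) :
      (b - (∫ p, truncate R p.2 ∂(m P : Measure (Ω × ℝ)) -
        ∫ p, truncate R p.2 ∂(m N : Measure (Ω × ℝ)))) ^ 2 ≤
      (∫ p, tailWeight R p.2 ∂(m (hY.mulStar hY) : Measure (Ω × ℝ))) * c := by
    have tendsto_truncate := (h.tendsto_integral_snd hP (continuous_truncate hR)
      (abs_truncate_le hR)).sub (h.tendsto_integral_snd hN (continuous_truncate hR)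
      (abs_truncate_le hR))
    have tendsto_tailWeight := h.tendsto_integral_snd hY.mulStar_self_nonneg
      (continuous_tailWeight hR) (abs_tailWeight_le_one R)
    refine le_of_tendsto_of_tendsto' ((hb.sub tendsto_truncate).pow 2)
      (tendsto_tailWeight.mul hdc) fun i => ?_
    rw [integral_jointLaw_sub (G i) hP hN hPN (continuous_truncate hR).measurable]
    exact (sq_sum_sub_truncate_le hφ hY (G i) hR).trans (mul_le_mul_of_nonneg_left (hd i)
      (integral_nonneg fun p => tailWeight_nonneg R p.2))
  have tendsto_bound := (tendsto_integral_tailWeight_zero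
    (m (hY.mulStar hY) : Measure (Ω × ℝ))).mul_const c
  rw [zero_mul] at tendsto_bound
  have tendsto_sq := squeeze_zero' (Eventually.of_forall fun _ => sq_nonneg _)
    ((eventually_gt_atTop 0).mono fun _ => sq_sub_le) tendsto_bound
  have tendsto_abs := tendsto_sq.sqrt
  simp only [Real.sqrt_sq_eq_abs, Real.sqrt_zero] at tendsto_abs
  rw [tendsto_iff_dist_tendsto_zero]
  simpa only [dist_comm, Real.dist_eq] using tendsto_abs

/-- The second coordinate of `M` is a locally unbiased estimator of `b` with second moment at most
`c`; this is the Cramér–Rao inequality for its truncations. -/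
theorem ofReal_sq_le_mul_fisherInfo (h : I.IsLimitPOVM l G M m)
    (hd : ∀ i, ∫ p, p.2 ^ 2 ∂(I.jointLaw (G i) ρ.op : Measure (Ω × ℝ)) ≤ d i)
    (hdc : Tendsto d l (𝓝 c)) (hφ : IsSLD (ρ.op : H →L[ℂ] H) φ Y) (hY : IsHilbertSchmidt Y)
    (hb : Tendsto (fun i => ∑ y ∈ (G i).values,
      y * (trace ((G i).effect y * (I.toFun Set.univ φ : H →L[ℂ] H))).re) l (𝓝 b)) :
    ENNReal.ofReal (b ^ 2) ≤ ENNReal.ofReal c * fisherInfo M ρ φ := by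
  obtain ⟨P, N, hP, hN, hPN⟩ := hφ.exists_eq_add hY
  refine le_of_tendsto ((ENNReal.continuous_ofReal.tendsto _).comp
    ((h.tendsto_integral_truncate_sub hd hdc hφ hY hP hN hPN hb).pow 2)) ?_
  filter_upwards [eventually_gt_atTop 0] with R hR
  have cramer_rao := (fisherInfo_le_iff (M := M) (ρ := ρ) fun S hS =>
    h.signedLaw_eq_sub hP hN hPN hS).1 le_rfl (fun p => truncate R p.2)
    ((continuous_truncate hR).measurable.comp measurable_snd) ⟨R, fun p => abs_truncate_le hR p.2⟩
  exact cramer_rao.trans (mul_le_mul_left (h.lintegral_truncate_sq_le hd hdc hR) _)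

end IsLimitPOVM

end CPInstrument

end Moments

section MainTheorem

open MeasureTheory Filter Topology

theorem excessError_le_of_forall_le_mul {V : Type*} {D : Set V} {J J' : V → ℝ≥0∞} {b : V → ℝ}
    {c : ℝ≥0∞} (hker : ∀ φ ∈ D, J φ = 0 → b φ = 0) (hc : c ≤ inverseForm D J b)
    (h : ∀ φ ∈ D, ENNReal.ofReal (b φ ^ 2) ≤ c * J' φ) (v : ℝ) :
    excessError D J' b v ≤ excessError D J b v := by
  have hker' (φ : V) (hφ : φ ∈ D) (J_eq_zero : J' φ = 0) : b φ = 0 := by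
    have ofReal_sq_le := h φ hφ
    rw [J_eq_zero, mul_zero, nonpos_iff_eq_zero, ENNReal.ofReal_eq_zero] at ofReal_sq_le
    exact pow_eq_zero_iff two_ne_zero |>.1 (le_antisymm ofReal_sq_le (sq_nonneg _))
  rw [excessError, excessError, if_pos hker, if_pos hker']
  refine EReal.sub_le_sub (EReal.coe_ennreal_le_coe_ennreal_iff.2 ?_) le_rfl
  exact (iSup₂_le fun φ hφ => ENNReal.div_le_of_le_mul (h φ hφ)).trans hc

theorem excessError_ne_top_iff {V : Type*} {D : Set V} {J : V → ℝ≥0∞} {b : V → ℝ} {v : ℝ} :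
    excessError D J b v ≠ ⊤ ↔ (∀ φ ∈ D, J φ = 0 → b φ = 0) ∧ inverseForm D J b ≠ ⊤ := by
  unfold excessError
  split_ifs with hker
  · rw [sub_eq_add_neg, ← EReal.coe_neg, EReal.add_ne_top_iff_ne_top_left (EReal.coe_ne_bot _)
      (EReal.coe_ne_top _), Ne, EReal.coe_ennreal_eq_top_iff]
    exact (and_iff_right hker).symm
  · simp [hker]

variable {H : Type*} [NormedAddCommGroup H] [InnerProductSpace ℂ H] [CompleteSpace H]
  {Ω : Type*} [MeasurableSpace Ω]

/-- The image of a POVM under a measurable map of the outcome spaces. -/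
def POVM.map {Ω' : Type*} [MeasurableSpace Ω'] (M : POVM Ω H) {f : Ω → Ω'} (hf : Measurable f) :
    POVM Ω' H where
  toFun S := M.toFun (f ⁻¹' S)
  nonneg' S hS := M.nonneg' _ (hf hS)
  univ' := M.univ'
  iUnion' s hs hd x y := by
    rw [Set.preimage_iUnion]
    exact M.iUnion' _ (fun i => hf (hs i)) (fun i j hij => (hd hij).preimage f) x y

theorem CPInstrument.exists_povm_of_disturbance_ne_top [TopologicalSpace.SeparableSpace H]
    [TopologicalSpace Ω] [PolishSpace Ω] [BorelSpace Ω] (I : CPInstrument Ω H)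
    (ρ : FaithfulState H) {B : H →ₗ.[ℂ] H} (hB : Dense (B.domain : Set H))
    (hfin : I.disturbance ρ B ≠ ⊤) :
    ∃ M : POVM (Ω × ℝ) H,
      (∀ S, MeasurableSet S → I.inducedPOVM.toFun S = M.toFun (Prod.fst ⁻¹' S)) ∧
      M.error ρ B ≤ I.disturbance ρ B := by
  obtain ⟨hker, hinv⟩ := excessError_ne_top_iff.1 hfin
  obtain ⟨X, c, tendsto_mean, tendsto_var, hc⟩ :=
    (I.completelyPositive' _ .univ).exists_tendsto_expDeriv hker hinv hB
  choose G hG_mean hG_sq using fun n : ℕ =>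
    exists_finiteObservable (X n).2 (Nat.one_div_pos_of_nat (α := ℝ) (n := n))
  have sq_le (n : ℕ) := I.integral_sq_jointLaw_le ρ (hG_sq n)
  have tendsto_sq := tendsto_var.add (tendsto_one_div_add_atTop_nhds_zero_nat.pow 2)
  rw [zero_pow two_ne_zero, add_zero] at tendsto_sq
  obtain ⟨C, hC⟩ := tendsto_sq.bddAbove_range
  obtain ⟨M, m, hM⟩ := I.exists_isLimitPOVM (fun n => (sq_le n).trans (hC ⟨n, rfl⟩))
    (hyperfilter ℕ)
  refine ⟨M, fun S hS => hM.inducedPOVM_apply hS,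
    excessError_le_of_forall_le_mul hker hc (fun φ hφ => ?_) _⟩
  obtain ⟨Y, hY, hs_Y⟩ := sldInfo_lt_top_iff.1 hφ.2.2.1
  refine hM.ofReal_sq_le_mul_fisherInfo sq_le (tendsto_sq.mono_left Nat.hyperfilter_le_atTop)
    hY hs_Y (((tendsto_mean φ hφ).mono_left Nat.hyperfilter_le_atTop).congr fun n => ?_)
  rw [sum_mul_re_trace_mul _ _ _ (I.toFun _ φ).2, hG_mean]

end MainTheorem

end QEst

theorem mainTheorem3_general {H : Type*} [NormedAddCommGroup H] [InnerProductSpace ℂ H]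
    [CompleteSpace H] [TopologicalSpace.SeparableSpace H] {Ω : Type*} [MeasurableSpace Ω]
    [StandardBorelSpace Ω] (ρ : QEst.FaithfulState H) {B : H →ₗ.[ℂ] H}
    (hB : Dense (B.domain : Set H)) (I : QEst.CPInstrument Ω H) :
    ∃ M : QEst.POVM (Ω × ℝ) H,
      (∀ S, MeasurableSet S → I.inducedPOVM.toFun S = M.toFun (Prod.fst ⁻¹' S)) ∧
      M.error ρ B ≤ I.disturbance ρ B := by
  by_cases htop : I.disturbance ρ B = ⊤
  · exact ⟨I.inducedPOVM.map (f := fun ω => (ω, 0)) measurable_prodMk_right, fun _ _ => rfl,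
      le_top.trans_eq htop.symm⟩
  · let := upgradeStandardBorel Ω
    exact I.exists_povm_of_disturbance_ne_top ρ hB htop

theorem mainTheorem3 {H : Type*} [NormedAddCommGroup H] [InnerProductSpace ℂ H] [CompleteSpace H]
    [TopologicalSpace.SeparableSpace H] (ρ : QEst.FaithfulState H) (A B : H →ₗ.[ℂ] H)
    (hA : QEst.IsObservable ρ A) (hB : QEst.IsObservable ρ B)
    (hAA : QEst.MulMemTraceClass (ρ.op : H →L[ℂ] H) (QEst.opMul A A))
    (hBB : QEst.MulMemTraceClass (ρ.op : H →L[ℂ] H) (QEst.opMul B B))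
    (hAB : QEst.MulMemTraceClass (ρ.op : H →L[ℂ] H) (QEst.opMul A B))
    (I : QEst.CPInstrument ℝ H) :
    ∃ M : QEst.POVM (ℝ × ℝ) H,
      I.error ρ A ≥ M.error ρ A ∧ I.disturbance ρ B ≥ M.error ρ B := by
  obtain ⟨M, hfst, hM⟩ := mainTheorem3_general ρ hB.1.dense_domain I
  exact ⟨M, QEst.excessError_anti _ _ fun φ _ =>
    QEst.fisherInfo_le_of_preimage measurable_fst hfst ρ φ, hM⟩
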